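/- Let $M$ be a compact connected complex manifold of complex dimension $n$ with a smooth Hermitian metric $g$. Fix a finite family of holomorphic charts of $M$ together with compact subsets of their domains covering $M$. For functions and tensors on $M\times[0,T)$, $C^{k,l}(M\times[0,T))$ means that in every chart the space derivatives of order $\le k$ and the time derivatives of order $\le l$ of the components exist and are continuous in space and time, and $|\cdot|_{C^{k,l}(M\times[0,T))}$ is the supremum of these derivatives over $[0,T)$ and the fixed compact sets, in the fixed charts. Let $0<\lambda$, $\Lambda\in\mathbb R$ and $K_G,K_\chi,K_0\ge 0$. Then there are positive constants $C_1,C_2,\beta$, depending only on $(M,g)$ (hence on $n$), on the fixed family of charts and compact sets, and on $\lambda,\Lambda,K_G,K_\chi,K_0$, with the following property. Let $0<T\le\infty$, and let $G^{i\bar j}$ be a Hermitian tensor, $\chi^i\partial_i$ a vector field of type $(1,0)$ and $\chi^0$ a real function, all time dependent and of class $C^{3,1}(M\times[0,T))$, with $$\lambda\, g^{i\bar j}\xi_i\bar\xi_{j}\le G^{i\bar j}\xi_i\bar\xi_{j}\le \Lambda\, g^{i\bar j}\xi_i\bar\xi_{j}\quad\text{on } M\times[0,T) \text{ for all } \xi\in\mathbb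 C^n,$$ $$|G^{i\bar j}|_{C^{3,1}(M\times[0,T))}\le K_G,\qquad |\chi^i|_{C^{1,1}(M\times[0,T))}\le K_\chi,\qquad |\chi^0|_{C^{1,1}(M\times[0,T))}\le K_0 .$$ Let $u\in C^{3,2}(M\times[0,T))$ be a positive real function which in local holomorphic coordinates satisfies $$\frac{\partial u}{\partial t}=G^{i\bar j}\partial_i\partial_{\bar j}u+\chi^i\partial_i u+\overline{\chi^i}\,\partial_{\bar i}u+\chi^0u \quad\text{on } M\times[0,T).$$ Then for all $0<t<\tau<T$ $$\sup_{z\in M}u(z,t)\le\Big(\frac{\tau}{t}\Big)^{\beta}\exp\Big(\frac{C_1}{\tau-t}+C_2(\tau-t)\Big)\inf_{z\in M}u(z,\tau).$$ -/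

import Mathlib

open scoped Manifold ContDiff ENNReal NNReal

noncomputable section

namespace HermitianHarnack

/-- The model space `ℂⁿ`. -/
abbrev Cn (n : ℕ) : Type := EuclideanSpace ℂ (Fin n)

section Calculus

/-- The time interval `[0, T)`, where `T` may be `∞`. -/
def timeInterval (T : EReal) : Set ℝ := {t : ℝ | 0 ≤ t ∧ (t : EReal) < T}

variable {n : ℕ}

/-- The Wirtinger derivative `∂F/∂zᵢ = (1/2) (∂F/∂xᵢ - √-1 ∂F/∂yᵢ)`. -/
def wirtinger (i : Fin n) (F : Cn n → ℂ) (z : Cn n) : ℂ :=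
  (1 / 2) * (fderiv ℝ F z (EuclideanSpace.single i 1)
    - Complex.I * fderiv ℝ F z (EuclideanSpace.single i Complex.I))

/-- The Wirtinger derivative `∂F/∂z̄ᵢ = (1/2) (∂F/∂xᵢ + √-1 ∂F/∂yᵢ)`. -/
def wirtingerBar (i : Fin n) (F : Cn n → ℂ) (z : Cn n) : ℂ :=
  (1 / 2) * (fderiv ℝ F z (EuclideanSpace.single i 1)
    + Complex.I * fderiv ℝ F z (EuclideanSpace.single i Complex.I))

/-- `F` is of class `C^{k,l}` on `U × I` (`U` an open set of space variables, `I` an interval of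
times): the space derivatives of order at most `k` and the time derivatives of order at most `l`
exist and are continuous in all variables together. -/
structure IsCkl {V : Type*} [NormedAddCommGroup V] [NormedSpace ℝ V]
    (k l : ℕ) (I : Set ℝ) (U : Set (Cn n)) (F : ℝ → Cn n → V) : Prop where
  space : ∀ t ∈ I, ContDiffOn ℝ k (F t) U
  space_cont : ∀ a ≤ k, ContinuousOn
    (fun p : ℝ × Cn n => iteratedFDeriv ℝ a (F p.1) p.2) (I ×ˢ U)
  time : ∀ z ∈ U, ContDiffOn ℝ l (fun t => F t z) I
  time_cont : ∀ b ≤ l, ContinuousOn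
    (fun p : ℝ × Cn n => iteratedDerivWithin b (fun t => F t p.2) I p.1) (I ×ˢ U)

end Calculus

section Manifold

variable {n : ℕ} {M : Type*} [TopologicalSpace M] [ChartedSpace (Cn n) M]

/-- The holomorphic tangent space of `M` at `x`, a complex vector space (it is identified with
`T^{1,0}` as usual, the vector with coordinates `vⁱ` being `vⁱ ∂/∂zᵢ`). -/
abbrev HTangent (n : ℕ) {M : Type*} [TopologicalSpace M] [ChartedSpace (Cn n) M] (x : M) : Type :=
  TangentSpace 𝓘(ℂ, Cn n) x

/-- The holomorphic cotangent space, the complex dual of `T^{1,0}`. -/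
abbrev HCotangent (n : ℕ) {M : Type*} [TopologicalSpace M] [ChartedSpace (Cn n) M] (x : M) :
    Type :=
  HTangent n x →L[ℂ] ℂ

/-- The coordinate vector field `∂/∂zᵢ` of the chart `φ` at the point with coordinates `z`. -/
def coordVec (φ : OpenPartialHomeomorph M (Cn n)) (z : Cn n) (i : Fin n) :
    HTangent n (φ.symm z) :=
  mfderiv 𝓘(ℂ, Cn n) 𝓘(ℂ, Cn n) φ.symm z (EuclideanSpace.single i (1 : ℂ) : Cn n)

/-- The coordinates `vⁱ = dzᵢ(v)`, in the chart `φ`, of a tangent vector `v` at `x`. -/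
def coords (φ : OpenPartialHomeomorph M (Cn n)) (x : M) : HTangent n x →L[ℂ] Cn n :=
  mfderiv 𝓘(ℂ, Cn n) 𝓘(ℂ, Cn n) φ x

/-- The coordinate covector `dzᵢ` of the chart `φ` at `x`. -/
def coordCovec (φ : OpenPartialHomeomorph M (Cn n)) (x : M) (i : Fin n) : HCotangent n x :=
  (EuclideanSpace.proj i : Cn n →L[ℂ] ℂ).comp (coords φ x)

/-- A smooth Hermitian metric on `M`. Forms are conjugate linear in the first argument. -/
structure HermitianMetric (n : ℕ) (M : Type*) [TopologicalSpace M] [ChartedSpace (Cn n) M] where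
  form : ∀ x : M, HTangent n x →ₗ⋆[ℂ] HTangent n x →ₗ[ℂ] ℂ
  symm : ∀ (x : M) (v w : HTangent n x), (starRingEnd ℂ) (form x v w) = form x w v
  pos : ∀ (x : M) (v : HTangent n x), v ≠ 0 → 0 < (form x v v).re
  smooth : ∀ φ ∈ atlas (Cn n) M, ContDiffOn ℝ ∞
    (fun (z : Cn n) (i j : Fin n) => form (φ.symm z) (coordVec φ z j) (coordVec φ z i)) φ.target

/-- The components `g_{i j̄}` in the chart `φ`. -/
def HermitianMetric.lower (g : HermitianMetric n M) (φ : OpenPartialHomeomorph M (Cn n))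
    (z : Cn n) : Matrix (Fin n) (Fin n) ℂ :=
  Matrix.of fun i j => g.form (φ.symm z) (coordVec φ z j) (coordVec φ z i)

/-- The components `g^{i j̄}` of the dual metric in the chart `φ`, determined by
`∑ⱼ g^{i j̄} g_{k j̄} = δᵢₖ`. -/
def HermitianMetric.upper (g : HermitianMetric n M) (φ : OpenPartialHomeomorph M (Cn n))
    (z : Cn n) : Matrix (Fin n) (Fin n) ℂ :=
  ((g.lower φ z).transpose)⁻¹

/-- A time dependent field of Hermitian forms on the holomorphic cotangent spaces, that is, a
Hermitian tensor `G^{i j̄}`. Forms are conjugate linear in the first argument. -/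
structure HermitianCotensor (n : ℕ) (M : Type*) [TopologicalSpace M] [ChartedSpace (Cn n) M] where
  form : ∀ (_ : ℝ) (x : M), HCotangent n x →ₗ⋆[ℂ] HCotangent n x →ₗ[ℂ] ℂ
  symm : ∀ (t : ℝ) (x : M) (ξ η : HCotangent n x),
    (starRingEnd ℂ) (form t x ξ η) = form t x η ξ

/-- The components `G^{i j̄}` in the chart `φ`. -/
def HermitianCotensor.comp (G : HermitianCotensor n M) (φ : OpenPartialHomeomorph M (Cn n))
    (t : ℝ) (z : Cn n) : Fin n → Fin n → ℂ :=
  fun i j => G.form t (φ.symm z) (coordCovec φ (φ.symm z) j) (coordCovec φ (φ.symm z) i)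

/-- The components `χⁱ`, in the chart `φ`, of a time dependent vector field of type `(1,0)`. -/
def vecComp (χ : ∀ (_ : ℝ) (x : M), HTangent n x) (φ : OpenPartialHomeomorph M (Cn n))
    (t : ℝ) (z : Cn n) : Cn n :=
  coords φ (φ.symm z) (χ t (φ.symm z))

/-- A time dependent real function in the chart `φ`. -/
def funComp (u : ℝ → M → ℝ) (φ : OpenPartialHomeomorph M (Cn n)) (t : ℝ) (z : Cn n) : ℝ :=
  u t (φ.symm z)

/-- An object given by its components in all charts is of class `C^{k,l}` on `M × I`. -/
def IsCklOn {V : Type*} [NormedAddCommGroup V] [NormedSpace ℝ V] (k l : ℕ) (I : Set ℝ)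
    (F : OpenPartialHomeomorph M (Cn n) → ℝ → Cn n → V) : Prop :=
  ∀ φ ∈ atlas (Cn n) M, IsCkl k l I φ.target (F φ)

/-- Finitely many charts and compact subsets of their domains which cover `M`. Such a choice
fixes the `C^{k,l}` norms (which for different choices are equivalent). -/
structure FiniteCover (n : ℕ) (M : Type*) [TopologicalSpace M] [ChartedSpace (Cn n) M] where
  N : ℕ
  chart : Fin N → OpenPartialHomeomorph M (Cn n)
  chart_mem : ∀ α, chart α ∈ atlas (Cn n) M
  K : Fin N → Set M
  isCompact : ∀ α, IsCompact (K α)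
  subset_source : ∀ α, K α ⊆ (chart α).source
  covers : (⋃ α, K α) = Set.univ

/-- The `C^{k,l}` norm on `M × I`, possibly infinite, of an object given by its components: the
supremum, over the points of `I` and of the compact sets of the cover, of the sizes of the space
derivatives of order at most `k` and of the time derivatives of order at most `l`. -/
def cklNorm {V : Type*} [NormedAddCommGroup V] [NormedSpace ℝ V] (A : FiniteCover n M)
    (k l : ℕ) (I : Set ℝ) (F : OpenPartialHomeomorph M (Cn n) → ℝ → Cn n → V) : ℝ≥0∞ :=
  ⨆ α : Fin A.N, ⨆ x ∈ A.K α, ⨆ t ∈ I,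
    ((∑ a ∈ Finset.range (k + 1),
        ‖iteratedFDeriv ℝ a (F (A.chart α) t) (A.chart α x)‖ₑ)
      + ∑ b ∈ Finset.Icc 1 l,
        ‖iteratedDerivWithin b (fun s => F (A.chart α) s (A.chart α x)) I t‖ₑ)

/-- Uniform ellipticity:
`lam g^{i j̄} ξᵢ ξ̄ⱼ ≤ G^{i j̄} ξᵢ ξ̄ⱼ ≤ Lam g^{i j̄} ξᵢ ξ̄ⱼ` for all times in `I`. -/
def UniformlyElliptic (g : HermitianMetric n M) (lam Lam : ℝ) (I : Set ℝ)
    (G : HermitianCotensor n M) : Prop :=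
  ∀ t ∈ I, ∀ φ ∈ atlas (Cn n) M, ∀ z ∈ φ.target, ∀ ξ : Fin n → ℂ,
    lam * (∑ i, ∑ j, g.upper φ z i j * ξ i * (starRingEnd ℂ) (ξ j)).re
        ≤ (∑ i, ∑ j, G.comp φ t z i j * ξ i * (starRingEnd ℂ) (ξ j)).re ∧
    (∑ i, ∑ j, G.comp φ t z i j * ξ i * (starRingEnd ℂ) (ξ j)).re
        ≤ Lam * (∑ i, ∑ j, g.upper φ z i j * ξ i * (starRingEnd ℂ) (ξ j)).re

/-- `u` satisfies, for all times in `I` and in all charts,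
`∂u/∂t = G^{i j̄} ∂ᵢ ∂_{j̄} u + χⁱ ∂ᵢ u + χ̄ⁱ ∂_{ī} u + χ⁰ u`. -/
def IsSolution (I : Set ℝ) (G : HermitianCotensor n M) (χ : ∀ (_ : ℝ) (x : M), HTangent n x)
    (χ₀ : ℝ → M → ℝ) (u : ℝ → M → ℝ) : Prop :=
  ∀ t ∈ I, ∀ φ ∈ atlas (Cn n) M, ∀ z ∈ φ.target,
    ((derivWithin (fun s => u s (φ.symm z)) I t : ℝ) : ℂ) =
      (∑ i, ∑ j, G.comp φ t z i j *
          wirtinger i (wirtingerBar j (fun w => ((funComp u φ t w : ℝ) : ℂ))) z)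
        + (∑ i, vecComp χ φ t z i * wirtinger i (fun w => ((funComp u φ t w : ℝ) : ℂ)) z)
        + (∑ i, (starRingEnd ℂ) (vecComp χ φ t z i) *
            wirtingerBar i (fun w => ((funComp u φ t w : ℝ) : ℂ)) z)
        + ((χ₀ t (φ.symm z) : ℝ) : ℂ) * ((u t (φ.symm z) : ℝ) : ℂ)

end Manifold

end HermitianHarnack

end

/-! Put `f = log u`. In the real coordinates of a chart the equation becomes `f_t = a^{pq} f_{pq} +
|∇f|²_a + b·∇f + c`, with `a` a real symmetric matrix that is uniformly elliptic on compact sets.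
The heart of the matter is the Li–Yau estimate `t (|∇f|²_a - 2 f_t) ≤ C (t + 1)`, with `C` depending
only on the fixed data (`exists_liYau_estimate`). Integrating it along a segment traversed at
constant speed in a chart bounds `f(t, x) - f(τ, y)` for nearby points
(`IsLogSolution.sub_le_of_liYau`). Halving the time interval chains such bounds, and compactness and
connectedness of `M` make the constant uniform (`exists_uniform_of_local`). Exponentiating gives the
theorem.

The gradient estimate comes from the maximum principle. The regularity gives `f_t` only one space
derivative, so `f_t` is replaced by the forward quotient `S = (f(t+h) - f(t))/h`. At a maximum of `t
P` with `P = |∇f|²_a - 2 S`, the third derivatives of `f` coming from the time derivative and from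
the second order operator cancel, and the convexity of the quadratic gradient term gives the
discretization error a favourable sign. What survives is a good term comparable to `|D²f|²`, bounded
by lower order terms plus `P/t`. The factor 2 in front of `S` matters: the equation then gives `P +
|∇f|²_a ≤ M (1 + |∇f| + |D²f|)`, so `|∇f|²` is controlled by `1 + |D²f|`, and hence `P² ≤ c + c'
P/t`. These steps are `exists_bound_of_max_conditions` and `exists_bound_of_quadratic_system`. The
constant does not see `h`, so `h → 0` is harmless.

The maximum is taken over the whole of `M`, which makes sense because `|∇f|²_a` is the `G`-norm of
`∂f` and so independent of the chart (`gradSq_eq_of_mem_source`). It is then analysed in a chart of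
the cover whose compact set contains the maximum point. -/

namespace HermitianHarnack

open Set Filter Topology

/-! ### Directional derivatives and second order conditions at a local maximum -/

section DirectionalDerivative

variable {E : Type*} [NormedAddCommGroup E] [NormedSpace ℝ E]

/-- The derivative of `g` at `z` in the direction `v`. -/
noncomputable def dird (v : E) (g : E → ℝ) (z : E) : ℝ := fderiv ℝ g z v

theorem dird_congr {v : E} {g k : E → ℝ} {z : E} (h : g =ᶠ[𝓝 z] k) : dird v g z = dird v k z := by
  rw [dird, dird, h.fderiv_eq]

theorem dird_add {v : E} {g k : E → ℝ} {z : E} (hg : DifferentiableAt ℝ g z)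
    (hk : DifferentiableAt ℝ k z) :
    dird v (fun w => g w + k w) z = dird v g z + dird v k z := by
  simp [dird, fderiv_fun_add hg hk]

theorem dird_mul {v : E} {g k : E → ℝ} {z : E} (hg : DifferentiableAt ℝ g z)
    (hk : DifferentiableAt ℝ k z) :
    dird v (fun w => g w * k w) z = dird v g z * k z + g z * dird v k z := by
  simp [dird, fderiv_fun_mul hg hk]; ring

theorem dird_sum {ι : Type*} {s : Finset ι} {v : E} {g : ι → E → ℝ} {z : E}
    (hg : ∀ i ∈ s, DifferentiableAt ℝ (g i) z) :
    dird v (fun w => ∑ i ∈ s, g i w) z = ∑ i ∈ s, dird v (g i) z := by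
  simp [dird, fderiv_fun_sum hg]

theorem dird_sum_vec {ι : Type*} [Fintype ι] (c : ι → ℝ) (e : ι → E) (g : E → ℝ) (z : E) :
    dird (∑ i, c i • e i) g z = ∑ i, c i * dird (e i) g z := by
  simp [dird]

theorem differentiableAt_dird {v : E} {g : E → ℝ} {z : E} (hg : ContDiffAt ℝ 2 g z) :
    DifferentiableAt ℝ (dird v g) z := by
  have h : ContDiffAt ℝ 1 (fderiv ℝ g) z := hg.fderiv_right (by norm_num)
  exact (h.differentiableAt (by norm_num)).clm_apply (differentiableAt_const v)

theorem contDiffOn_dird {v : E} {g : E → ℝ} {U : Set E} (hU : IsOpen U) {k : ℕ}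
    (hg : ContDiffOn ℝ (k + 1 : ℕ) g U) : ContDiffOn ℝ k (dird v g) U :=
  (hg.fderiv_of_isOpen hU (by norm_cast)).clm_apply contDiffOn_const

theorem dird_comm {v w : E} {g : E → ℝ} {z : E} (hg : ContDiffAt ℝ 2 g z) :
    dird v (dird w g) z = dird w (dird v g) z := by
  have h : ContDiffAt ℝ 1 (fderiv ℝ g) z := hg.fderiv_right (by norm_num)
  have hd := h.differentiableAt (by norm_num)
  have key : ∀ a b : E, dird a (dird b g) z = fderiv ℝ (fderiv ℝ g) z a b := by
    intro a b
    have : dird b g = fun y => fderiv ℝ g y b := rfl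
    rw [dird, this, fderiv_clm_apply hd (differentiableAt_const b)]
    simp
  rw [key, key]
  exact (hg.isSymmSndFDerivAt (by simp)) v w

theorem dird_eq_zero_of_isLocalMax {v : E} {g : E → ℝ} {z : E} (h : IsLocalMax g z) :
    dird v g z = 0 := by
  simp [dird, h.fderiv_eq_zero]

/-- Restrict to the line through `z` in direction `v`. A positive second derivative would make `0` a
local minimum as well as a local maximum, so the restriction would be locally constant and its
second derivative zero. -/
theorem dird_dird_nonpos_of_isLocalMax {v : E} {g : E → ℝ} {z : E} (hg : ContDiffAt ℝ 2 g z)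
    (hmax : IsLocalMax g z) : dird v (dird v g) z ≤ 0 := by
  by_contra! hpos
  have hline : Tendsto (fun s : ℝ => z + s • v) (𝓝 0) (𝓝 z) := by
    have : Continuous fun s : ℝ => z + s • v := by fun_prop
    simpa using this.tendsto 0
  have hderiv : ∀ (k : E → ℝ) (s : ℝ), DifferentiableAt ℝ k (z + s • v) →
      HasDerivAt (fun r : ℝ => k (z + r • v)) (dird v k (z + s • v)) s := by
    intro k s hk
    have h1 : HasDerivAt (fun r : ℝ => z + r • v) v s := by
      simpa using ((hasDerivAt_id s).smul_const v).const_add z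
    exact hk.hasFDerivAt.comp_hasDerivAt s h1
  have hnear : ∀ᶠ y in 𝓝 z, DifferentiableAt ℝ g y := by
    filter_upwards [hg.eventually (by simp)] with y hy using hy.differentiableAt (by norm_num)
  have hd1 : deriv (fun r : ℝ => g (z + r • v)) =ᶠ[𝓝 0] fun r => dird v g (z + r • v) := by
    filter_upwards [hline.eventually hnear] with s hs using (hderiv g s hs).deriv
  have hd2 : deriv (deriv fun r : ℝ => g (z + r • v)) 0 = dird v (dird v g) z := by
    rw [hd1.deriv_eq]
    have := hderiv (dird v g) 0 (by simpa using differentiableAt_dird hg)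
    simpa using this.deriv
  have hd0 : deriv (fun r : ℝ => g (z + r • v)) 0 = 0 := by
    rw [hd1.eq_of_nhds]
    simpa using dird_eq_zero_of_isLocalMax hmax
  have hcont : ContinuousAt (fun r : ℝ => g (z + r • v)) 0 :=
    (hderiv g 0 (by simpa using hg.differentiableAt (by norm_num))).continuousAt
  have hmin := isLocalMin_of_deriv_deriv_pos (by rw [hd2]; exact hpos) hd0 hcont
  have hconst : (fun r : ℝ => g (z + r • v)) =ᶠ[𝓝 0] fun _ => g z := by
    filter_upwards [hmin, hline.eventually hmax] with s h1 h2
    have h1 : g (z + (0 : ℝ) • v) ≤ g (z + s • v) := h1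
    rw [zero_smul, add_zero] at h1
    exact le_antisymm h2 h1
  have : deriv (deriv fun r : ℝ => g (z + r • v)) 0 = 0 := by
    rw [hconst.deriv.deriv_eq]; simp
  linarith

/-- A nonnegative form is a sum of squares of linear forms. This reduces trace inequalities to
inequalities along single directions, without simultaneous diagonalization. -/
theorem exists_factor_of_nonneg {ι : Type*} [Fintype ι] {A : ι → ι → ℝ}
    (hs : ∀ p q, A p q = A q p) (hA : ∀ ξ : ι → ℝ, 0 ≤ ∑ p, ∑ q, A p q * ξ p * ξ q) :
    ∃ (m : ℕ) (B : Fin m → ι → ℝ), ∀ p q, A p q = ∑ k, B k p * B k q := by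
  classical
  have hpsd : (Matrix.of A).PosSemidef := by
    refine Matrix.PosSemidef.of_dotProduct_mulVec_nonneg ?_ ?_
    · ext p q; simp [hs p q]
    · intro x
      refine (hA x).trans_eq ?_
      simp only [dotProduct, Matrix.mulVec, Matrix.of_apply, Finset.mul_sum, star_trivial]
      exact Finset.sum_congr rfl fun p _ => Finset.sum_congr rfl fun q _ => by ring
  obtain ⟨m, B, hB⟩ := Matrix.posSemidef_iff_eq_sum_vecMulVec.mp hpsd
  refine ⟨m, B, fun p q => ?_⟩
  have := congrFun (congrFun hB p) q
  simpa [Matrix.sum_apply, Matrix.vecMulVec_apply] using this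

/-- After factoring `A`, the operator is a sum of pure second derivatives along the vectors `∑ p, B
k p • e p`, each of which is nonpositive. -/
theorem sum_dird_dird_nonpos_of_isLocalMax {ι : Type*} [Fintype ι] {A : ι → ι → ℝ}
    (hs : ∀ p q, A p q = A q p) (hA : ∀ ξ : ι → ℝ, 0 ≤ ∑ p, ∑ q, A p q * ξ p * ξ q)
    (e : ι → E) {g : E → ℝ} {z : E} (hg : ContDiffAt ℝ 2 g z) (hmax : IsLocalMax g z) :
    ∑ p, ∑ q, A p q * dird (e p) (dird (e q) g) z ≤ 0 := by
  obtain ⟨m, B, hB⟩ := exists_factor_of_nonneg hs hA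
  have key : ∀ k, dird (∑ p, B k p • e p) (dird (∑ p, B k p • e p) g) z
      = ∑ p, ∑ q, B k p * B k q * dird (e p) (dird (e q) g) z := by
    intro k
    have h1 : dird (∑ p, B k p • e p) g = fun w => ∑ q, B k q * dird (e q) g w :=
      funext fun w => dird_sum_vec _ _ _ _
    rw [dird_sum_vec, h1]
    refine Finset.sum_congr rfl fun p _ => ?_
    rw [dird_sum fun q _ => (differentiableAt_dird hg).const_mul _, Finset.mul_sum]
    refine Finset.sum_congr rfl fun q _ => ?_
    rw [dird_mul (differentiableAt_const _) (differentiableAt_dird hg)]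
    simp only [dird, fderiv_fun_const, Pi.zero_apply, _root_.zero_apply]
    ring
  calc ∑ p, ∑ q, A p q * dird (e p) (dird (e q) g) z
      = ∑ k, dird (∑ p, B k p • e p) (dird (∑ p, B k p • e p) g) z := by
        simp_rw [key, hB, Finset.sum_mul]
        rw [Finset.sum_comm]
        simp_rw [Finset.sum_comm (s := (Finset.univ : Finset (Fin m)))]
        rw [Finset.sum_comm]
    _ ≤ 0 := Finset.sum_nonpos fun k _ => dird_dird_nonpos_of_isLocalMax hg hmax

/-- Interchange of the time derivative with one space derivative. No second order differentiability
in time and space together is available, so the mean value inequality is applied to the mixed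
difference of `f`, first in space to `Φ` and then in time to `f`. -/
theorem hasDerivAt_dird_of_hasDerivAt {f Φ : ℝ → E → ℝ} {t₀ : ℝ} {z₀ v : E}
    (hf : ∀ᶠ p : ℝ × E in 𝓝 (t₀, z₀), HasDerivAt (fun t => f t p.2) (Φ p.1 p.2) p.1)
    (hfd : ∀ᶠ t in 𝓝 t₀, DifferentiableAt ℝ (f t) z₀)
    (hΦ : ∀ᶠ p : ℝ × E in 𝓝 (t₀, z₀), DifferentiableAt ℝ (Φ p.1) p.2)
    (hc : ContinuousAt (fun p : ℝ × E => dird v (Φ p.1) p.2) (t₀, z₀)) :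
    HasDerivAt (fun t => dird v (f t) z₀) (dird v (Φ t₀) z₀) t₀ := by
  set L := dird v (Φ t₀) z₀ with hL
  have hline : ∀ s : ℝ, HasDerivAt (fun r : ℝ => z₀ + r • v) v s := fun s => by
    simpa using ((hasDerivAt_id s).smul_const v).const_add z₀
  rw [hasDerivAt_iff_isLittleO, Asymptotics.isLittleO_iff]
  intro ε hε
  have hLε : ∀ᶠ p : ℝ × E in 𝓝 (t₀, z₀), |dird v (Φ p.1) p.2 - L| ≤ ε := by
    have := hc.eventually (Metric.closedBall_mem_nhds _ hε)
    simpa [Real.dist_eq] using this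
  have hmap : Tendsto (fun p : ℝ × ℝ => ((p.1, z₀ + p.2 • v) : ℝ × E)) (𝓝 (t₀, 0))
      (𝓝 (t₀, z₀)) := by
    have : Continuous fun p : ℝ × ℝ => ((p.1, z₀ + p.2 • v) : ℝ × E) := by fun_prop
    simpa using this.tendsto (t₀, 0)
  obtain ⟨δ, hδ, hball⟩ := Metric.eventually_nhds_iff_ball.1
    ((hmap.eventually hf).and ((hmap.eventually hΦ).and (hmap.eventually hLε)))
  have hmem : ∀ t s : ℝ, |t - t₀| < δ → |s| < δ → (t, s) ∈ Metric.ball (t₀, (0 : ℝ)) δ := by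
    intro t s ht hs
    simp [Prod.dist_eq, Real.dist_eq, ht, hs]
  filter_upwards [hfd, Metric.ball_mem_nhds t₀ hδ] with t hft ht
  rw [Metric.mem_ball, Real.dist_eq] at ht
  have hs_diff : ∀ s : ℝ, |s| < δ → ∀ r : ℝ, |r - t₀| < δ →
      |Φ r (z₀ + s • v) - Φ r z₀ - s * L| ≤ ε * |s| := by
    intro s hs r hr
    have hd : ∀ x ∈ Metric.ball (0 : ℝ) δ, HasDerivWithinAt
        (fun x : ℝ => Φ r (z₀ + x • v) - x * L) (dird v (Φ r) (z₀ + x • v) - L)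
        (Metric.ball 0 δ) x := by
      intro x hx
      rw [Metric.mem_ball, Real.dist_eq, sub_zero] at hx
      have h1 := (hball _ (hmem r x hr hx)).2.1
      have h2 := h1.hasFDerivAt.comp_hasDerivAt x (hline x)
      exact ((h2.fun_sub ((hasDerivAt_id x).mul_const L)).congr_deriv
        (by simp [dird])).hasDerivWithinAt
    have hb : ∀ x ∈ Metric.ball (0 : ℝ) δ, ‖dird v (Φ r) (z₀ + x • v) - L‖ ≤ ε := by
      intro x hx
      rw [Metric.mem_ball, Real.dist_eq, sub_zero] at hx
      exact (hball _ (hmem r x hr hx)).2.2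
    have := (convex_ball (0 : ℝ) δ).norm_image_sub_le_of_norm_hasDerivWithin_le hd hb
      (Metric.mem_ball_self hδ) (by simpa using hs : s ∈ Metric.ball (0 : ℝ) δ)
    simp only [Real.norm_eq_abs, zero_smul, add_zero, zero_mul, sub_zero] at this
    convert this using 2
    ring
  have ht_diff : ∀ s : ℝ, |s| < δ →
      |(f t (z₀ + s • v) - f t₀ (z₀ + s • v)) - (f t z₀ - f t₀ z₀) - (t - t₀) * (s * L)|
        ≤ (ε * |t - t₀|) * |s| := by
    intro s hs
    have hd : ∀ r ∈ Metric.ball t₀ δ, HasDerivWithinAt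
        (fun r : ℝ => f r (z₀ + s • v) - f r z₀ - r * (s * L))
        (Φ r (z₀ + s • v) - Φ r z₀ - s * L) (Metric.ball t₀ δ) r := by
      intro r hr
      rw [Metric.mem_ball, Real.dist_eq] at hr
      have h1 := (hball _ (hmem r s hr hs)).1
      have h2 := (hball _ (hmem r 0 hr (by simpa using hδ))).1
      simp only [zero_smul, add_zero] at h2
      exact (((h1.fun_sub h2).fun_sub ((hasDerivAt_id r).mul_const (s * L))).congr_deriv
        (by simp)).hasDerivWithinAt
    have hb : ∀ r ∈ Metric.ball t₀ δ, ‖Φ r (z₀ + s • v) - Φ r z₀ - s * L‖ ≤ ε * |s| := by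
      intro r hr
      rw [Metric.mem_ball, Real.dist_eq] at hr
      exact hs_diff s hs r hr
    have := (convex_ball t₀ δ).norm_image_sub_le_of_norm_hasDerivWithin_le hd hb
      (Metric.mem_ball_self hδ) (by simpa [Real.dist_eq] using ht : t ∈ Metric.ball t₀ δ)
    simp only [Real.norm_eq_abs] at this
    calc _ = |f t (z₀ + s • v) - f t z₀ - t * (s * L)
          - (f t₀ (z₀ + s • v) - f t₀ z₀ - t₀ * (s * L))| := by congr 1; ring
      _ ≤ _ := this
      _ = _ := by ring
  have hft₀ : DifferentiableAt ℝ (f t₀) z₀ := hfd.self_of_nhds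
  have hcomp : ∀ r, DifferentiableAt ℝ (f r) z₀ →
      HasDerivAt (fun s : ℝ => f r (z₀ + s • v)) (dird v (f r) z₀) 0 := by
    intro r hr
    have h0 : HasFDerivAt (f r) (fderiv ℝ (f r) z₀) (z₀ + (0 : ℝ) • v) := by
      simpa using hr.hasFDerivAt
    exact h0.comp_hasDerivAt 0 (hline 0)
  -- Dividing the mixed difference bound by `s` and letting `s → 0` turns it into a bound for the
  -- increment of the directional derivative.
  have hlim : HasDerivAt (fun s : ℝ => f t (z₀ + s • v) - f t₀ (z₀ + s • v) - (t - t₀) * (s * L))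
      (dird v (f t) z₀ - dird v (f t₀) z₀ - (t - t₀) * (1 * L)) 0 :=
    ((hcomp t hft).sub (hcomp t₀ hft₀)).sub (((hasDerivAt_id 0).mul_const L).const_mul (t - t₀))
  have := hlim.le_of_lip' (C := ε * |t - t₀|) (by positivity) (by
    filter_upwards [Metric.ball_mem_nhds (0 : ℝ) hδ] with s hs
    rw [Metric.mem_ball, Real.dist_eq, sub_zero] at hs
    refine le_trans (le_of_eq ?_) ((ht_diff s hs).trans_eq ?_)
    · rw [Real.norm_eq_abs]; congr 1; simp; ring
    · simp)
  simpa [Real.norm_eq_abs, smul_eq_mul] using this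

end DirectionalDerivative

/-! ### Joint continuity of iterated space derivatives -/

section JointRegularity

variable {E : Type*} [NormedAddCommGroup E] [NormedSpace ℝ E] {ι : Type*}

/-- The iterated directional derivatives of `g` in the directions `e i`, up to the given order,
exist and are continuous in time and space together. -/
def JointC (e : ι → E) (I : Set ℝ) (U : Set E) : ℕ → (ℝ → E → ℝ) → Prop
  | 0, g => ContinuousOn (fun p : ℝ × E => g p.1 p.2) (I ×ˢ U)
  | k + 1, g => ContinuousOn (fun p : ℝ × E => g p.1 p.2) (I ×ˢ U) ∧
      (∀ t ∈ I, ∀ z ∈ U, DifferentiableAt ℝ (g t) z) ∧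
      ∀ i, JointC e I U k (fun t z => dird (e i) (g t) z)

variable {e : ι → E} {I : Set ℝ} {U : Set E}

theorem JointC.continuousOn {k : ℕ} {g : ℝ → E → ℝ} (h : JointC e I U k g) :
    ContinuousOn (fun p : ℝ × E => g p.1 p.2) (I ×ˢ U) := by
  cases k with
  | zero => exact h
  | succ k => exact h.1

theorem JointC.differentiableAt {k : ℕ} {g : ℝ → E → ℝ} (h : JointC e I U (k + 1) g) {t : ℝ}
    (ht : t ∈ I) {z : E} (hz : z ∈ U) : DifferentiableAt ℝ (g t) z := h.2.1 t ht z hz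

theorem JointC.dird {k : ℕ} {g : ℝ → E → ℝ} (h : JointC e I U (k + 1) g) (i : ι) :
    JointC e I U k (fun t z => dird (e i) (g t) z) := h.2.2 i

theorem JointC.of_succ {k : ℕ} {g : ℝ → E → ℝ} (h : JointC e I U (k + 1) g) :
    JointC e I U k g := by
  induction k generalizing g with
  | zero => exact h.1
  | succ k ih => exact ⟨h.1, h.2.1, fun i => ih (h.2.2 i)⟩

theorem JointC.congr (hU : IsOpen U) {k : ℕ} {g g' : ℝ → E → ℝ} (h : JointC e I U k g)
    (hgg : ∀ t ∈ I, ∀ z ∈ U, g' t z = g t z) : JointC e I U k g' := by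
  induction k generalizing g g' with
  | zero => exact ContinuousOn.congr h fun p hp => hgg p.1 hp.1 p.2 hp.2
  | succ k ih =>
    have hev : ∀ t ∈ I, ∀ z ∈ U, g' t =ᶠ[𝓝 z] g t := fun t ht z hz => by
      filter_upwards [hU.mem_nhds hz] with w hw using hgg t ht w hw
    exact ⟨h.1.congr fun p hp => hgg p.1 hp.1 p.2 hp.2,
      fun t ht z hz => (h.2.1 t ht z hz).congr_of_eventuallyEq (hev t ht z hz),
      fun i => ih (h.2.2 i) fun t ht z hz => dird_congr (hev t ht z hz)⟩

theorem JointC.add (hU : IsOpen U) {k : ℕ} {g g' : ℝ → E → ℝ} (h : JointC e I U k g)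
    (h' : JointC e I U k g') : JointC e I U k (fun t z => g t z + g' t z) := by
  induction k generalizing g g' with
  | zero => exact ContinuousOn.add h h'
  | succ k ih =>
    refine ⟨h.1.add h'.1, fun t ht z hz => (h.2.1 t ht z hz).add (h'.2.1 t ht z hz), fun i => ?_⟩
    exact (ih (h.2.2 i) (h'.2.2 i)).congr hU fun t ht z hz =>
      dird_add (h.2.1 t ht z hz) (h'.2.1 t ht z hz)

theorem JointC.mul (hU : IsOpen U) {k : ℕ} {g g' : ℝ → E → ℝ} (h : JointC e I U k g)
    (h' : JointC e I U k g') : JointC e I U k (fun t z => g t z * g' t z) := by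
  induction k generalizing g g' with
  | zero => exact ContinuousOn.mul h h'
  | succ k ih =>
    refine ⟨h.1.mul h'.1, fun t ht z hz => (h.2.1 t ht z hz).mul (h'.2.1 t ht z hz), fun i => ?_⟩
    exact ((ih (h.2.2 i) h'.of_succ).add hU (ih h.of_succ (h'.2.2 i))).congr hU fun t ht z hz =>
      dird_mul (h.2.1 t ht z hz) (h'.2.1 t ht z hz)

theorem JointC.const {k : ℕ} (c : ℝ) : JointC e I U k (fun _ _ => c) := by
  induction k generalizing c with
  | zero => exact continuousOn_const
  | succ k ih =>
    refine ⟨continuousOn_const, fun t _ z _ => differentiableAt_const c, fun i => ?_⟩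
    simpa [HermitianHarnack.dird] using ih 0

theorem JointC.sum (hU : IsOpen U) {κ : Type*} (s : Finset κ) {k : ℕ} {g : κ → ℝ → E → ℝ}
    (h : ∀ j ∈ s, JointC e I U k (g j)) : JointC e I U k (fun t z => ∑ j ∈ s, g j t z) := by
  classical
  induction s using Finset.induction_on with
  | empty => simpa using JointC.const 0
  | insert j s hj ih =>
    simp only [Finset.sum_insert hj]
    exact (h j (by simp)).add hU (ih fun i hi => h i (by simp [hi]))

/-- The derivative of `g⁻¹` is `-g⁻¹ · g⁻¹ · ∂g`, which involves the inverse itself at one order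
less, so the induction closes through the product rule. -/
theorem JointC.inv (hU : IsOpen U) {k : ℕ} {g : ℝ → E → ℝ} (h : JointC e I U k g)
    (h0 : ∀ t ∈ I, ∀ z ∈ U, g t z ≠ 0) : JointC e I U k (fun t z => (g t z)⁻¹) := by
  induction k generalizing g with
  | zero => exact ContinuousOn.inv₀ h fun p hp => h0 p.1 hp.1 p.2 hp.2
  | succ k ih =>
    refine ⟨h.1.inv₀ fun p hp => h0 p.1 hp.1 p.2 hp.2,
      fun t ht z hz => (h.2.1 t ht z hz).inv (h0 t ht z hz), fun i => ?_⟩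
    have hi := ih h.of_succ h0
    refine ((((JointC.const (-1)).mul hU hi).mul hU hi).mul hU (h.2.2 i)).congr hU
      fun t ht z hz => ?_
    have := ((hasDerivAt_inv (h0 t ht z hz)).comp_hasFDerivAt z
      (h.2.1 t ht z hz).hasFDerivAt).fderiv
    simp only [Function.comp_def] at this
    rw [HermitianHarnack.dird, this]
    simp only [HermitianHarnack.dird, smul_apply, smul_eq_mul]
    field_simp

theorem dird_log {v : E} {g : E → ℝ} {z : E} (hg : DifferentiableAt ℝ g z) (h0 : g z ≠ 0) :
    dird v (fun w => Real.log (g w)) z = (g z)⁻¹ * dird v g z := by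
  rw [dird, (hg.hasFDerivAt.log h0).fderiv]
  simp [dird]

theorem JointC.log (hU : IsOpen U) {k : ℕ} {g : ℝ → E → ℝ} (h : JointC e I U k g)
    (h0 : ∀ t ∈ I, ∀ z ∈ U, g t z ≠ 0) : JointC e I U k (fun t z => Real.log (g t z)) := by
  cases k with
  | zero => exact ContinuousOn.log h fun p hp => h0 p.1 hp.1 p.2 hp.2
  | succ k =>
    refine ⟨h.1.log fun p hp => h0 p.1 hp.1 p.2 hp.2,
      fun t ht z hz => (h.2.1 t ht z hz).log (h0 t ht z hz), fun i => ?_⟩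
    exact ((h.of_succ.inv hU h0).mul hU (h.2.2 i)).congr hU fun t ht z hz =>
      dird_log (h.2.1 t ht z hz) (h0 t ht z hz)

/-- Joint continuity of the space derivatives up to order `k`. -/
def SpaceC {V : Type*} [NormedAddCommGroup V] [NormedSpace ℝ V] (k : ℕ) (I : Set ℝ) (U : Set E)
    (F : ℝ → E → V) : Prop :=
  (∀ t ∈ I, ContDiffOn ℝ k (F t) U) ∧
    ∀ a ≤ k, ContinuousOn (fun p : ℝ × E => iteratedFDeriv ℝ a (F p.1) p.2) (I ×ˢ U)

theorem SpaceC.fderiv {V : Type*} [NormedAddCommGroup V] [NormedSpace ℝ V] {k : ℕ}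
    (hU : IsOpen U) {F : ℝ → E → V} (h : SpaceC (k + 1) I U F) :
    SpaceC k I U (fun t z => fderiv ℝ (F t) z) := by
  refine ⟨fun t ht => (h.1 t ht).fderiv_of_isOpen hU (by norm_cast), fun a ha => ?_⟩
  have h1 := h.2 (a + 1) (by omega)
  simp only [iteratedFDeriv_succ_eq_comp_right] at h1
  have h2 := (continuousMultilinearCurryRightEquiv' ℝ a E V).symm.symm.continuous.comp_continuousOn h1
  refine h2.congr fun p _ => ?_
  simp

theorem SpaceC.clm {V W : Type*} [NormedAddCommGroup V] [NormedSpace ℝ V] [NormedAddCommGroup W]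
    [NormedSpace ℝ W] {k : ℕ} (hU : IsOpen U) {F : ℝ → E → V} (h : SpaceC k I U F) (l : V →L[ℝ] W) :
    SpaceC k I U (fun t z => l (F t z)) := by
  refine ⟨fun t ht => l.contDiff.comp_contDiffOn (h.1 t ht), fun a ha => ?_⟩
  have h1 := ((ContinuousLinearMap.compContinuousMultilinearMapL ℝ (fun _ : Fin a => E) V W) l
    ).continuous.comp_continuousOn (h.2 a ha)
  refine h1.congr fun p hp => ?_
  have := ContinuousLinearMap.iteratedFDeriv_comp_left (f := F p.1) (i := a) l
    (((h.1 p.1 hp.1).contDiffAt (hU.mem_nhds hp.2)).of_le (by exact_mod_cast ha)) le_rfl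
  exact this

theorem SpaceC.jointC {k : ℕ} (hU : IsOpen U) {F : ℝ → E → ℝ} (h : SpaceC k I U F) :
    JointC e I U k F := by
  have h0 : ContinuousOn (fun p : ℝ × E => F p.1 p.2) (I ×ˢ U) := by
    have := (continuousMultilinearCurryFin0 ℝ E ℝ).continuous.comp_continuousOn (h.2 0 (Nat.zero_le _))
    exact this.congr fun p _ => by simp
  induction k generalizing F with
  | zero => exact h0
  | succ k ih =>
    refine ⟨h0, fun t ht z hz => ((h.1 t ht).contDiffAt (hU.mem_nhds hz)).differentiableAt
      (by simp), fun i => ?_⟩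
    have h1 := (h.fderiv hU).clm hU (ContinuousLinearMap.apply ℝ ℝ (e i))
    refine ih h1 ?_
    have := (continuousMultilinearCurryFin0 ℝ E ℝ).continuous.comp_continuousOn (h1.2 0 (Nat.zero_le _))
    exact this.congr fun p _ => by simp [HermitianHarnack.dird]

end JointRegularity

/-! ### Estimates for bilinear forms and traces -/

section BilinearSums

variable {ι : Type*} [Fintype ι]

/-- The value on `x`, `y` of the bilinear form with matrix `m`. -/
def bil (m : ι → ι → ℝ) (x y : ι → ℝ) : ℝ := ∑ p, ∑ q, m p q * x p * y q

/-- The contraction of two matrices. -/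
def tr₂ (m w : ι → ι → ℝ) : ℝ := ∑ p, ∑ q, m p q * w p q

/-- The contraction of two vectors. -/
def dot (b x : ι → ℝ) : ℝ := ∑ p, b p * x p

/-- The `ℓ¹` norm of a vector. -/
def l₁ (x : ι → ℝ) : ℝ := ∑ p, |x p|

theorem l₁_nonneg (x : ι → ℝ) : 0 ≤ l₁ x := Finset.sum_nonneg fun _ _ => abs_nonneg _

theorem abs_dot_le {K : ℝ} {b : ι → ℝ} (hb : ∀ p, |b p| ≤ K) (x : ι → ℝ) :
    |dot b x| ≤ K * l₁ x := by
  rw [dot, l₁, Finset.mul_sum]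
  refine (Finset.abs_sum_le_sum_abs _ _).trans (Finset.sum_le_sum fun p _ => ?_)
  rw [abs_mul]
  exact mul_le_mul_of_nonneg_right (hb p) (abs_nonneg _)

theorem abs_tr₂_le {K : ℝ} {m : ι → ι → ℝ} (hm : ∀ p q, |m p q| ≤ K) (w : ι → ι → ℝ) :
    |tr₂ m w| ≤ K * ∑ p, l₁ (w p) := by
  rw [tr₂, Finset.mul_sum]
  exact (Finset.abs_sum_le_sum_abs _ _).trans
    (Finset.sum_le_sum fun p _ => abs_dot_le (hm p) (w p))

theorem abs_bil_le {K : ℝ} {m : ι → ι → ℝ} (hm : ∀ p q, |m p q| ≤ K) (x y : ι → ℝ) :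
    |bil m x y| ≤ K * l₁ x * l₁ y := by
  have h := abs_tr₂_le hm fun p q => x p * y q
  have h1 : tr₂ m (fun p q => x p * y q) = bil m x y := by simp only [tr₂, bil, mul_assoc]
  have h2 : ∑ p, l₁ (fun q => x p * y q) = l₁ x * l₁ y := by
    simp only [l₁, abs_mul, Finset.sum_mul_sum]
  rw [h1, h2] at h
  linarith

theorem bil_comm {m : ι → ι → ℝ} (hm : ∀ p q, m p q = m q p) (x y : ι → ℝ) :
    bil m x y = bil m y x := by
  rw [bil, bil, Finset.sum_comm]
  exact Finset.sum_congr rfl fun p _ => Finset.sum_congr rfl fun q _ => by rw [hm q p]; ring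

theorem bil_add_left (m : ι → ι → ℝ) (x x' y : ι → ℝ) :
    bil m (fun p => x p + x' p) y = bil m x y + bil m x' y := by
  simp only [bil, ← Finset.sum_add_distrib]
  exact Finset.sum_congr rfl fun p _ => Finset.sum_congr rfl fun q _ => by ring

theorem bil_smul_left (m : ι → ι → ℝ) (r : ℝ) (x y : ι → ℝ) :
    bil m (fun p => r * x p) y = r * bil m x y := by
  simp only [bil, Finset.mul_sum]
  exact Finset.sum_congr rfl fun p _ => Finset.sum_congr rfl fun q _ => by ring

theorem bil_add_right (m : ι → ι → ℝ) (x y y' : ι → ℝ) :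
    bil m x (fun p => y p + y' p) = bil m x y + bil m x y' := by
  simp only [bil, ← Finset.sum_add_distrib]
  exact Finset.sum_congr rfl fun p _ => Finset.sum_congr rfl fun q _ => by ring

theorem bil_smul_right (m : ι → ι → ℝ) (r : ℝ) (x y : ι → ℝ) :
    bil m x (fun p => r * y p) = r * bil m x y := by
  simp only [bil, Finset.mul_sum]
  exact Finset.sum_congr rfl fun p _ => Finset.sum_congr rfl fun q _ => by ring

theorem tr₂_add_right (m w w' : ι → ι → ℝ) :
    tr₂ m (fun p q => w p q + w' p q) = tr₂ m w + tr₂ m w' := by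
  simp only [tr₂, ← Finset.sum_add_distrib]
  exact Finset.sum_congr rfl fun p _ => Finset.sum_congr rfl fun q _ => by ring

theorem tr₂_smul_right (m : ι → ι → ℝ) (r : ℝ) (w : ι → ι → ℝ) :
    tr₂ m (fun p q => r * w p q) = r * tr₂ m w := by
  simp only [tr₂, Finset.mul_sum]
  exact Finset.sum_congr rfl fun p _ => Finset.sum_congr rfl fun q _ => by ring

theorem tr₂_bil_left (m a : ι → ι → ℝ) (w : ι → ι → ι → ℝ) (y : ι → ℝ) :
    tr₂ m (fun r s => bil a (w r s) y) = bil a (fun p => tr₂ m (fun r s => w r s p)) y := by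
  simp only [tr₂, bil, Finset.mul_sum, Finset.sum_mul]
  calc _ = ∑ r, ∑ p, ∑ q, ∑ s, m r s * (a p q * w r s p * y q) := by
        refine Finset.sum_congr rfl fun r _ => ?_
        rw [Finset.sum_comm]
        exact Finset.sum_congr rfl fun p _ => Finset.sum_comm
    _ = ∑ p, ∑ q, ∑ r, ∑ s, m r s * (a p q * w r s p * y q) := by
        rw [Finset.sum_comm]
        exact Finset.sum_congr rfl fun p _ => Finset.sum_comm
    _ = _ := by
        refine Finset.sum_congr rfl fun p _ => Finset.sum_congr rfl fun q _ =>
          Finset.sum_congr rfl fun r _ => Finset.sum_congr rfl fun s _ => by ring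

theorem tr₂_swap {m : ι → ι → ℝ} (hm : ∀ p q, m p q = m q p) (w : ι → ι → ℝ) :
    tr₂ m (fun r s => w s r) = tr₂ m w := by
  rw [tr₂, tr₂, Finset.sum_comm]
  exact Finset.sum_congr rfl fun p _ => Finset.sum_congr rfl fun q _ => by rw [hm]

theorem l₁_sq_le (x : ι → ℝ) : l₁ x ^ 2 ≤ (Fintype.card ι : ℝ) * ∑ p, x p ^ 2 := by
  have := sq_sum_le_card_mul_sum_sq (s := (Finset.univ : Finset ι)) (f := fun p => |x p|)
  simpa [l₁, sq_abs] using this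

theorem sum_l₁_sq_le (w : ι → ι → ℝ) :
    (∑ p, l₁ (w p)) ^ 2 ≤ (Fintype.card ι : ℝ) ^ 2 * ∑ p, ∑ q, w p q ^ 2 := by
  have h1 := sq_sum_le_card_mul_sum_sq (s := (Finset.univ : Finset ι)) (f := fun p => l₁ (w p))
  have h2 : ∑ p, l₁ (w p) ^ 2 ≤ ∑ p, (Fintype.card ι : ℝ) * ∑ q, w p q ^ 2 :=
    Finset.sum_le_sum fun p _ => l₁_sq_le _
  rw [← Finset.mul_sum] at h2
  calc _ ≤ (Fintype.card ι : ℝ) * ∑ p, l₁ (w p) ^ 2 := by simpa using h1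
    _ ≤ (Fintype.card ι : ℝ) * ((Fintype.card ι : ℝ) * ∑ p, ∑ q, w p q ^ 2) :=
        mul_le_mul_of_nonneg_left h2 (Nat.cast_nonneg _)
    _ = _ := by ring

/-- This is the coercivity of the good Hessian term in the Bochner computation. With `a = ∑ₖ Bₖ Bₖᵀ`
the left-over trace is a sum of `a`-squares of the vectors `∑ₛ Bₖₛ wₛ`. Ellipticity is used twice:
on these vectors, and on the columns of `w`. -/
theorem le_tr₂_bil_of_elliptic {κ : ℝ} (hκ : 0 < κ) {a : ι → ι → ℝ}
    (ha : ∀ p q, a p q = a q p) (hell : ∀ ξ : ι → ℝ, κ * ∑ p, ξ p ^ 2 ≤ bil a ξ ξ)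
    (w : ι → ι → ℝ) :
    κ ^ 2 * ∑ p, ∑ q, w p q ^ 2 ≤ tr₂ a (fun r s => bil a (w s) (w r)) := by
  have hnn : ∀ ξ : ι → ℝ, 0 ≤ ∑ p, ∑ q, a p q * ξ p * ξ q := fun ξ =>
    (mul_nonneg hκ.le (Finset.sum_nonneg fun _ _ => sq_nonneg _)).trans (hell ξ)
  obtain ⟨m, B, hB⟩ := exists_factor_of_nonneg ha hnn
  have h1 : ∀ x : ι → ι → ℝ, tr₂ a (fun r s => bil a (x s) (x r))
      = ∑ k, bil a (fun p => ∑ s, B k s * x s p) (fun p => ∑ s, B k s * x s p) := by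
    intro x
    have : ∀ k, bil a (fun p => ∑ s, B k s * x s p) (fun p => ∑ s, B k s * x s p)
        = ∑ r, ∑ s, B k r * B k s * bil a (x s) (x r) := by
      intro k
      simp only [bil, Finset.mul_sum, Finset.sum_mul]
      calc _ = ∑ p, ∑ r, ∑ s, ∑ q, a p q * (B k s * x s p) * (B k r * x r q) := by
            refine Finset.sum_congr rfl fun p _ => ?_
            rw [Finset.sum_comm]
            exact Finset.sum_congr rfl fun r _ => Finset.sum_comm
        _ = ∑ r, ∑ s, ∑ p, ∑ q, a p q * (B k s * x s p) * (B k r * x r q) := by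
            rw [Finset.sum_comm]
            exact Finset.sum_congr rfl fun r _ => Finset.sum_comm
        _ = _ := by
            refine Finset.sum_congr rfl fun p _ => Finset.sum_congr rfl fun q _ =>
              Finset.sum_congr rfl fun r _ => Finset.sum_congr rfl fun s _ => by ring
    have hfac : ∀ X : ι → ι → ℝ, tr₂ a X = ∑ k, ∑ r, ∑ s, B k r * B k s * X r s := by
      intro X
      simp only [tr₂, hB, Finset.sum_mul]
      rw [Finset.sum_comm (s := (Finset.univ : Finset (Fin m)))]
      exact Finset.sum_congr rfl fun r _ => Finset.sum_comm
    rw [hfac]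
    exact Finset.sum_congr rfl fun k _ => (this k).symm
  have h2 : ∀ p, κ * ∑ q, w q p ^ 2 ≤ ∑ k, (∑ s, B k s * w s p) ^ 2 := by
    intro p
    refine (hell fun q => w q p).trans_eq ?_
    simp only [bil, hB, Finset.sum_mul, sq]
    calc _ = ∑ r, ∑ k, ∑ s, B k r * B k s * w r p * w s p :=
          Finset.sum_congr rfl fun r _ => Finset.sum_comm
      _ = ∑ k, ∑ r, ∑ s, B k r * B k s * w r p * w s p := Finset.sum_comm
      _ = _ := by
        refine Finset.sum_congr rfl fun k _ => ?_
        rw [← Finset.sum_mul, Finset.sum_mul_sum]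
        exact Finset.sum_congr rfl fun r _ => Finset.sum_congr rfl fun s _ => by ring
  rw [h1]
  calc κ ^ 2 * ∑ p, ∑ q, w p q ^ 2 = κ * ∑ p, κ * ∑ q, w q p ^ 2 := by
        rw [← Finset.mul_sum, Finset.sum_comm]; ring
    _ ≤ κ * ∑ p, ∑ k, (∑ s, B k s * w s p) ^ 2 :=
        mul_le_mul_of_nonneg_left (Finset.sum_le_sum fun p _ => h2 p) hκ.le
    _ = ∑ k, κ * ∑ p, (∑ s, B k s * w s p) ^ 2 := by
        rw [Finset.sum_comm, Finset.mul_sum]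
    _ ≤ _ := Finset.sum_le_sum fun k _ => hell _

end BilinearSums

/-- Here `X`, `Y`, `Q` stand for `|∇f|`, `|D²f|`, `|∇f|²_a`. Since `P > 0`, the last two
inequalities give `X² ≤ A (1 + Y)`. The first then yields `Y² ≤ const + 2P/(κt)` by absorption, and
`P ≤ c₂ (1 + Y)` turns this into a quadratic inequality for `t P`. -/
theorem exists_bound_of_quadratic_system {κ M : ℝ} (hκ : 0 < κ) (hM : 0 ≤ M) :
    ∃ C : ℝ, 0 < C ∧ ∀ X Y P Q t : ℝ, 0 ≤ X → 0 ≤ Y → 0 < P → 0 < t →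
      κ * Y ^ 2 ≤ M * (1 + X + Y + X ^ 2 + X * Y) + P / t →
      P + Q ≤ M * (1 + X + Y) → κ * X ^ 2 ≤ Q → t * P ≤ C * (t + 1) := by
  set m := M / κ with hm
  have hm0 : 0 ≤ m := by positivity
  set A := 2 * m + m ^ 2 with hA
  have hA0 : 0 ≤ A := by positivity
  set c₁ := m * (2 + 2 * A) + m + m ^ 2 * A with hc₁
  have hc₁0 : 0 ≤ c₁ := by positivity
  set c₂ := M * (2 + A) with hc₂
  have hc₂0 : 0 ≤ c₂ := by positivity
  set c₃ := 2 * c₂ ^ 2 * (2 * (c₁ ^ 2 + c₁) + 1) with hc₃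
  have hc₃0 : 0 ≤ c₃ := by positivity
  set c₄ := 2 * c₂ ^ 2 * (2 / κ) with hc₄
  have hc₄0 : 0 ≤ c₄ := by positivity
  refine ⟨1 + 2 * c₃ + c₄, by positivity, ?_⟩
  intro X Y P Q t hX hY hP ht h1 h2 h3
  have hMm : M = κ * m := by rw [hm]; field_simp
  have e1 : X ^ 2 ≤ A * (1 + Y) := by
    have : κ * X ^ 2 ≤ κ * (m * (1 + X + Y)) := by rw [← mul_assoc, ← hMm]; linarith
    have h4 := le_of_mul_le_mul_left this hκ
    have h5 : (X - m) ^ 2 = X ^ 2 - 2 * (m * X) + m ^ 2 := by ring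
    have h6 : A * (1 + Y) = 2 * m + 2 * (m * Y) + m ^ 2 + m ^ 2 * Y := by rw [hA]; ring
    have h7 : m * (1 + X + Y) = m + m * X + m * Y := by ring
    linarith [sq_nonneg (X - m), mul_nonneg (sq_nonneg m) hY]
  have hX1 : X ≤ 1 + X ^ 2 := by nlinarith [sq_nonneg (X - 1)]
  set R := P / (κ * t) with hR
  have e2 : Y ^ 2 ≤ m * (1 + X + Y + X ^ 2 + X * Y) + R := by
    have : κ * Y ^ 2 ≤ κ * (m * (1 + X + Y + X ^ 2 + X * Y) + R) := by
      have hR' : κ * R = P / t := by rw [hR]; field_simp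
      rw [mul_add, hR', ← mul_assoc, ← hMm]; exact h1
    exact le_of_mul_le_mul_left this hκ
  -- The products `m X Y` and `c₁ Y` each cost a quarter of `Y²`, which leaves half of it on the
  -- left.
  have e3 : Y ^ 2 ≤ 2 * (c₁ ^ 2 + c₁) + 2 * R := by
    have i1 : m * (X * Y) ≤ Y ^ 2 / 4 + m ^ 2 * X ^ 2 := by
      have : (Y / 2 - m * X) ^ 2 = Y ^ 2 / 4 - m * (X * Y) + m ^ 2 * X ^ 2 := by ring
      linarith [sq_nonneg (Y / 2 - m * X)]
    have i2 : m ^ 2 * X ^ 2 ≤ m ^ 2 * (A * (1 + Y)) := mul_le_mul_of_nonneg_left e1 (sq_nonneg m)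
    have i3 : m * (X + X ^ 2) ≤ m * (1 + 2 * (A * (1 + Y))) :=
      mul_le_mul_of_nonneg_left (by linarith) hm0
    have i4 : c₁ * Y ≤ Y ^ 2 / 4 + c₁ ^ 2 := by linarith [sq_nonneg (Y / 2 - c₁), sub_sq (Y / 2) c₁]
    have i5 : (3 / 4) * Y ^ 2 ≤ c₁ * (1 + Y) + R := by
      have j1 : c₁ * (1 + Y) = 3 * m + 3 * (m * Y) + 2 * (m * (A * (1 + Y)))
        + m ^ 2 * (A * (1 + Y)) := by rw [hc₁]; ring
      have j2 : m * (1 + X + Y + X ^ 2 + X * Y) = m + m * (X + X ^ 2) + m * Y + m * (X * Y) := by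
        ring
      have j3 : m * (1 + 2 * (A * (1 + Y))) = m + 2 * (m * (A * (1 + Y))) := by ring
      have j4 := mul_nonneg hm0 hY
      clear_value c₁ A
      linarith
    linarith
  have e4 : P ≤ c₂ * (1 + Y) := by
    have hQ : 0 ≤ Q := le_trans (by positivity) h3
    have : M * (1 + X + Y) ≤ M * (2 + A * (1 + Y) + Y) :=
      mul_le_mul_of_nonneg_left (by linarith) hM
    have h5 : M * (2 + A * (1 + Y) + Y) ≤ c₂ * (1 + Y) := by
      have h6 : c₂ * (1 + Y) = 2 * M + 2 * (M * Y) + M * (A * (1 + Y)) := by rw [hc₂]; ring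
      have h7 : M * (2 + A * (1 + Y) + Y) = 2 * M + M * (A * (1 + Y)) + M * Y := by ring
      linarith [mul_nonneg hM hY]
    linarith
  have e5 : P ^ 2 ≤ c₃ + c₄ * (P / t) := by
    have i1 : P ^ 2 ≤ (c₂ * (1 + Y)) ^ 2 := pow_le_pow_left₀ hP.le e4 2
    have i2 : (1 + Y) ^ 2 ≤ 2 * (2 * (c₁ ^ 2 + c₁) + 2 * R + 1) := by
      have j1 : (1 + Y) ^ 2 = 1 + 2 * Y + Y ^ 2 := by ring
      have j2 : (Y - 1) ^ 2 = Y ^ 2 - 2 * Y + 1 := by ring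
      linarith [sq_nonneg (Y - 1)]
    have i3 : c₂ ^ 2 * (1 + Y) ^ 2 ≤ c₂ ^ 2 * (2 * (2 * (c₁ ^ 2 + c₁) + 2 * R + 1)) :=
      mul_le_mul_of_nonneg_left i2 (sq_nonneg _)
    have i4 : c₄ * (P / t) = 2 * c₂ ^ 2 * (2 * R) := by rw [hc₄, hR]; field_simp
    rw [i4]
    have i5 : (c₂ * (1 + Y)) ^ 2 = c₂ ^ 2 * (1 + Y) ^ 2 := by ring
    have i6 : c₂ ^ 2 * (2 * (2 * (c₁ ^ 2 + c₁) + 2 * R + 1)) = c₃ + 2 * c₂ ^ 2 * (2 * R) := by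
      rw [hc₃]; ring
    linarith
  have e6 : (t * P) ^ 2 ≤ c₃ * t ^ 2 + c₄ * (t * P) := by
    have := mul_le_mul_of_nonneg_left e5 (sq_nonneg t)
    have h6 : t ^ 2 * (c₃ + c₄ * (P / t)) = c₃ * t ^ 2 + c₄ * (t * P) := by field_simp
    rw [h6] at this
    linarith [mul_pow t P 2]
  have hw : 0 < t * P := mul_pos ht hP
  -- If `t P > C (t + 1)`, then both `t²` and `t P` are at most `(t + 1) t P`, and `C = 1 + 2 c₃ +
  -- c₄` contradicts `e6`.
  by_contra! hlt
  have ht1 : (0 : ℝ) < t + 1 := by linarith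
  have j1 : t + 1 ≤ t * P := by
    have : 1 * (t + 1) ≤ (1 + 2 * c₃ + c₄) * (t + 1) :=
      mul_le_mul_of_nonneg_right (by linarith) ht1.le
    linarith
  have j2 : (1 + 2 * c₃ + c₄) * (t + 1) * (t * P) < (t * P) ^ 2 := by
    rw [sq]; exact mul_lt_mul_of_pos_right hlt hw
  have j3 : c₃ * t ^ 2 ≤ c₃ * ((t + 1) * (t * P)) := by
    refine mul_le_mul_of_nonneg_left ?_ hc₃0
    rw [sq]
    exact mul_le_mul (by linarith) (by linarith) ht.le ht1.le
  have j4 : c₄ * (t * P) ≤ c₄ * ((t + 1) * (t * P)) := by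
    refine mul_le_mul_of_nonneg_left ?_ hc₄0
    exact le_mul_of_one_le_left hw.le (by linarith)
  have j5 : (1 + 2 * c₃ + c₄) * (t + 1) * (t * P)
      = (t + 1) * (t * P) + 2 * (c₃ * ((t + 1) * (t * P))) + c₄ * ((t + 1) * (t * P)) := by ring
  have j6 := mul_pos ht1 hw
  have j7 := mul_nonneg hc₃0 j6.le
  linarith

/-! ### Algebra at a maximum of the discretized Li–Yau quantity -/

section MaximumAlgebra

/-- Each monomial in `X`, `Y` that occurs is at most `Z = 1 + X + Y + X² + XY`. No `Y²` occurs among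
the errors, and that is what allows the good Hessian term to win. -/
theorem max_condition_error_le {K N X Y : ℝ} (hK : 0 ≤ K) (hN0 : 0 ≤ N) (hX0 : 0 ≤ X)
    (hY0 : 0 ≤ Y) :
    (K ^ 2 * N ^ 2 * X ^ 2 + 4 * (K ^ 2 * N * (X * Y))
        + 2 * (K ^ 2 * N * (X * Y)) + 2 * (K ^ 2 * N * X ^ 2) + 2 * (K ^ 2 * (X * Y))
        + 2 * (K ^ 2 * N * X) + K * X ^ 2 + K ^ 2 * N * X ^ 2 + 2 * (K ^ 2 * (X * Y))
        + 2 * (K * Y) + 2 * (K * N ^ 2) + 2 * (K * X ^ 2) + 4 * (K * N * X) + 2 * (K * N ^ 2)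
        + 2 * (K * X) + 2 * (K * N) + 2 * K) ≤
      (K ^ 2 * N ^ 2 + 9 * (K ^ 2 * N) + 4 * K ^ 2 + 11 * K + 4 * (K * N ^ 2)
      + 6 * (K * N) + (2 * K ^ 2 * N + 2 * K + 2)) * (1 + X + Y + X ^ 2 + X * Y) := by
  obtain ⟨Z, hZ⟩ : ∃ Z, Z = 1 + X + Y + X ^ 2 + X * Y := ⟨_, rfl⟩
  have hXY := mul_nonneg hX0 hY0
  have z0 : 1 ≤ Z := by rw [hZ]; nlinarith [sq_nonneg X]
  have z1 : X ≤ Z := by rw [hZ]; nlinarith [sq_nonneg X]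
  have z2 : Y ≤ Z := by rw [hZ]; nlinarith [sq_nonneg X]
  have z3 : X ^ 2 ≤ Z := by rw [hZ]; nlinarith [sq_nonneg X]
  have z4 : X * Y ≤ Z := by rw [hZ]; nlinarith [sq_nonneg X]
  have hK2 := sq_nonneg K
  have hK2N := mul_nonneg hK2 hN0
  have hKN := mul_nonneg hK hN0
  have hKN2 := mul_nonneg hK (sq_nonneg N)
  have hK2N2 := mul_nonneg hK2 (sq_nonneg N)
  have y1 := mul_le_mul_of_nonneg_left z3 hK2N2
  have y2 := mul_le_mul_of_nonneg_left z4 hK2N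
  have y3 := mul_le_mul_of_nonneg_left z3 hK2N
  have y4 := mul_le_mul_of_nonneg_left z4 hK2
  have y5 := mul_le_mul_of_nonneg_left z1 hK2N
  have y6 := mul_le_mul_of_nonneg_left z3 hK
  have y7 := mul_le_mul_of_nonneg_left z2 hK
  have y8 := mul_le_mul_of_nonneg_left z0 hKN2
  have y9 := mul_le_mul_of_nonneg_left z1 hKN
  have y10 := mul_le_mul_of_nonneg_left z1 hK
  have y11 := mul_le_mul_of_nonneg_left z0 hKN
  have y12 := mul_le_mul_of_nonneg_left z0 hK
  have hMZ : (K ^ 2 * N ^ 2 + 9 * (K ^ 2 * N) + 4 * K ^ 2 + 11 * K + 4 * (K * N ^ 2)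
      + 6 * (K * N) + (2 * K ^ 2 * N + 2 * K + 2)) * Z = K ^ 2 * N ^ 2 * Z + 11 * (K ^ 2 * N * Z) + 4 * (K ^ 2 * Z) + 13 * (K * Z)
      + 4 * (K * N ^ 2 * Z) + 6 * (K * N * Z) + 2 * Z := by ring
  rw [← hZ, hMZ]
  linarith only [y1, y2, y3, y4, y5, y6, y7, y8, y9, y10, y11, y12, z0, mul_nonneg hK (zero_le_one.trans z0)]

variable {ι : Type*} [Fintype ι]

theorem l₁_le_card_mul {K : ℝ} {x : ι → ℝ} (hx : ∀ p, |x p| ≤ K) :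
    l₁ x ≤ Fintype.card ι * K := by
  have := Finset.sum_le_card_nsmul (Finset.univ : Finset ι) (fun p => |x p|) K fun p _ => hx p
  simpa [l₁] using this

theorem l₁_le_of_abs_sub_le {x y : ι → ℝ} (h : ∀ p, |y p - x p| ≤ 1) :
    l₁ y ≤ l₁ x + Fintype.card ι := by
  have : l₁ y ≤ ∑ p : ι, (|x p| + 1) := Finset.sum_le_sum fun p _ => by
    have h1 := abs_add_le (y p - x p) (x p)
    rw [sub_add_cancel] at h1
    linarith [h p]
  simpa [l₁, Finset.sum_add_distrib] using this

/-- Convexity of the quadratic form: the difference quotient exceeds the derivative by `h · bil a S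
S ≥ 0`, so the unknown size of `S` does no harm. -/
theorem bil_sq_add_ge {a : ι → ι → ℝ} (ha : ∀ p q, a p q = a q p)
    (hnn : ∀ ξ : ι → ℝ, 0 ≤ bil a ξ ξ) {h : ℝ} (hh : 0 < h) {f g S : ι → ℝ}
    (hg : ∀ p, g p = f p + h * S p) :
    2 * bil a S f ≤ (bil a g g - bil a f f) / h := by
  have hg' : g = fun p => f p + h * S p := funext hg
  have : bil a g g = bil a f f + 2 * (h * bil a S f) + h * (h * bil a S S) := by
    rw [hg', bil_add_left, bil_add_right, bil_add_right, bil_smul_left, bil_smul_right,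
      bil_smul_left, bil_smul_right, bil_comm ha f S]
    ring
  rw [le_div_iff₀ hh, this]
  nlinarith [mul_nonneg hh.le (mul_nonneg hh.le (hnn S))]

/-- The pointwise core of the maximum principle, with derivatives treated as independent numbers.
The letters `f`, `g` denote the solution at times `t`, `t + h`, and `S` the difference quotient,
with subscripts counting space derivatives. The prefixes `d`, `t`, `s` denote space derivatives,
time derivatives and difference quotients of the coefficients. The tolerances `1` say that `h` is
small, and `C` does not depend on `h`. -/
theorem exists_bound_of_max_conditions (ι : Type*) [Fintype ι] {κ K : ℝ} (hκ : 0 < κ)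
    (hK : 0 ≤ K) :
    ∃ C : ℝ, 0 < C ∧ ∀ (a ta sa : ι → ι → ℝ) (da : ι → ι → ι → ℝ) (dda : ι → ι → ι → ι → ℝ)
      (b sb : ι → ℝ) (db : ι → ι → ℝ) (c sc : ℝ) (dc : ι → ℝ)
      (f₁ g₁ S₁ Q₁ Φ₁ : ι → ℝ) (f₂ g₂ S₂ Q₂ : ι → ι → ℝ) (f₃ : ι → ι → ι → ℝ)
      (h t P S Qt St : ℝ),
      (∀ p q, a p q = a q p) → (∀ ξ : ι → ℝ, κ * ∑ p, ξ p ^ 2 ≤ bil a ξ ξ) →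
      (∀ p q, |a p q| ≤ K) → (∀ p q, |ta p q| ≤ K) → (∀ p q, |sa p q| ≤ K) →
      (∀ r p q, |da r p q| ≤ K) → (∀ r s p q, |dda r s p q| ≤ K) →
      (∀ p, |b p| ≤ K) → (∀ p, |sb p| ≤ K) → (∀ r p, |db r p| ≤ K) →
      |c| ≤ K → |sc| ≤ K → (∀ r, |dc r| ≤ K) →
      (∀ r s p, f₃ r s p = f₃ p r s) →
      (∀ p, |g₁ p - f₁ p| ≤ 1) → (∀ p q, |g₂ p q - f₂ p q| ≤ 1) →
      0 < h → (∀ p, g₁ p = f₁ p + h * S₁ p) →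
      (∀ r, Q₁ r = bil (da r) f₁ f₁ + 2 * bil a (f₂ r) f₁) →
      (∀ r s, Q₂ r s = bil (dda r s) f₁ f₁ + 2 * bil (da s) (f₂ r) f₁
        + 2 * bil (da r) (f₂ s) f₁ + 2 * bil a (f₃ r s) f₁ + 2 * bil a (f₂ s) (f₂ r)) →
      (∀ r, Φ₁ r = tr₂ (da r) f₂ + tr₂ a (f₃ r) + Q₁ r + dot (db r) f₁ + dot b (f₂ r) + dc r) →
      Qt = bil ta f₁ f₁ + 2 * bil a Φ₁ f₁ →
      St = tr₂ sa g₂ + tr₂ a S₂ + (bil sa g₁ g₁ + (bil a g₁ g₁ - bil a f₁ f₁) / h)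
        + dot sb g₁ + dot b S₁ + sc →
      |S - (tr₂ a f₂ + bil a f₁ f₁ + dot b f₁ + c)| ≤ 1 →
      P = bil a f₁ f₁ - 2 * S → 0 < P → 0 < t →
      (∀ r, Q₁ r = 2 * S₁ r) → tr₂ a Q₂ - 2 * tr₂ a S₂ ≤ 0 → 0 ≤ P + t * (Qt - 2 * St) →
      t * P ≤ C * (t + 1) := by
  set N : ℝ := ((Fintype.card ι : ℕ) : ℝ) with hN
  have hN0 : 0 ≤ N := Nat.cast_nonneg _
  -- The two entries convert `ℓ²` coercivity of the Hessian and of the gradient into `ℓ¹`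
  -- coercivity. The added `1` covers an empty index type.
  set κ' := min (2 * κ ^ 2 / (N ^ 2 + 1)) (κ / (N + 1)) with hκ'
  have hκ'0 : 0 < κ' := lt_min (by positivity) (by positivity)
  set M := K ^ 2 * N ^ 2 + 9 * (K ^ 2 * N) + 4 * K ^ 2 + 11 * K + 4 * (K * N ^ 2) + 6 * (K * N)
    + (2 * K ^ 2 * N + 2 * K + 2) with hM
  have hM0 : 0 ≤ M := by positivity
  obtain ⟨C, hC, hbound⟩ := exists_bound_of_quadratic_system hκ'0 hM0
  refine ⟨C, hC, ?_⟩
  intro a ta sa da dda b sb db c sc dc f₁ g₁ S₁ Q₁ Φ₁ f₂ g₂ S₂ Q₂ f₃ h t P S Qt St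
    ha hell ka kta ksa kda kdda kb ksb kdb kc ksc kdc hf₃ hg₁ hg₂ hh hgS hQ₁ hQ₂ hΦ₁ hQt hSt
    hSΦ hP hP0 ht hgrad hlap htime
  have hnn : ∀ ξ : ι → ℝ, 0 ≤ bil a ξ ξ := fun ξ =>
    (mul_nonneg hκ.le (Finset.sum_nonneg fun _ _ => sq_nonneg _)).trans (hell ξ)
  set X := l₁ f₁ with hX
  set Y := ∑ p, l₁ (f₂ p) with hY
  have hX0 : 0 ≤ X := l₁_nonneg _
  have hY0 : 0 ≤ Y := Finset.sum_nonneg fun _ _ => l₁_nonneg _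
  refine hbound X Y P (bil a f₁ f₁) t hX0 hY0 hP0 ht ?_ ?_ ?_
  · have hQ₂' : tr₂ a Q₂ = tr₂ a (fun r s => bil (dda r s) f₁ f₁)
        + 4 * tr₂ a (fun r s => bil (da s) (f₂ r) f₁)
        + 2 * bil a (fun p => tr₂ a (f₃ p)) f₁
        + 2 * tr₂ a (fun r s => bil a (f₂ s) (f₂ r)) := by
      have : Q₂ = fun r s => bil (dda r s) f₁ f₁ + 2 * bil (da s) (f₂ r) f₁
        + 2 * bil (da r) (f₂ s) f₁ + 2 * bil a (f₃ r s) f₁ + 2 * bil a (f₂ s) (f₂ r) :=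
        funext fun r => funext fun s => hQ₂ r s
      -- Symmetry of `a` merges the two mixed terms, and commuting derivatives through `hf₃` puts
      -- the third order term in the form in which it occurs in `Φ₁`.
      rw [this, tr₂_add_right, tr₂_add_right, tr₂_add_right, tr₂_add_right, tr₂_smul_right,
        tr₂_smul_right, tr₂_smul_right, tr₂_smul_right, tr₂_bil_left,
        tr₂_swap ha (fun r s => bil (da s) (f₂ r) f₁)]
      simp_rw [fun r s p => hf₃ r s p]
      ring
    have hΦ' : bil a Φ₁ f₁ = bil a (fun r => tr₂ (da r) f₂) f₁ + bil a (fun r => tr₂ a (f₃ r)) f₁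
        + bil a Q₁ f₁ + bil a (fun r => dot (db r) f₁) f₁ + bil a (fun r => dot b (f₂ r)) f₁
        + bil a dc f₁ := by
      rw [funext hΦ₁, bil_add_left, bil_add_left, bil_add_left, bil_add_left, bil_add_left]
    have hconv := bil_sq_add_ge ha hnn hh hgS
    have hQS : 2 * bil a S₁ f₁ = bil a Q₁ f₁ := by
      rw [funext hgrad, bil_smul_left]
    have hH := le_tr₂_bil_of_elliptic hκ ha hell f₂
    have hYH : κ' * Y ^ 2 ≤ 2 * tr₂ a (fun r s => bil a (f₂ s) (f₂ r)) := by
      have h1 := sum_l₁_sq_le f₂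
      have h0 : 0 ≤ ∑ p, ∑ q, f₂ p q ^ 2 :=
        Finset.sum_nonneg fun _ _ => Finset.sum_nonneg fun _ _ => sq_nonneg _
      calc κ' * Y ^ 2 ≤ 2 * κ ^ 2 / (N ^ 2 + 1) * Y ^ 2 :=
            mul_le_mul_of_nonneg_right (min_le_left _ _) (sq_nonneg _)
        _ ≤ 2 * κ ^ 2 / (N ^ 2 + 1) * ((N ^ 2 + 1) * ∑ p, ∑ q, f₂ p q ^ 2) := by
            refine mul_le_mul_of_nonneg_left ?_ (by positivity)
            linarith
        _ = 2 * (κ ^ 2 * ∑ p, ∑ q, f₂ p q ^ 2) := by field_simp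
        _ ≤ _ := by linarith
    have hl : ∀ x : ι → ℝ, ∀ B : ℝ, (∀ p, |x p| ≤ B) → l₁ x ≤ N * B := fun x B hx =>
      l₁_le_card_mul hx
    have E1 : |tr₂ a (fun r s => bil (dda r s) f₁ f₁)| ≤ K * (N * (N * (K * X * X))) := by
      refine (abs_tr₂_le ka _).trans (mul_le_mul_of_nonneg_left ?_ hK)
      have : ∀ r ∈ Finset.univ, l₁ (fun s => bil (dda r s) f₁ f₁) ≤ N * (K * X * X) :=
        fun r _ => hl _ _ fun s => abs_bil_le (kdda r s) _ _
      simpa using Finset.sum_le_card_nsmul _ _ _ this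
    have E2 : |tr₂ a (fun r s => bil (da s) (f₂ r) f₁)| ≤ K * (N * (K * Y * X)) := by
      refine (abs_tr₂_le ka _).trans (mul_le_mul_of_nonneg_left ?_ hK)
      have : ∀ r ∈ Finset.univ, l₁ (fun s => bil (da s) (f₂ r) f₁) ≤ N * (K * l₁ (f₂ r) * X) :=
        fun r _ => hl _ _ fun s => abs_bil_le (kda s) _ _
      refine (Finset.sum_le_sum this).trans_eq ?_
      rw [hY]
      simp only [Finset.mul_sum, Finset.sum_mul]
    have hb : ∀ (x : ι → ℝ) (B : ℝ), l₁ x ≤ B → |bil a x f₁| ≤ K * B * X := fun x B hx =>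
      (abs_bil_le ka _ _).trans
        (mul_le_mul_of_nonneg_right (mul_le_mul_of_nonneg_left hx hK) hX0)
    have E3 := hb (fun r => tr₂ (da r) f₂) _ (hl _ _ fun r => abs_tr₂_le (kda r) f₂)
    have E4 := hb (fun r => dot (db r) f₁) _ (hl _ _ fun r => abs_dot_le (kdb r) f₁)
    have hdotb : l₁ (fun r => dot b (f₂ r)) ≤ K * Y := by
      rw [hY, Finset.mul_sum]
      exact Finset.sum_le_sum fun r _ => abs_dot_le kb (f₂ r)
    have E5 := hb (fun r => dot b (f₂ r)) _ hdotb
    have E6 := hb dc _ (hl _ _ kdc)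
    have E7 := abs_bil_le kta f₁ f₁
    have hlQ : l₁ Q₁ ≤ N * (K * X * X) + 2 * (K * Y * X) := by
      have : ∀ r ∈ Finset.univ, |Q₁ r| ≤ K * X * X + 2 * (K * l₁ (f₂ r) * X) := fun r _ => by
        rw [hQ₁]
        refine (abs_add_le _ _).trans (add_le_add (abs_bil_le (kda r) _ _) ?_)
        rw [abs_mul, abs_two]
        exact mul_le_mul_of_nonneg_left (abs_bil_le ka _ _) (by norm_num)
      refine (Finset.sum_le_sum this).trans_eq ?_
      rw [Finset.sum_add_distrib, hY]
      simp only [Finset.mul_sum, Finset.sum_mul, Finset.sum_const, Finset.card_univ,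
        nsmul_eq_mul, hN]
    have hdotS : 2 * dot b S₁ = dot b Q₁ := by
      simp only [dot, Finset.mul_sum, hgrad]
      exact Finset.sum_congr rfl fun _ _ => by ring
    have E8 : |dot b Q₁| ≤ K * (N * (K * X * X) + 2 * (K * Y * X)) :=
      (abs_dot_le kb _).trans (mul_le_mul_of_nonneg_left hlQ hK)
    have hlg₁ : l₁ g₁ ≤ X + N := l₁_le_of_abs_sub_le hg₁
    have E9 : |tr₂ sa g₂| ≤ K * (Y + N * N) := by
      refine (abs_tr₂_le ksa _).trans (mul_le_mul_of_nonneg_left ?_ hK)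
      have : ∀ r ∈ Finset.univ, l₁ (g₂ r) ≤ l₁ (f₂ r) + N := fun r _ =>
        l₁_le_of_abs_sub_le (hg₂ r)
      refine (Finset.sum_le_sum this).trans_eq ?_
      rw [Finset.sum_add_distrib]
      simp [hN, hY]
    have E10 : |bil sa g₁ g₁| ≤ K * (X + N) * (X + N) :=
      (abs_bil_le ksa _ _).trans
        (mul_le_mul (mul_le_mul_of_nonneg_left hlg₁ hK) hlg₁ (l₁_nonneg _) (by positivity))
    have E11 : |dot sb g₁| ≤ K * (X + N) :=
      (abs_dot_le ksb _).trans (mul_le_mul_of_nonneg_left hlg₁ hK)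
    have hPt : -(Qt - 2 * St) ≤ P / t := by
      rw [le_div_iff₀ ht]; linarith
    rw [hQt, hSt, hΦ'] at hPt
    rw [hQ₂'] at hlap
    rw [abs_le] at E1 E2 E3 E4 E5 E6 E7 E8 E9 E10 E11 ksc
    -- Exact cancellations: the terms with `f₃` between `Qt` and `tr₂ a Q₂`, the terms `tr₂ a S₂`
    -- between `St` and `hlap`, and `2 * bil a Q₁ f₁` from `Qt` against the convexity bound `hconv`
    -- with `2 S₁ = Q₁`. The rest is estimated by `E1` to `E11`.
    have main : κ' * Y ^ 2 ≤ P / t + (K ^ 2 * N ^ 2 * X ^ 2 + 4 * (K ^ 2 * N * (X * Y))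
        + 2 * (K ^ 2 * N * (X * Y)) + 2 * (K ^ 2 * N * X ^ 2) + 2 * (K ^ 2 * (X * Y))
        + 2 * (K ^ 2 * N * X) + K * X ^ 2 + K ^ 2 * N * X ^ 2 + 2 * (K ^ 2 * (X * Y))
        + 2 * (K * Y) + 2 * (K * N ^ 2) + 2 * (K * X ^ 2) + 4 * (K * N * X) + 2 * (K * N ^ 2)
        + 2 * (K * X) + 2 * (K * N) + 2 * K) := by
      linarith only [hPt, hlap, hconv, hQS, hYH, hdotS, E1.1, E2.1, E3.2, E4.2, E5.2, E6.2, E7.2,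
        E8.1, E9.1, E10.1, E11.1, ksc.1]
    have hpoly := max_condition_error_le hK hN0 hX0 hY0
    rw [← hM] at hpoly
    linarith only [main, hpoly]
  · have k1 := abs_tr₂_le ka f₂
    have k2 := abs_dot_le kb f₁
    rw [abs_le] at k1 k2 hSΦ kc
    -- With `S` replaced by the right-hand side of the equation up to `1`, `P` contains `|∇f|²_a - 2
    -- |∇f|²_a`, so adding `|∇f|²_a` leaves only terms linear in `X` and `Y`.
    have : P + bil a f₁ f₁ ≤ (2 * K + 2) * (1 + X + Y) := by
      rw [hP]; nlinarith only [hSΦ.1, k1.1, k2.1, kc.1, hX0, hY0]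
    refine this.trans (mul_le_mul_of_nonneg_right ?_ (by positivity))
    have : 0 ≤ K ^ 2 * N ^ 2 + 9 * (K ^ 2 * N) + 4 * K ^ 2 + 11 * K + 4 * (K * N ^ 2)
        + 6 * (K * N) + 2 * K ^ 2 * N := by positivity
    rw [hM]; linarith
  · calc κ' * X ^ 2 ≤ κ / (N + 1) * X ^ 2 :=
          mul_le_mul_of_nonneg_right (min_le_right _ _) (sq_nonneg _)
      _ ≤ κ / (N + 1) * ((N + 1) * ∑ p, f₁ p ^ 2) := by
          refine mul_le_mul_of_nonneg_left ?_ (by positivity)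
          have h0 : 0 ≤ ∑ p, f₁ p ^ 2 := Finset.sum_nonneg fun _ _ => sq_nonneg _
          linarith [l₁_sq_le f₁]
      _ = κ * ∑ p, f₁ p ^ 2 := by field_simp
      _ ≤ _ := hell f₁

end MaximumAlgebra

/-! ### Time intervals and one-sided maxima in time -/

section TimeInterval

theorem timeInterval_mem_nhds {T : EReal} {t : ℝ} (ht : t ∈ timeInterval T) (h0 : 0 < t) :
    timeInterval T ∩ Ioi 0 ∈ 𝓝 t := by
  have h1 : {s : ℝ | (s : EReal) < T} ∈ 𝓝 t :=
    (isOpen_Iio.preimage continuous_coe_real_ereal).mem_nhds ht.2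
  filter_upwards [h1, Ioi_mem_nhds h0] with s hs hs0
  exact ⟨⟨le_of_lt hs0, hs⟩, hs0⟩

theorem mem_timeInterval_of_le {T : EReal} {s t : ℝ} (ht : t ∈ timeInterval T) (h0 : 0 ≤ s)
    (hst : s ≤ t) : s ∈ timeInterval T :=
  ⟨h0, lt_of_le_of_lt (EReal.coe_le_coe_iff.2 hst) ht.2⟩

/-- Only earlier times are compared, because the maximum over `[0, t₁]` may sit at the endpoint
`t₁`. -/
theorem nonneg_of_hasDerivAt_of_left_max {φ : ℝ → ℝ} {D t : ℝ} (hφ : HasDerivAt φ D t)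
    (hmax : ∀ᶠ s in 𝓝[<] t, φ s ≤ φ t) : 0 ≤ D := by
  have h1 := hasDerivWithinAt_iff_tendsto_slope' (by simp) |>.1 (hφ.hasDerivWithinAt (s := Iio t))
  refine ge_of_tendsto h1 ?_
  filter_upwards [hmax, self_mem_nhdsWithin] with s hs hst
  rw [slope_def_field]
  exact div_nonneg_of_nonpos (by linarith) (by linarith [mem_Iio.1 hst])

end TimeInterval

/-! ### Product rules for contractions -/

section BilinearDerivatives

variable {E : Type*} [NormedAddCommGroup E] [NormedSpace ℝ E] {ι : Type*} [Fintype ι]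

theorem dird_dot {v z : E} {b x : ι → E → ℝ} (hb : ∀ p, DifferentiableAt ℝ (b p) z)
    (hx : ∀ p, DifferentiableAt ℝ (x p) z) :
    dird v (fun w => dot (fun p => b p w) (fun p => x p w)) z
      = dot (fun p => dird v (b p) z) (fun p => x p z)
        + dot (fun p => b p z) (fun p => dird v (x p) z) := by
  simp only [dot]
  rw [dird_sum fun p _ => (hb p).fun_mul (hx p), ← Finset.sum_add_distrib]
  exact Finset.sum_congr rfl fun p _ => dird_mul (hb p) (hx p)

theorem dird_tr₂ {v z : E} {m w : ι → ι → E → ℝ} (hm : ∀ p q, DifferentiableAt ℝ (m p q) z)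
    (hw : ∀ p q, DifferentiableAt ℝ (w p q) z) :
    dird v (fun y => tr₂ (fun p q => m p q y) (fun p q => w p q y)) z
      = tr₂ (fun p q => dird v (m p q) z) (fun p q => w p q z)
        + tr₂ (fun p q => m p q z) (fun p q => dird v (w p q) z) := by
  simp only [tr₂]
  rw [dird_sum fun p _ => DifferentiableAt.fun_sum fun q _ => (hm p q).fun_mul (hw p q),
    ← Finset.sum_add_distrib]
  exact Finset.sum_congr rfl fun p _ => dird_dot (hm p) (hw p)

theorem bil_eq_tr₂ (m : ι → ι → ℝ) (x y : ι → ℝ) : bil m x y = tr₂ m (fun p q => x p * y q) := by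
  simp only [bil, tr₂, mul_assoc]

theorem dird_bil {v z : E} {m : ι → ι → E → ℝ} {x y : ι → E → ℝ}
    (hm : ∀ p q, DifferentiableAt ℝ (m p q) z) (hx : ∀ p, DifferentiableAt ℝ (x p) z)
    (hy : ∀ p, DifferentiableAt ℝ (y p) z) :
    dird v (fun w => bil (fun p q => m p q w) (fun p => x p w) (fun p => y p w)) z
      = bil (fun p q => dird v (m p q) z) (fun p => x p z) (fun p => y p z)
        + bil (fun p q => m p q z) (fun p => dird v (x p) z) (fun p => y p z)
        + bil (fun p q => m p q z) (fun p => x p z) (fun p => dird v (y p) z) := by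
  simp only [bil_eq_tr₂]
  rw [dird_tr₂ hm fun p q => (hx p).fun_mul (hy q), add_assoc, ← tr₂_add_right]
  congr 2
  exact funext fun p => funext fun q => dird_mul (hx p) (hy q)

theorem hasDerivAt_bil {t : ℝ} {m : ι → ι → ℝ → ℝ} {m' : ι → ι → ℝ} {x : ι → ℝ → ℝ}
    {x' : ι → ℝ} (hs : ∀ p q, m p q t = m q p t) (hm : ∀ p q, HasDerivAt (m p q) (m' p q) t)
    (hx : ∀ p, HasDerivAt (x p) (x' p) t) :
    HasDerivAt (fun s => bil (fun p q => m p q s) (fun p => x p s) (fun p => x p s))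
      (bil m' (fun p => x p t) (fun p => x p t)
        + 2 * bil (fun p q => m p q t) x' (fun p => x p t)) t := by
  have h := HasDerivAt.fun_sum (u := Finset.univ) fun p _ =>
    HasDerivAt.fun_sum (u := Finset.univ) fun q _ => ((hm p q).fun_mul (hx p)).fun_mul (hx q)
  refine h.congr_deriv ?_
  have h2 : 2 * bil (fun p q => m p q t) x' (fun p => x p t)
      = bil (fun p q => m p q t) x' (fun p => x p t)
        + bil (fun p q => m p q t) (fun p => x p t) x' := by
    rw [bil_comm hs (fun p => x p t) x']; ring
  rw [h2]
  simp only [bil, ← Finset.sum_add_distrib]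
  exact Finset.sum_congr rfl fun p _ => Finset.sum_congr rfl fun q _ => by ring

end BilinearDerivatives

/-! ### The logarithmic equation and the maximum principle in one chart -/

section LocalSolution

variable {E : Type*} [NormedAddCommGroup E] [NormedSpace ℝ E] {ι : Type*} [Fintype ι]

/-- The square of the gradient of `f` with respect to the form `a`. -/
noncomputable def gradSq (e : ι → E) (a : ι → ι → ℝ → E → ℝ) (f : ℝ → E → ℝ) (t : ℝ) (z : E) : ℝ :=
  bil (fun p q => a p q t z) (fun p => dird (e p) (f t) z) (fun p => dird (e p) (f t) z)

/-- The right-hand side of the equation satisfied by the logarithm of a positive solution. -/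
noncomputable def logRhs (e : ι → E) (a : ι → ι → ℝ → E → ℝ) (b : ι → ℝ → E → ℝ)
    (c f : ℝ → E → ℝ) (t : ℝ) (z : E) : ℝ :=
  tr₂ (fun p q => a p q t z) (fun p q => dird (e p) (dird (e q) (f t)) z) + gradSq e a f t z
    + dot (fun p => b p t z) (fun p => dird (e p) (f t) z) + c t z

/-- The Li–Yau quantity with the time derivative replaced by a difference quotient. -/
noncomputable def liYau (e : ι → E) (a : ι → ι → ℝ → E → ℝ) (f : ℝ → E → ℝ) (h t : ℝ) (z : E) : ℝ :=
  gradSq e a f t z - 2 / h * (f (t + h) z - f t z)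

/-- `f` is a regular solution on `timeInterval T × U` of `∂f/∂t = logRhs e a b c f`. -/
structure IsLogSolution (e : ι → E) (T : EReal) (U : Set E) (a : ι → ι → ℝ → E → ℝ)
    (b : ι → ℝ → E → ℝ) (c f : ℝ → E → ℝ) : Prop where
  symm : ∀ p q t z, a p q t z = a q p t z
  a_smooth : ∀ p q, ∀ t ∈ timeInterval T, ContDiffOn ℝ 3 (a p q t) U
  f_smooth : ∀ t ∈ timeInterval T, ContDiffOn ℝ 3 (f t) U
  a_joint : ∀ p q, JointC e (timeInterval T) U 3 (a p q)
  b_joint : ∀ p, JointC e (timeInterval T) U 3 (b p)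
  c_joint : JointC e (timeInterval T) U 3 c
  f_joint : JointC e (timeInterval T) U 3 f
  a_time : ∀ p q, ∀ z ∈ U, ∀ t ∈ timeInterval T, 0 < t →
    DifferentiableAt ℝ (fun s => a p q s z) t
  b_time : ∀ p, ∀ z ∈ U, ∀ t ∈ timeInterval T, 0 < t → DifferentiableAt ℝ (fun s => b p s z) t
  c_time : ∀ z ∈ U, ∀ t ∈ timeInterval T, 0 < t → DifferentiableAt ℝ (fun s => c s z) t
  eqn : ∀ z ∈ U, ∀ t ∈ timeInterval T, 0 < t →
    HasDerivAt (fun s => f s z) (logRhs e a b c f t z) t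

/-- Bounds at the point `z` for the coefficients and their derivatives. -/
structure CoeffBounds (e : ι → E) (T : EReal) (K : ℝ) (z : E) (a : ι → ι → ℝ → E → ℝ)
    (b : ι → ℝ → E → ℝ) (c : ℝ → E → ℝ) : Prop where
  a_le : ∀ p q, ∀ t ∈ timeInterval T, |a p q t z| ≤ K
  da_le : ∀ r p q, ∀ t ∈ timeInterval T, |dird (e r) (a p q t) z| ≤ K
  dda_le : ∀ r s p q, ∀ t ∈ timeInterval T, |dird (e r) (dird (e s) (a p q t)) z| ≤ K
  ta_le : ∀ p q, ∀ t ∈ timeInterval T, 0 < t → |deriv (fun s => a p q s z) t| ≤ K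
  b_le : ∀ p, ∀ t ∈ timeInterval T, |b p t z| ≤ K
  db_le : ∀ r p, ∀ t ∈ timeInterval T, |dird (e r) (b p t) z| ≤ K
  tb_le : ∀ p, ∀ t ∈ timeInterval T, 0 < t → |deriv (fun s => b p s z) t| ≤ K
  c_le : ∀ t ∈ timeInterval T, |c t z| ≤ K
  dc_le : ∀ r, ∀ t ∈ timeInterval T, |dird (e r) (c t) z| ≤ K
  tc_le : ∀ t ∈ timeInterval T, 0 < t → |deriv (fun s => c s z) t| ≤ K

variable {e : ι → E} {T : EReal} {U : Set E} {a : ι → ι → ℝ → E → ℝ} {b : ι → ℝ → E → ℝ}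
  {c f : ℝ → E → ℝ}

theorem abs_slope_le_of_abs_deriv_le {g : ℝ → ℝ} {K t h : ℝ} (hh : 0 < h)
    (hg : ∀ s ∈ Icc t (t + h), DifferentiableAt ℝ g s)
    (hK : ∀ s ∈ Icc t (t + h), |deriv g s| ≤ K) : |(g (t + h) - g t) / h| ≤ K := by
  obtain ⟨s, hs, hs'⟩ := exists_deriv_eq_slope g (by linarith : t < t + h)
    (fun s hs => (hg s hs).continuousAt.continuousWithinAt)
    (fun s hs => (hg s (Ioo_subset_Icc_self hs)).differentiableWithinAt)
  rw [add_sub_cancel_left] at hs'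
  rw [← hs']
  exact hK s (Ioo_subset_Icc_self hs)

theorem IsLogSolution.jointC_gradSq (hU : IsOpen U) (h : IsLogSolution e T U a b c f) :
    JointC e (timeInterval T) U 2 (gradSq e a f) :=
  JointC.sum hU _ fun p _ => JointC.sum hU _ fun q _ =>
    ((h.a_joint p q).of_succ.mul hU (h.f_joint.dird p)).mul hU (h.f_joint.dird q)

/-- The right-hand side consumes two of the three space derivatives of `f`. This single remaining
order suffices to differentiate the gradient in time, but not for the second derivatives of `f_t`;
hence the difference quotient in `liYau`. -/
theorem IsLogSolution.jointC_logRhs (hU : IsOpen U) (h : IsLogSolution e T U a b c f) :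
    JointC e (timeInterval T) U 1 (logRhs e a b c f) := by
  have h1 : JointC e (timeInterval T) U 1 (fun t z => tr₂ (fun p q => a p q t z)
      (fun p q => dird (e p) (dird (e q) (f t)) z)) :=
    JointC.sum hU _ fun p _ => JointC.sum hU _ fun q _ =>
      (h.a_joint p q).of_succ.of_succ.mul hU ((h.f_joint.dird q).dird p)
  have h2 : JointC e (timeInterval T) U 1 (fun t z => dot (fun p => b p t z)
      (fun p => dird (e p) (f t) z)) :=
    JointC.sum hU _ fun p _ => (h.b_joint p).of_succ.of_succ.mul hU (h.f_joint.dird p).of_succ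
  exact ((h1.add hU (h.jointC_gradSq hU).of_succ).add hU h2).add hU h.c_joint.of_succ.of_succ

theorem IsLogSolution.contDiffAt_a (hU : IsOpen U) (h : IsLogSolution e T U a b c f) {t : ℝ}
    (ht : t ∈ timeInterval T) {z : E} (hz : z ∈ U) (p q : ι) : ContDiffAt ℝ 3 (a p q t) z :=
  (h.a_smooth p q t ht).contDiffAt (hU.mem_nhds hz)

theorem IsLogSolution.contDiffAt_f (hU : IsOpen U) (h : IsLogSolution e T U a b c f) {t : ℝ}
    (ht : t ∈ timeInterval T) {z : E} (hz : z ∈ U) : ContDiffAt ℝ 3 (f t) z :=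
  (h.f_smooth t ht).contDiffAt (hU.mem_nhds hz)

theorem IsLogSolution.contDiffAt_dird_f (hU : IsOpen U) (h : IsLogSolution e T U a b c f) {t : ℝ}
    (ht : t ∈ timeInterval T) {z : E} (hz : z ∈ U) (v : E) : ContDiffAt ℝ 2 (dird v (f t)) z :=
  (contDiffOn_dird hU (k := 2) (by simpa using h.f_smooth t ht)).contDiffAt (hU.mem_nhds hz)

theorem IsLogSolution.contDiffAt_gradSq (hU : IsOpen U) (h : IsLogSolution e T U a b c f) {t : ℝ}
    (ht : t ∈ timeInterval T) {z : E} (hz : z ∈ U) : ContDiffAt ℝ 2 (gradSq e a f t) z := by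
  refine ContDiffAt.sum fun p _ => ContDiffAt.sum fun q _ => ?_
  exact (((h.contDiffAt_a hU ht hz p q).of_le (by norm_num)).mul
    (h.contDiffAt_dird_f hU ht hz _)).mul (h.contDiffAt_dird_f hU ht hz _)

theorem IsLogSolution.dird_gradSq (hU : IsOpen U) (h : IsLogSolution e T U a b c f) {t : ℝ}
    (ht : t ∈ timeInterval T) {z : E} (hz : z ∈ U) (v : E) :
    dird v (gradSq e a f t) z
      = bil (fun p q => dird v (a p q t) z) (fun p => dird (e p) (f t) z)
          (fun p => dird (e p) (f t) z)
        + 2 * bil (fun p q => a p q t z) (fun p => dird v (dird (e p) (f t)) z)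
          (fun p => dird (e p) (f t) z) := by
  have hd : ∀ p, DifferentiableAt ℝ (dird (e p) (f t)) z := fun p =>
    (h.contDiffAt_dird_f hU ht hz _).differentiableAt (by norm_num)
  have := dird_bil (v := v) (m := fun p q => a p q t) (x := fun p => dird (e p) (f t))
    (y := fun p => dird (e p) (f t))
    (fun p q => (h.contDiffAt_a hU ht hz p q).differentiableAt (by norm_num)) hd hd
  refine this.trans ?_
  rw [bil_comm (fun p q => h.symm p q t z) (fun p => dird (e p) (f t) z)]
  ring

theorem IsLogSolution.dird_dird_gradSq (hU : IsOpen U) (h : IsLogSolution e T U a b c f) {t : ℝ}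
    (ht : t ∈ timeInterval T) {z : E} (hz : z ∈ U) (v w : E) :
    dird v (dird w (gradSq e a f t)) z
      = bil (fun p q => dird v (dird w (a p q t)) z) (fun p => dird (e p) (f t) z)
          (fun p => dird (e p) (f t) z)
        + 2 * bil (fun p q => dird w (a p q t) z) (fun p => dird v (dird (e p) (f t)) z)
          (fun p => dird (e p) (f t) z)
        + 2 * bil (fun p q => dird v (a p q t) z) (fun p => dird w (dird (e p) (f t)) z)
          (fun p => dird (e p) (f t) z)
        + 2 * bil (fun p q => a p q t z) (fun p => dird v (dird w (dird (e p) (f t))) z)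
          (fun p => dird (e p) (f t) z)
        + 2 * bil (fun p q => a p q t z) (fun p => dird w (dird (e p) (f t)) z)
          (fun p => dird v (dird (e p) (f t)) z) := by
  have hev : dird w (gradSq e a f t) =ᶠ[𝓝 z] fun z =>
      bil (fun p q => dird w (a p q t) z) (fun p => dird (e p) (f t) z)
          (fun p => dird (e p) (f t) z)
        + 2 * bil (fun p q => a p q t z) (fun p => dird w (dird (e p) (f t)) z)
          (fun p => dird (e p) (f t) z) := by
    filter_upwards [hU.mem_nhds hz] with y hy using h.dird_gradSq hU ht hy w
  have hd : ∀ p, DifferentiableAt ℝ (dird (e p) (f t)) z := fun p =>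
    (h.contDiffAt_dird_f hU ht hz _).differentiableAt (by norm_num)
  have hdd : ∀ p, DifferentiableAt ℝ (dird w (dird (e p) (f t))) z := fun p =>
    differentiableAt_dird (h.contDiffAt_dird_f hU ht hz _)
  have ha : ∀ p q, DifferentiableAt ℝ (a p q t) z := fun p q =>
    (h.contDiffAt_a hU ht hz p q).differentiableAt (by norm_num)
  have hda : ∀ p q, DifferentiableAt ℝ (dird w (a p q t)) z := fun p q =>
    differentiableAt_dird ((h.contDiffAt_a hU ht hz p q).of_le (by norm_num))
  have hdiff : ∀ {m : ι → ι → E → ℝ} {x y : ι → E → ℝ}, (∀ p q, DifferentiableAt ℝ (m p q) z) →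
      (∀ p, DifferentiableAt ℝ (x p) z) → (∀ p, DifferentiableAt ℝ (y p) z) →
      DifferentiableAt ℝ (fun w => bil (fun p q => m p q w) (fun p => x p w) (fun p => y p w)) z :=
    fun hm hx hy => DifferentiableAt.fun_sum fun p _ => DifferentiableAt.fun_sum fun q _ =>
      ((hm p q).mul (hx p)).mul (hy q)
  rw [dird_congr hev, dird_add (hdiff hda hd hd) ((hdiff ha hdd hd).const_mul 2),
    dird_mul (differentiableAt_const _) (hdiff ha hdd hd), dird_bil hda hd hd,
    dird_bil ha hdd hd]
  have hsw : ∀ p q, dird w (a p q t) z = dird w (a q p t) z := fun p q => by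
    have : a p q t = a q p t := funext fun y => h.symm p q t y
    rw [this]
  have h0 : dird v (fun _ : E => (2 : ℝ)) z = 0 := by simp [dird]
  rw [h0, bil_comm hsw (fun p => dird (e p) (f t) z)]
  ring

theorem IsLogSolution.dird_logRhs (hU : IsOpen U) (h : IsLogSolution e T U a b c f) {t : ℝ}
    (ht : t ∈ timeInterval T) {z : E} (hz : z ∈ U) (v : E) :
    dird v (logRhs e a b c f t) z
      = tr₂ (fun p q => dird v (a p q t) z) (fun p q => dird (e p) (dird (e q) (f t)) z)
        + tr₂ (fun p q => a p q t z) (fun p q => dird v (dird (e p) (dird (e q) (f t))) z)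
        + dird v (gradSq e a f t) z
        + dot (fun p => dird v (b p t) z) (fun p => dird (e p) (f t) z)
        + dot (fun p => b p t z) (fun p => dird v (dird (e p) (f t)) z)
        + dird v (c t) z := by
  have hd : ∀ p, DifferentiableAt ℝ (dird (e p) (f t)) z := fun p =>
    (h.contDiffAt_dird_f hU ht hz _).differentiableAt (by norm_num)
  have hdd : ∀ p q, DifferentiableAt ℝ (dird (e p) (dird (e q) (f t))) z := fun p q =>
    differentiableAt_dird (h.contDiffAt_dird_f hU ht hz _)
  have ha : ∀ p q, DifferentiableAt ℝ (a p q t) z := fun p q =>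
    (h.contDiffAt_a hU ht hz p q).differentiableAt (by norm_num)
  have hb : ∀ p, DifferentiableAt ℝ (b p t) z := fun p => (h.b_joint p).differentiableAt ht hz
  have hc : DifferentiableAt ℝ (c t) z := h.c_joint.differentiableAt ht hz
  have hQ : DifferentiableAt ℝ (gradSq e a f t) z :=
    (h.contDiffAt_gradSq hU ht hz).differentiableAt (by norm_num)
  have d1 : DifferentiableAt ℝ (fun z => tr₂ (fun p q => a p q t z)
      (fun p q => dird (e p) (dird (e q) (f t)) z)) z :=
    DifferentiableAt.fun_sum fun p _ => DifferentiableAt.fun_sum fun q _ => (ha p q).mul (hdd p q)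
  have d2 : DifferentiableAt ℝ (fun z => dot (fun p => b p t z) (fun p => dird (e p) (f t) z)) z :=
    DifferentiableAt.fun_sum fun p _ => (hb p).mul (hd p)
  have := dird_add (v := v) ((d1.add hQ).add d2) hc
  refine this.trans ?_
  rw [show dird v ((fun z => tr₂ (fun p q => a p q t z)
      (fun p q => dird (e p) (dird (e q) (f t)) z)) + gradSq e a f t
      + fun z => dot (fun p => b p t z) (fun p => dird (e p) (f t) z)) z = _ from
      dird_add (v := v) (d1.add hQ) d2,
    show dird v ((fun z => tr₂ (fun p q => a p q t z)
      (fun p q => dird (e p) (dird (e q) (f t)) z)) + gradSq e a f t) z = _ from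
      dird_add (v := v) d1 hQ, dird_tr₂ ha hdd, dird_dot hb hd]
  ring

theorem IsLogSolution.hasDerivAt_dird (hU : IsOpen U) (h : IsLogSolution e T U a b c f) {t : ℝ}
    (ht : t ∈ timeInterval T) (h0 : 0 < t) {z : E} (hz : z ∈ U) (p : ι) :
    HasDerivAt (fun s => dird (e p) (f s) z) (dird (e p) (logRhs e a b c f t) z) t := by
  have hR := h.jointC_logRhs hU
  have hnhds : (timeInterval T ∩ Ioi 0) ×ˢ U ∈ 𝓝 (t, z) :=
    prod_mem_nhds (timeInterval_mem_nhds ht h0) (hU.mem_nhds hz)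
  refine hasDerivAt_dird_of_hasDerivAt ?_ ?_ ?_ ?_
  · filter_upwards [hnhds] with y hy using h.eqn y.2 hy.2 y.1 hy.1.1 hy.1.2
  · filter_upwards [timeInterval_mem_nhds ht h0] with s hs using
      h.f_joint.differentiableAt hs.1 hz
  · filter_upwards [hnhds] with y hy using hR.differentiableAt hy.1.1 hy.2
  · refine (hR.dird p).continuousOn.continuousAt ?_
    exact mem_of_superset hnhds (prod_mono inter_subset_left subset_rfl)

/-- A discrete Leibniz rule: quotients of coefficients multiply the later solution, quotients of the
solution carry the earlier coefficients. The quadratic quotient is left unexpanded so that convexity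
can be applied to it. -/
theorem logRhs_diff_eq {a a' sa : ι → ι → ℝ} {b b' sb f₁ g₁ S₁ : ι → ℝ} {c c' sc h : ℝ}
    {f₂ g₂ S₂ : ι → ι → ℝ} (hh : h ≠ 0) (ha : ∀ p q, sa p q = (a' p q - a p q) / h)
    (hb : ∀ p, sb p = (b' p - b p) / h) (hc : sc = (c' - c) / h)
    (h₁ : ∀ p, S₁ p = (g₁ p - f₁ p) / h) (h₂ : ∀ p q, S₂ p q = (g₂ p q - f₂ p q) / h) :
    ((tr₂ a' g₂ + bil a' g₁ g₁ + dot b' g₁ + c') - (tr₂ a f₂ + bil a f₁ f₁ + dot b f₁ + c)) / h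
      = tr₂ sa g₂ + tr₂ a S₂ + (bil sa g₁ g₁ + (bil a g₁ g₁ - bil a f₁ f₁) / h)
        + dot sb g₁ + dot b S₁ + sc := by
  have e1 : (tr₂ a' g₂ - tr₂ a f₂) / h = tr₂ sa g₂ + tr₂ a S₂ := by
    simp only [tr₂, ← Finset.sum_sub_distrib, Finset.sum_div, ← Finset.sum_add_distrib, ha, h₂]
    exact Finset.sum_congr rfl fun p _ => Finset.sum_congr rfl fun q _ => by field_simp; ring
  have e2 : (bil a' g₁ g₁ - bil a g₁ g₁) / h = bil sa g₁ g₁ := by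
    simp only [bil, ← Finset.sum_sub_distrib, Finset.sum_div, ha]
    exact Finset.sum_congr rfl fun p _ => Finset.sum_congr rfl fun q _ => by field_simp
  have e3 : (dot b' g₁ - dot b f₁) / h = dot sb g₁ + dot b S₁ := by
    simp only [dot, ← Finset.sum_sub_distrib, Finset.sum_div, ← Finset.sum_add_distrib, hb, h₁]
    exact Finset.sum_congr rfl fun p _ => by field_simp; ring
  rw [← e2, ← e1, add_assoc _ (dot sb g₁), ← e3, hc]
  ring

theorem dird_sub_const_mul_sub {v z : E} {g k l : E → ℝ} (α : ℝ) (hg : DifferentiableAt ℝ g z)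
    (hk : DifferentiableAt ℝ k z) (hl : DifferentiableAt ℝ l z) :
    dird v (fun w => g w - α * (k w - l w)) z = dird v g z - α * (dird v k z - dird v l z) := by
  have := ((hg.hasFDerivAt).sub ((hk.hasFDerivAt.sub hl.hasFDerivAt).const_mul α)).fderiv
  have h2 : fderiv ℝ (fun w => g w - α * (k w - l w)) z
      = fderiv ℝ g z - α • (fderiv ℝ k z - fderiv ℝ l z) := this
  simp [dird, h2]

variable (e) in
/-- At an interior maximum of `t` times the Li–Yau quantity, the quantity is bounded. -/
theorem exists_bound_liYau_of_localMax {κ K : ℝ} (hκ : 0 < κ) (hK : 0 ≤ K) :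
    ∃ C : ℝ, 0 < C ∧ ∀ (T : EReal) (U : Set E) (a : ι → ι → ℝ → E → ℝ) (b : ι → ℝ → E → ℝ)
      (c f : ℝ → E → ℝ), IsOpen U → IsLogSolution e T U a b c f →
      ∀ (t h : ℝ) (z : E), z ∈ U → 0 < t → 0 < h → t + h ∈ timeInterval T →
      CoeffBounds e T K z a b c →
      (∀ ξ : ι → ℝ, κ * ∑ p, ξ p ^ 2 ≤ bil (fun p q => a p q t z) ξ ξ) →
      (∀ p, |dird (e p) (f (t + h)) z - dird (e p) (f t) z| ≤ 1) →
      (∀ p q, |dird (e p) (dird (e q) (f (t + h))) z - dird (e p) (dird (e q) (f t)) z| ≤ 1) →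
      (∀ s ∈ Icc t (t + h), |logRhs e a b c f s z - logRhs e a b c f t z| ≤ 1) →
      IsLocalMax (liYau e a f h t) z →
      (∀ᶠ s in 𝓝[<] t, s * liYau e a f h s z ≤ t * liYau e a f h t z) →
      0 < liYau e a f h t z →
      t * liYau e a f h t z ≤ C * (t + 1) := by
  obtain ⟨C, hC, hbound⟩ := exists_bound_of_max_conditions ι hκ hK
  refine ⟨C, hC, ?_⟩
  intro T U a b c f hU hsol t h z hz ht hh hth hbd hell hc₁ hc₂ hcΦ hmax hleft hpos
  have hI : ∀ s ∈ Icc t (t + h), s ∈ timeInterval T ∧ 0 < s := fun s hs =>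
    ⟨mem_timeInterval_of_le hth (ht.le.trans hs.1) hs.2, ht.trans_le hs.1⟩
  have htI : t ∈ timeInterval T := (hI t ⟨le_rfl, by linarith⟩).1
  have hth0 : 0 < t + h := by linarith
  have hddf : ∀ s ∈ timeInterval T, ∀ v, DifferentiableAt ℝ (dird v (f s)) z := fun s hs v =>
    (hsol.contDiffAt_dird_f hU hs hz v).differentiableAt (by norm_num)
  have hdLY : ∀ v, ∀ y ∈ U, dird v (liYau e a f h t) y
      = dird v (gradSq e a f t) y - 2 / h * (dird v (f (t + h)) y - dird v (f t) y) := by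
    intro v y hy
    exact dird_sub_const_mul_sub _
      ((hsol.contDiffAt_gradSq hU htI hy).differentiableAt (by norm_num))
      (hsol.f_joint.differentiableAt hth hy) (hsol.f_joint.differentiableAt htI hy)
  have hddLY : ∀ v w, dird v (dird w (liYau e a f h t)) z
      = dird v (dird w (gradSq e a f t)) z
        - 2 / h * (dird v (dird w (f (t + h))) z - dird v (dird w (f t)) z) := by
    intro v w
    have : dird w (liYau e a f h t) =ᶠ[𝓝 z] fun y => dird w (gradSq e a f t) y
        - 2 / h * (dird w (f (t + h)) y - dird w (f t) y) := by
      filter_upwards [hU.mem_nhds hz] with y hy using hdLY w y hy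
    rw [dird_congr this]
    exact dird_sub_const_mul_sub _ (differentiableAt_dird (hsol.contDiffAt_gradSq hU htI hz))
      (hddf _ hth _) (hddf _ htI _)
  have hLYc : ContDiffAt ℝ 2 (liYau e a f h t) z :=
    (hsol.contDiffAt_gradSq hU htI hz).sub (contDiffAt_const.mul
      (((hsol.contDiffAt_f hU hth hz).sub (hsol.contDiffAt_f hU htI hz)).of_le (by norm_num)))
  have hnn : ∀ ξ : ι → ℝ, 0 ≤ ∑ p, ∑ q, a p q t z * ξ p * ξ q := fun ξ =>
    (mul_nonneg hκ.le (Finset.sum_nonneg fun _ _ => sq_nonneg _)).trans (hell ξ)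
  -- Time derivative bounds for the coefficients pass to their difference quotients by the mean
  -- value theorem, uniformly in `h`.
  have hslope : ∀ g : ℝ → ℝ, (∀ s ∈ timeInterval T, 0 < s → DifferentiableAt ℝ g s) →
      (∀ s ∈ timeInterval T, 0 < s → |deriv g s| ≤ K) → |(g (t + h) - g t) / h| ≤ K :=
    fun g h1 h2 => abs_slope_le_of_abs_deriv_le hh (fun s hs => h1 s (hI s hs).1 (hI s hs).2)
      fun s hs => h2 s (hI s hs).1 (hI s hs).2
  refine hbound (fun p q => a p q t z) (fun p q => deriv (fun s => a p q s z) t)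
    (fun p q => (a p q (t + h) z - a p q t z) / h) (fun r p q => dird (e r) (a p q t) z)
    (fun r s p q => dird (e r) (dird (e s) (a p q t)) z) (fun p => b p t z)
    (fun p => (b p (t + h) z - b p t z) / h) (fun r p => dird (e r) (b p t) z) (c t z)
    ((c (t + h) z - c t z) / h) (fun r => dird (e r) (c t) z) (fun p => dird (e p) (f t) z)
    (fun p => dird (e p) (f (t + h)) z)
    (fun p => (dird (e p) (f (t + h)) z - dird (e p) (f t) z) / h)
    (fun r => dird (e r) (gradSq e a f t) z) (fun r => dird (e r) (logRhs e a b c f t) z)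
    (fun p q => dird (e p) (dird (e q) (f t)) z)
    (fun p q => dird (e p) (dird (e q) (f (t + h))) z)
    (fun p q => (dird (e p) (dird (e q) (f (t + h))) z - dird (e p) (dird (e q) (f t)) z) / h)
    (fun r s => dird (e r) (dird (e s) (gradSq e a f t)) z)
    (fun r s p => dird (e r) (dird (e s) (dird (e p) (f t))) z)
    h t (liYau e a f h t z) ((f (t + h) z - f t z) / h) _
    ((logRhs e a b c f (t + h) z - logRhs e a b c f t z) / h)
    (fun p q => hsol.symm p q t z) hell (fun p q => hbd.a_le p q t htI)
    (fun p q => hbd.ta_le p q t htI ht)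
    (fun p q => hslope (fun s => a p q s z) (hsol.a_time p q z hz) (hbd.ta_le p q))
    (fun r p q => hbd.da_le r p q t htI) (fun r s p q => hbd.dda_le r s p q t htI)
    (fun p => hbd.b_le p t htI)
    (fun p => hslope (fun s => b p s z) (hsol.b_time p z hz) (hbd.tb_le p))
    (fun r p => hbd.db_le r p t htI) (hbd.c_le t htI)
    (hslope (fun s => c s z) (hsol.c_time z hz) hbd.tc_le) (fun r => hbd.dc_le r t htI)
    ?_ hc₁ hc₂ hh (fun p => by field_simp; ring) (fun r => hsol.dird_gradSq hU htI hz (e r))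
    (fun r s => hsol.dird_dird_gradSq hU htI hz (e r) (e s))
    (fun r => hsol.dird_logRhs hU htI hz (e r)) rfl
    (logRhs_diff_eq hh.ne' (fun _ _ => rfl) (fun _ => rfl) rfl (fun _ => rfl) (fun _ _ => rfl))
    ?_ ?_ hpos ht ?_ ?_ ?_
  · intro r s p
    have hev : dird (e s) (dird (e p) (f t)) =ᶠ[𝓝 z] dird (e p) (dird (e s) (f t)) := by
      filter_upwards [hU.mem_nhds hz] with y hy
      exact dird_comm ((hsol.contDiffAt_f hU htI hy).of_le (by norm_num))
    rw [dird_congr hev]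
    exact dird_comm (hsol.contDiffAt_dird_f hU htI hz _)
  -- The mean value theorem for `f` minus its linear approximation in time shows that the quotient
  -- is within `1` of the right-hand side at time `t`.
  · have hd : ∀ s ∈ Icc t (t + h), HasDerivAt (fun s => f s z - s * logRhs e a b c f t z)
        (logRhs e a b c f s z - logRhs e a b c f t z) s := fun s hs =>
      ((hsol.eqn z hz s (hI s hs).1 (hI s hs).2).fun_sub
        ((hasDerivAt_id' s).mul_const _)).congr_deriv (by rw [one_mul])
    have h1 := abs_slope_le_of_abs_deriv_le hh (fun s hs => (hd s hs).differentiableAt)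
      (fun s hs => by rw [(hd s hs).deriv]; exact hcΦ s hs)
    refine le_trans (le_of_eq ?_) h1
    congr 1
    have : logRhs e a b c f t z = tr₂ (fun p q => a p q t z)
      (fun p q => dird (e p) (dird (e q) (f t)) z)
      + bil (fun p q => a p q t z) (fun p => dird (e p) (f t) z) (fun p => dird (e p) (f t) z)
      + dot (fun p => b p t z) (fun p => dird (e p) (f t) z) + c t z := rfl
    rw [← this]
    field_simp
    ring
  · rw [liYau, gradSq]; ring
  · intro r
    have h1 := dird_eq_zero_of_isLocalMax (v := e r) hmax
    rw [hdLY _ z hz] at h1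
    have : 2 * ((dird (e r) (f (t + h)) z - dird (e r) (f t) z) / h)
      = 2 / h * (dird (e r) (f (t + h)) z - dird (e r) (f t) z) := by ring
    rw [this]; linarith
  · have h1 := sum_dird_dird_nonpos_of_isLocalMax (fun p q => hsol.symm p q t z) hnn e hLYc hmax
    refine le_trans (le_of_eq ?_) h1
    simp only [hddLY, tr₂, Finset.mul_sum, ← Finset.sum_sub_distrib]
    exact Finset.sum_congr rfl fun p _ => Finset.sum_congr rfl fun q _ => by ring
  · have hQt : HasDerivAt (fun s => gradSq e a f s z) _ t :=
      hasDerivAt_bil (m := fun p q s => a p q s z) (x := fun p s => dird (e p) (f s) z)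
        (fun p q => hsol.symm p q t z)
        (fun p q => (hsol.a_time p q z hz t htI ht).hasDerivAt)
        (fun p => hsol.hasDerivAt_dird hU htI ht hz p)
    have hS : HasDerivAt (fun s => f (s + h) z) (logRhs e a b c f (t + h) z) t :=
      HasDerivAt.comp_add_const t h (hsol.eqn z hz (t + h) hth hth0)
    have hLY := hQt.fun_sub ((hS.fun_sub (hsol.eqn z hz t htI ht)).const_mul (2 / h))
    have := nonneg_of_hasDerivAt_of_left_max ((hasDerivAt_id t).fun_mul hLY) hleft
    refine this.trans_eq ?_
    simp only [id_eq, one_mul, liYau]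
    ring

end LocalSolution

/-! ### Translation between Wirtinger and real derivatives -/

section RealCoordinates

variable {n : ℕ}

/-- The real basis `∂/∂xᵢ, ∂/∂yᵢ` of `ℂⁿ`. -/
noncomputable def realBasis (n : ℕ) : Fin n ⊕ Fin n → Cn n
  | Sum.inl i => EuclideanSpace.single i 1
  | Sum.inr i => EuclideanSpace.single i Complex.I

theorem norm_realBasis (p : Fin n ⊕ Fin n) : ‖realBasis n p‖ = 1 := by
  cases p <;> simp [realBasis]

theorem eq_sum_realBasis (v : Cn n) :
    v = ∑ p, (Sum.elim (fun i => (v i).re) (fun i => (v i).im) p : ℝ) • realBasis n p := by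
  ext j
  simp [realBasis, Fintype.sum_sum_type, Finset.sum_apply,
    Pi.single_apply, Complex.re_add_im]

/-- The real symmetric matrix of the second order operator `m i j ∂ᵢ∂_{j̄}`. -/
noncomputable def realMatrix : ∀ _ _ : Fin n ⊕ Fin n, (Fin n → Fin n → ℂ) →L[ℝ] ℝ
  | Sum.inl i, Sum.inl j => (1 / 4 : ℝ) • Complex.reCLM ∘L
      (ContinuousLinearMap.proj j : (Fin n → ℂ) →L[ℝ] ℂ) ∘L ContinuousLinearMap.proj i
  | Sum.inr i, Sum.inr j => (1 / 4 : ℝ) • Complex.reCLM ∘L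
      (ContinuousLinearMap.proj j : (Fin n → ℂ) →L[ℝ] ℂ) ∘L ContinuousLinearMap.proj i
  | Sum.inl i, Sum.inr j => (-1 / 4 : ℝ) • Complex.imCLM ∘L
      (ContinuousLinearMap.proj j : (Fin n → ℂ) →L[ℝ] ℂ) ∘L ContinuousLinearMap.proj i
  | Sum.inr i, Sum.inl j => (1 / 4 : ℝ) • Complex.imCLM ∘L
      (ContinuousLinearMap.proj j : (Fin n → ℂ) →L[ℝ] ℂ) ∘L ContinuousLinearMap.proj i

/-- The real coordinates of a vector of `ℂⁿ`. -/
noncomputable def realVector : ∀ _ : Fin n ⊕ Fin n, Cn n →L[ℝ] ℝ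
  | Sum.inl i => Complex.reCLM ∘L (EuclideanSpace.proj i : Cn n →L[ℂ] ℂ).restrictScalars ℝ
  | Sum.inr i => Complex.imCLM ∘L (EuclideanSpace.proj i : Cn n →L[ℂ] ℂ).restrictScalars ℝ

theorem abs_realMatrix_le (p q : Fin n ⊕ Fin n) (m : Fin n → Fin n → ℂ) :
    |realMatrix p q m| ≤ ‖m‖ := by
  have h : ∀ i j, ‖m i j‖ ≤ ‖m‖ := fun i j => (norm_le_pi_norm (m i) j).trans (norm_le_pi_norm m i)
  have hre : ∀ i j, |(m i j).re| ≤ ‖m‖ := fun i j => (Complex.abs_re_le_norm _).trans (h i j)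
  have him : ∀ i j, |(m i j).im| ≤ ‖m‖ := fun i j => (Complex.abs_im_le_norm _).trans (h i j)
  have h0 := norm_nonneg m
  rcases p with i | i <;> rcases q with j | j <;>
    simp only [realMatrix, smul_apply, ContinuousLinearMap.comp_apply,
      ContinuousLinearMap.proj_apply, Complex.reCLM_apply, Complex.imCLM_apply, smul_eq_mul,
      abs_mul] <;> norm_num <;> linarith [hre i j, him i j]

theorem abs_realVector_le (p : Fin n ⊕ Fin n) (v : Cn n) : |realVector p v| ≤ ‖v‖ := by
  rcases p with i | i
  · exact (Complex.abs_re_le_norm _).trans (PiLp.norm_apply_le v i)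
  · exact (Complex.abs_im_le_norm _).trans (PiLp.norm_apply_le v i)

theorem realMatrix_symm {m : Fin n → Fin n → ℂ} (hm : ∀ i j, starRingEnd ℂ (m i j) = m j i)
    (p q : Fin n ⊕ Fin n) : realMatrix p q m = realMatrix q p m := by
  have hre : ∀ i j, (m i j).re = (m j i).re := fun i j => by rw [← hm i j, Complex.conj_re]
  have him : ∀ i j, (m j i).im = -(m i j).im := fun i j => by rw [← hm i j, Complex.conj_im]
  rcases p with i | i <;> rcases q with j | j <;> simp [realMatrix]
  · exact hre i j
  · rw [him i j]; ring
  · rw [him i j]; ring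
  · exact hre i j

theorem tr₂_realMatrix (m : Fin n → Fin n → ℂ) (w : Fin n ⊕ Fin n → Fin n ⊕ Fin n → ℝ) :
    tr₂ (fun p q => realMatrix p q m) w = (∑ i, ∑ j, m i j * ((1 / 4 : ℂ) *
      ((w (.inl i) (.inl j) : ℂ) + Complex.I * (w (.inl i) (.inr j) : ℂ)
        - Complex.I * ((w (.inr i) (.inl j) : ℂ) + Complex.I * (w (.inr i) (.inr j) : ℂ))))).re := by
  simp only [tr₂, Fintype.sum_sum_type, Complex.re_sum, ← Finset.sum_add_distrib]
  refine Finset.sum_congr rfl fun i _ => Finset.sum_congr rfl fun j _ => ?_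
  simp [realMatrix]
  ring

/-- If `ξ` is the real gradient of a function, the complex vector on the right consists of twice its
derivatives `∂ᵢ`; hence the factor `1/4`. -/
theorem bil_realMatrix (m : Fin n → Fin n → ℂ) (ξ : Fin n ⊕ Fin n → ℝ) :
    bil (fun p q => realMatrix p q m) ξ ξ = (1 / 4) * (∑ i, ∑ j, m i j *
      ((ξ (.inl i) : ℂ) - Complex.I * (ξ (.inr i) : ℂ)) *
      starRingEnd ℂ ((ξ (.inl j) : ℂ) - Complex.I * (ξ (.inr j) : ℂ))).re := by
  simp only [bil, Fintype.sum_sum_type, Complex.re_sum, ← Finset.sum_add_distrib, Finset.mul_sum]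
  refine Finset.sum_congr rfl fun i _ => Finset.sum_congr rfl fun j _ => ?_
  simp [realMatrix]
  ring

theorem fderiv_ofReal_add {g k : Cn n → ℝ} {z : Cn n} (hg : DifferentiableAt ℝ g z)
    (hk : DifferentiableAt ℝ k z) (α β : ℂ) (v : Cn n) :
    fderiv ℝ (fun w => α * (g w : ℂ) + β * (k w : ℂ)) z v
      = α * (dird v g z : ℂ) + β * (dird v k z : ℂ) := by
  have h1 : HasFDerivAt (fun w => (g w : ℂ)) (Complex.ofRealCLM ∘L fderiv ℝ g z) z :=
    Complex.ofRealCLM.hasFDerivAt.comp z hg.hasFDerivAt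
  have h2 : HasFDerivAt (fun w => (k w : ℂ)) (Complex.ofRealCLM ∘L fderiv ℝ k z) z :=
    Complex.ofRealCLM.hasFDerivAt.comp z hk.hasFDerivAt
  have h3 := ((h1.const_mul α).add (h2.const_mul β)).fderiv
  have h4 : fderiv ℝ (fun w => α * (g w : ℂ) + β * (k w : ℂ)) z
    = α • (Complex.ofRealCLM ∘L fderiv ℝ g z) + β • (Complex.ofRealCLM ∘L fderiv ℝ k z) := h3
  rw [h4]
  simp [dird]

theorem fderiv_ofReal {g : Cn n → ℝ} {z : Cn n} (hg : DifferentiableAt ℝ g z) (v : Cn n) :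
    fderiv ℝ (fun w => (g w : ℂ)) z v = (dird v g z : ℂ) := by
  simpa using fderiv_ofReal_add hg hg 1 0 v

theorem wirtinger_ofReal {g : Cn n → ℝ} {z : Cn n} (hg : DifferentiableAt ℝ g z) (i : Fin n) :
    wirtinger i (fun w => (g w : ℂ)) z = (1 / 2) * ((dird (realBasis n (.inl i)) g z : ℂ)
      - Complex.I * (dird (realBasis n (.inr i)) g z : ℂ)) := by
  rw [wirtinger, fderiv_ofReal hg, fderiv_ofReal hg]; rfl

theorem wirtingerBar_ofReal {g : Cn n → ℝ} {z : Cn n} (hg : DifferentiableAt ℝ g z) (i : Fin n) :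
    wirtingerBar i (fun w => (g w : ℂ)) z = (1 / 2) * ((dird (realBasis n (.inl i)) g z : ℂ)
      + Complex.I * (dird (realBasis n (.inr i)) g z : ℂ)) := by
  rw [wirtingerBar, fderiv_ofReal hg, fderiv_ofReal hg]; rfl

theorem wirtinger_wirtingerBar_ofReal {g : Cn n → ℝ} {z : Cn n} (hg : ContDiffAt ℝ 2 g z)
    (i j : Fin n) :
    wirtinger i (wirtingerBar j (fun w => (g w : ℂ))) z = (1 / 4) *
      ((dird (realBasis n (.inl i)) (dird (realBasis n (.inl j)) g) z : ℂ)
        + Complex.I * (dird (realBasis n (.inl i)) (dird (realBasis n (.inr j)) g) z : ℂ)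
        - Complex.I * ((dird (realBasis n (.inr i)) (dird (realBasis n (.inl j)) g) z : ℂ)
          + Complex.I * (dird (realBasis n (.inr i)) (dird (realBasis n (.inr j)) g) z : ℂ))) := by
  have hev : wirtingerBar j (fun w => (g w : ℂ)) =ᶠ[𝓝 z] fun w =>
      (1 / 2) * ((dird (realBasis n (.inl j)) g w : ℂ))
        + (Complex.I / 2) * ((dird (realBasis n (.inr j)) g w : ℂ)) := by
    filter_upwards [hg.eventually (by simp)] with w hw
    rw [wirtingerBar_ofReal (hw.differentiableAt (by norm_num))]
    ring
  rw [wirtinger, hev.fderiv_eq,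
    fderiv_ofReal_add (differentiableAt_dird hg) (differentiableAt_dird hg),
    fderiv_ofReal_add (differentiableAt_dird hg) (differentiableAt_dird hg)]
  simp only [realBasis]
  ring

theorem re_first_order (v : Cn n) (w : Fin n ⊕ Fin n → ℝ) :
    ((∑ i, v i * ((1 / 2 : ℂ) * ((w (.inl i) : ℂ) - Complex.I * (w (.inr i) : ℂ))))
      + ∑ i, starRingEnd ℂ (v i) * ((1 / 2 : ℂ) * ((w (.inl i) : ℂ)
        + Complex.I * (w (.inr i) : ℂ)))).re = dot (fun p => realVector p v) w := by
  simp only [dot, Fintype.sum_sum_type, ← Finset.sum_add_distrib, Complex.re_sum]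
  refine Finset.sum_congr rfl fun i _ => ?_
  simp [realVector]
  ring

end RealCoordinates

/-! ### Passage to the logarithm of the solution -/

section LogTransform

variable {E : Type*} [NormedAddCommGroup E] [NormedSpace ℝ E] {ι : Type*} [Fintype ι]

theorem dird_dird_log {v w z : E} {g : E → ℝ} (hg : ContDiffAt ℝ 2 g z) (h0 : g z ≠ 0) :
    dird v (dird w fun y => Real.log (g y)) z
      = (g z)⁻¹ * dird v (dird w g) z - (g z)⁻¹ * dird v g z * ((g z)⁻¹ * dird w g z) := by
  have hd : DifferentiableAt ℝ g z := hg.differentiableAt (by norm_num)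
  have hev : (dird w fun y => Real.log (g y)) =ᶠ[𝓝 z] fun y => (g y)⁻¹ * dird w g y := by
    filter_upwards [hg.eventually (by simp), hg.continuousAt.eventually_ne h0] with y hy hy0
    exact dird_log (hy.differentiableAt (by norm_num)) hy0
  have hinv : dird v (fun y => (g y)⁻¹) z = -(g z)⁻¹ * (g z)⁻¹ * dird v g z := by
    have := ((hasDerivAt_inv h0).comp_hasFDerivAt z hd.hasFDerivAt).fderiv
    simp only [Function.comp_def] at this
    rw [dird, this]
    simp only [dird, smul_apply, smul_eq_mul]
    field_simp
  rw [dird_congr hev, dird_mul (hd.fun_inv h0) (differentiableAt_dird hg), hinv]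
  ring

/-- The gradient square in `logRhs` exactly compensates the term `-∂ₚ log u · ∂_q log u` in the
Hessian of the logarithm, leaving the linear operator divided by `u`. -/
theorem logRhs_log {e : ι → E} {a : ι → ι → ℝ → E → ℝ} {b : ι → ℝ → E → ℝ} {c u : ℝ → E → ℝ}
    {t : ℝ} {z : E} (hu : ContDiffAt ℝ 2 (u t) z) (h0 : u t z ≠ 0) :
    logRhs e a b c (fun s y => Real.log (u s y)) t z
      = (tr₂ (fun p q => a p q t z) (fun p q => dird (e p) (dird (e q) (u t)) z)
        + dot (fun p => b p t z) (fun p => dird (e p) (u t) z) + c t z * u t z) / u t z := by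
  have hd : DifferentiableAt ℝ (u t) z := hu.differentiableAt (by norm_num)
  rw [logRhs, gradSq, bil_eq_tr₂, ← tr₂_add_right]
  simp only [dird_dird_log hu h0, dird_log hd h0, sub_add_cancel]
  rw [tr₂_smul_right]
  have : dot (fun p => b p t z) (fun p => (u t z)⁻¹ * dird (e p) (u t) z)
      = (u t z)⁻¹ * dot (fun p => b p t z) (fun p => dird (e p) (u t) z) := by
    simp only [dot, Finset.mul_sum]
    exact Finset.sum_congr rfl fun p _ => by ring
  rw [this]
  field_simp

end LogTransform

/-! ### Regularity and bounds of the real coefficients in a chart -/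

section ChartCoefficients

variable {n : ℕ} {M : Type*} [TopologicalSpace M] [ChartedSpace (Cn n) M]

/-- The real coefficients of second order in a chart. -/
noncomputable def secondCoeff (G : HermitianCotensor n M) (φ : OpenPartialHomeomorph M (Cn n))
    (p q : Fin n ⊕ Fin n) (t : ℝ) (z : Cn n) : ℝ := realMatrix p q (G.comp φ t z)

/-- The real coefficients of first order in a chart. -/
noncomputable def firstCoeff (χ : ∀ (_ : ℝ) (x : M), HTangent n x)
    (φ : OpenPartialHomeomorph M (Cn n)) (p : Fin n ⊕ Fin n) (t : ℝ) (z : Cn n) : ℝ :=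
  realVector p (vecComp χ φ t z)

theorem secondCoeff_symm (G : HermitianCotensor n M) (φ : OpenPartialHomeomorph M (Cn n))
    (p q : Fin n ⊕ Fin n) (t : ℝ) (z : Cn n) : secondCoeff G φ p q t z = secondCoeff G φ q p t z :=
  realMatrix_symm (fun _ _ => G.symm _ _ _ _) p q

theorem IsCkl.spaceC {V : Type*} [NormedAddCommGroup V] [NormedSpace ℝ V] {k l : ℕ} {I : Set ℝ}
    {U : Set (Cn n)} {F : ℝ → Cn n → V} (h : IsCkl k l I U F) : SpaceC k I U F :=
  ⟨h.space, h.space_cont⟩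

theorem IsCkl.jointC {V : Type*} [NormedAddCommGroup V] [NormedSpace ℝ V] {k l : ℕ} {I : Set ℝ}
    {U : Set (Cn n)} {F : ℝ → Cn n → V} (h : IsCkl k l I U F) (hU : IsOpen U) (L : V →L[ℝ] ℝ)
    {ι : Type*} (e : ι → Cn n) : JointC e I U k (fun t z => L (F t z)) :=
  (h.spaceC.clm hU L).jointC hU

theorem IsCkl.differentiableAt_time {V : Type*} [NormedAddCommGroup V] [NormedSpace ℝ V]
    {k l : ℕ} {T : EReal} {U : Set (Cn n)} {F : ℝ → Cn n → V}
    (h : IsCkl k (l + 1) (timeInterval T) U F) {z : Cn n} (hz : z ∈ U) {t : ℝ}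
    (ht : t ∈ timeInterval T) (h0 : 0 < t) : DifferentiableAt ℝ (fun s => F s z) t :=
  ((h.time z hz).contDiffAt (mem_of_superset (timeInterval_mem_nhds ht h0)
    inter_subset_left)).differentiableAt (by simp)

theorem isLogSolution_of_isSolution {T : EReal} {G : HermitianCotensor n M}
    {χ : ∀ (_ : ℝ) (x : M), HTangent n x} {χ₀ u : ℝ → M → ℝ}
    {φ : OpenPartialHomeomorph M (Cn n)} (hφ : φ ∈ atlas (Cn n) M)
    (hG : IsCklOn 3 1 (timeInterval T) G.comp) (hχ : IsCklOn 3 1 (timeInterval T) (vecComp χ))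
    (hχ₀ : IsCklOn (n := n) 3 1 (timeInterval T) (funComp χ₀))
    (hu : IsCklOn (n := n) 3 2 (timeInterval T) (funComp u))
    (hpos : ∀ t ∈ timeInterval T, ∀ x : M, 0 < u t x)
    (hsol : IsSolution (timeInterval T) G χ χ₀ u) :
    IsLogSolution (realBasis n) T φ.target (secondCoeff G φ) (firstCoeff χ φ) (funComp χ₀ φ)
      (fun t z => Real.log (funComp u φ t z)) := by
  have hU : IsOpen φ.target := φ.open_target
  have hne : ∀ t ∈ timeInterval T, ∀ z ∈ φ.target, funComp u φ t z ≠ 0 := fun t ht z _ =>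
    (hpos t ht _).ne'
  refine ⟨secondCoeff_symm G φ, fun p q t ht => ?_, fun t ht => ?_, fun p q => ?_, fun p => ?_,
    ?_, ?_, fun p q z hz t ht h0 => ?_, fun p z hz t ht h0 => ?_, fun z hz t ht h0 => ?_,
    fun z hz t ht h0 => ?_⟩
  · exact (realMatrix p q).contDiff.comp_contDiffOn ((hG φ hφ).space t ht)
  · exact ((hu φ hφ).space t ht).log (hne t ht)
  · exact (hG φ hφ).jointC hU (realMatrix p q) _
  · exact (hχ φ hφ).jointC hU (realVector p) _
  · exact (hχ₀ φ hφ).spaceC.jointC hU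
  · exact (hu φ hφ).spaceC.jointC hU |>.log hU hne
  · exact (realMatrix p q).differentiableAt.comp t ((hG φ hφ).differentiableAt_time hz ht h0)
  · exact (realVector p).differentiableAt.comp t ((hχ φ hφ).differentiableAt_time hz ht h0)
  · exact (hχ₀ φ hφ).differentiableAt_time hz ht h0
  · have hd : DifferentiableAt ℝ (fun s => funComp u φ s z) t :=
      (hu φ hφ).differentiableAt_time hz ht h0
    have hlog := hd.hasDerivAt.log (hne t ht z hz)
    refine hlog.congr_deriv ?_
    have hcd : ContDiffAt ℝ 2 (funComp u φ t) z :=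
      (((hu φ hφ).space t ht).contDiffAt (hU.mem_nhds hz)).of_le (by norm_num)
    rw [logRhs_log hcd (hne t ht z hz)]
    congr 1
    -- The real part of the complex equation is all that is needed, and it is what `tr₂_realMatrix`
    -- and `re_first_order` compute.
    have heq := congrArg Complex.re (hsol t ht φ hφ z hz)
    have hI : timeInterval T ∈ 𝓝 t :=
      mem_of_superset (timeInterval_mem_nhds ht h0) inter_subset_left
    have hdw : derivWithin (fun s => u s (φ.symm z)) (timeInterval T) t
        = deriv (fun s => funComp u φ s z) t := derivWithin_of_mem_nhds hI
    rw [hdw, Complex.ofReal_re] at heq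
    rw [heq]
    have hd1 := hcd.differentiableAt (by norm_num)
    simp only [wirtinger_ofReal hd1, wirtingerBar_ofReal hd1, wirtinger_wirtingerBar_ofReal hcd]
    rw [add_assoc (∑ i, ∑ j, _), Complex.add_re, Complex.add_re, ← Complex.ofReal_mul,
      Complex.ofReal_re]
    congr 1
    have h1 := tr₂_realMatrix (G.comp φ t z)
      (fun p q => dird (realBasis n p) (dird (realBasis n q) (funComp u φ t)) z)
    have h2 := re_first_order (vecComp χ φ t z)
      (fun p => dird (realBasis n p) (funComp u φ t) z)
    exact congrArg₂ (· + ·) h1.symm h2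

section Bounds

variable {V : Type*} [NormedAddCommGroup V] [NormedSpace ℝ V] {A : FiniteCover n M} {k l : ℕ}
  {T : EReal} {F : OpenPartialHomeomorph M (Cn n) → ℝ → Cn n → V} {K : ℝ≥0}

theorem sum_enorm_le_of_cklNorm_le {I : Set ℝ} (h : cklNorm A k l I F ≤ K)
    {α : Fin A.N} {x : M} (hx : x ∈ A.K α) {t : ℝ} (ht : t ∈ I) :
    (∑ a ∈ Finset.range (k + 1), ‖iteratedFDeriv ℝ a (F (A.chart α) t) (A.chart α x)‖ₑ)
      + ∑ b ∈ Finset.Icc 1 l,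
        ‖iteratedDerivWithin b (fun s => F (A.chart α) s (A.chart α x)) I t‖ₑ ≤ K := by
  refine le_trans ?_ h
  rw [cklNorm]
  exact le_iSup_of_le α (le_iSup₂_of_le x hx (le_iSup₂_of_le t ht le_rfl))

theorem norm_iteratedFDeriv_le_of_cklNorm_le {I : Set ℝ} (h : cklNorm A k l I F ≤ K)
    {α : Fin A.N} {x : M} (hx : x ∈ A.K α) {t : ℝ} (ht : t ∈ I) {m : ℕ} (hm : m ≤ k) :
    ‖iteratedFDeriv ℝ m (F (A.chart α) t) (A.chart α x)‖ ≤ K := by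
  have h1 : ‖iteratedFDeriv ℝ m (F (A.chart α) t) (A.chart α x)‖ₑ ≤ K :=
    (Finset.single_le_sum (f := fun a => ‖iteratedFDeriv ℝ a (F (A.chart α) t) (A.chart α x)‖ₑ)
      (fun _ _ => zero_le) (Finset.mem_range.2 (by omega))).trans
      (le_self_add.trans (sum_enorm_le_of_cklNorm_le h hx ht))
  exact_mod_cast enorm_le_coe.1 h1

theorem norm_deriv_le_of_cklNorm_le (h : cklNorm A k 1 (timeInterval T) F ≤ K)
    {α : Fin A.N} {x : M} (hx : x ∈ A.K α) {t : ℝ} (ht : t ∈ timeInterval T) (h0 : 0 < t) :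
    ‖deriv (fun s => F (A.chart α) s (A.chart α x)) t‖ ≤ K := by
  have h1 := le_add_self.trans (sum_enorm_le_of_cklNorm_le h hx ht)
  rw [Finset.Icc_self, Finset.sum_singleton, iteratedDerivWithin_one,
    derivWithin_of_mem_nhds (mem_of_superset (timeInterval_mem_nhds ht h0) inter_subset_left)] at h1
  exact_mod_cast enorm_le_coe.1 h1

theorem dird_clm {W : Cn n → V} {z : Cn n} (hW : DifferentiableAt ℝ W z) (L : V →L[ℝ] ℝ)
    (v : Cn n) : dird v (fun w => L (W w)) z = L (fderiv ℝ W z v) := by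
  have h1 : fderiv ℝ (fun w => L (W w)) z = L ∘L fderiv ℝ W z :=
    (L.hasFDerivAt.comp z hW.hasFDerivAt).fderiv
  rw [dird, h1]; rfl

theorem dird_dird_clm {W : Cn n → V} {z : Cn n} (hW : ContDiffAt ℝ 2 W z) (L : V →L[ℝ] ℝ)
    (v w : Cn n) :
    dird v (dird w (fun y => L (W y))) z = L (iteratedFDeriv ℝ 2 W z ![v, w]) := by
  have hev : dird w (fun y => L (W y)) =ᶠ[𝓝 z] fun y =>
      (L ∘L ContinuousLinearMap.apply ℝ V w) (fderiv ℝ W y) := by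
    filter_upwards [hW.eventually (by simp)] with y hy
    exact dird_clm (hy.differentiableAt (by norm_num)) L w
  have hd : ContDiffAt ℝ 1 (fderiv ℝ W) z := hW.fderiv_right (by norm_num)
  rw [dird_congr hev, dird_clm (hd.differentiableAt (by norm_num)), iteratedFDeriv_two_apply]
  rfl

theorem abs_dird_clm_le {W : Cn n → V} {z : Cn n} (hW : DifferentiableAt ℝ W z)
    {L : V →L[ℝ] ℝ} (hL : ∀ m, |L m| ≤ ‖m‖) {B : ℝ} (hB : ‖iteratedFDeriv ℝ 1 W z‖ ≤ B)
    (p : Fin n ⊕ Fin n) : |dird (realBasis n p) (fun w => L (W w)) z| ≤ B := by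
  rw [dird_clm hW]
  rw [norm_iteratedFDeriv_one] at hB
  refine (hL _).trans (((fderiv ℝ W z).le_opNorm _).trans ?_)
  rw [norm_realBasis, mul_one]
  exact hB

theorem abs_dird_dird_clm_le {W : Cn n → V} {z : Cn n} (hW : ContDiffAt ℝ 2 W z)
    {L : V →L[ℝ] ℝ} (hL : ∀ m, |L m| ≤ ‖m‖) {B : ℝ} (hB : ‖iteratedFDeriv ℝ 2 W z‖ ≤ B)
    (p q : Fin n ⊕ Fin n) :
    |dird (realBasis n p) (dird (realBasis n q) (fun w => L (W w))) z| ≤ B := by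
  rw [dird_dird_clm hW]
  refine (hL _).trans (((iteratedFDeriv ℝ 2 W z).le_opNorm _).trans ?_)
  simpa [Fin.prod_univ_two, norm_realBasis] using hB

theorem abs_deriv_clm_le {W : ℝ → V} {t : ℝ} (hW : DifferentiableAt ℝ W t) {L : V →L[ℝ] ℝ}
    (hL : ∀ m, |L m| ≤ ‖m‖) {B : ℝ} (hB : ‖deriv W t‖ ≤ B) :
    |deriv (fun s => L (W s)) t| ≤ B := by
  have : deriv (fun s => L (W s)) t = L (deriv W t) :=
    (L.hasFDerivAt.comp_hasDerivAt t hW.hasDerivAt).deriv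
  rw [this]
  exact (hL _).trans hB

end Bounds

theorem coeffBounds_of_cklNorm_le {A : FiniteCover n M} {T : EReal} {G : HermitianCotensor n M}
    {χ : ∀ (_ : ℝ) (x : M), HTangent n x} {χ₀ : ℝ → M → ℝ} {KG Kχ K₀ : ℝ≥0}
    (hG : IsCklOn 3 1 (timeInterval T) G.comp) (hχ : IsCklOn 3 1 (timeInterval T) (vecComp χ))
    (hχ₀ : IsCklOn (n := n) 3 1 (timeInterval T) (funComp χ₀))
    (bG : cklNorm A 3 1 (timeInterval T) G.comp ≤ KG)
    (bχ : cklNorm A 1 1 (timeInterval T) (vecComp χ) ≤ Kχ)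
    (bχ₀ : cklNorm A 1 1 (timeInterval T) (funComp χ₀) ≤ K₀) {α : Fin A.N} {x : M}
    (hx : x ∈ A.K α) :
    CoeffBounds (realBasis n) T ((KG + Kχ + K₀ : ℝ≥0) : ℝ) (A.chart α x)
      (secondCoeff G (A.chart α)) (firstCoeff χ (A.chart α)) (funComp χ₀ (A.chart α)) := by
  have hz : A.chart α x ∈ (A.chart α).target :=
    (A.chart α).map_source (A.subset_source α hx)
  have hU := (A.chart α).open_target
  have hm := A.chart_mem α
  have cd : ∀ {V : Type} [NormedAddCommGroup V] [NormedSpace ℝ V]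
      {F : ℝ → Cn n → V}, IsCkl 3 1 (timeInterval T) (A.chart α).target F →
      ∀ t ∈ timeInterval T, ContDiffAt ℝ 2 (F t) (A.chart α x) := fun h t ht =>
    ((h.space t ht).contDiffAt (hU.mem_nhds hz)).of_le (by norm_num)
  have cG : ∀ {r : ℝ}, r ≤ KG → r ≤ ((KG + Kχ + K₀ : ℝ≥0) : ℝ) := fun h => by
    push_cast; linarith [Kχ.2, K₀.2]
  have cχ : ∀ {r : ℝ}, r ≤ Kχ → r ≤ ((KG + Kχ + K₀ : ℝ≥0) : ℝ) := fun h => by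
    push_cast; linarith [KG.2, K₀.2]
  have cχ₀ : ∀ {r : ℝ}, r ≤ K₀ → r ≤ ((KG + Kχ + K₀ : ℝ≥0) : ℝ) := fun h => by
    push_cast; linarith [KG.2, Kχ.2]
  have hid : ∀ m : ℝ, |ContinuousLinearMap.id ℝ ℝ m| ≤ ‖m‖ := fun m => le_rfl
  refine ⟨fun p q t ht => cG ?_, fun r p q t ht => cG ?_, fun r s p q t ht => cG ?_,
    fun p q t ht h0 => cG ?_, fun p t ht => cχ ?_, fun r p t ht => cχ ?_,
    fun p t ht h0 => cχ ?_, fun t ht => cχ₀ ?_, fun r t ht => cχ₀ ?_, fun t ht h0 => cχ₀ ?_⟩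
  · refine (abs_realMatrix_le p q _).trans ?_
    simpa using norm_iteratedFDeriv_le_of_cklNorm_le bG hx ht (Nat.zero_le _)
  · exact abs_dird_clm_le ((cd (hG _ hm) t ht).differentiableAt (by norm_num))
      (abs_realMatrix_le p q)
      (norm_iteratedFDeriv_le_of_cklNorm_le bG hx ht (by norm_num)) r
  · exact abs_dird_dird_clm_le (cd (hG _ hm) t ht) (abs_realMatrix_le p q)
      (norm_iteratedFDeriv_le_of_cklNorm_le bG hx ht (by norm_num)) r s
  · exact abs_deriv_clm_le ((hG _ hm).differentiableAt_time hz ht h0) (abs_realMatrix_le p q)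
      (norm_deriv_le_of_cklNorm_le bG hx ht h0)
  · refine (abs_realVector_le p _).trans ?_
    simpa using norm_iteratedFDeriv_le_of_cklNorm_le bχ hx ht (Nat.zero_le _)
  · exact abs_dird_clm_le ((cd (hχ _ hm) t ht).differentiableAt (by norm_num))
      (abs_realVector_le p)
      (norm_iteratedFDeriv_le_of_cklNorm_le bχ hx ht le_rfl) r
  · exact abs_deriv_clm_le ((hχ _ hm).differentiableAt_time hz ht h0) (abs_realVector_le p)
      (norm_deriv_le_of_cklNorm_le bχ hx ht h0)
  · simpa using norm_iteratedFDeriv_le_of_cklNorm_le bχ₀ hx ht (Nat.zero_le _)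
  · exact abs_dird_clm_le ((cd (hχ₀ _ hm) t ht).differentiableAt (by norm_num)) hid
      (norm_iteratedFDeriv_le_of_cklNorm_le bχ₀ hx ht le_rfl) r
  · exact norm_deriv_le_of_cklNorm_le bχ₀ hx ht h0

end ChartCoefficients

open scoped ComplexOrder

/-! ### Uniform ellipticity of the real coefficients on compact sets -/

section Ellipticity

theorem sum_smul_clm_apply {V : Type*} [TopologicalSpace V] [AddCommGroup V] [Module ℂ V]
    {ι : Type*} [Fintype ι] (c : ι → ℂ) (L : ι → V →L[ℂ] ℂ) (v : V) :
    (∑ i, c i • L i) v = ∑ i, c i * L i v := by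
  simp [sum_apply]

theorem sesq_sum_smul {W : Type*} [AddCommGroup W] [Module ℂ W] {ι : Type*} [Fintype ι]
    (B : W →ₗ⋆[ℂ] W →ₗ[ℂ] ℂ) (c : ι → ℂ) (L : ι → W) :
    B (∑ i, c i • L i) (∑ i, c i • L i)
      = ∑ i, ∑ j, B (L j) (L i) * c i * starRingEnd ℂ (c j) := by
  simp only [map_sum, LinearMap.sum_apply, LinearMap.map_smulₛₗ, LinearMap.smul_apply,
    smul_eq_mul, map_smul, Finset.mul_sum]
  exact Finset.sum_congr rfl fun i _ => Finset.sum_congr rfl fun j _ => by ring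

variable {n : ℕ} {M : Type*} [TopologicalSpace M] [ChartedSpace (Cn n) M]

theorem form_self_pos (g : HermitianMetric n M) (x : M) {v : HTangent n x} (hv : v ≠ 0) :
    0 < g.form x v v := by
  rw [Complex.lt_def]
  have h := g.symm x v v
  exact ⟨g.pos x v hv, (Complex.conj_eq_iff_im.1 h).symm⟩

variable [IsManifold 𝓘(ℂ, Cn n) ω M]

/-- The coordinate fields are linearly independent because the derivative of the inverse chart is
injective. -/
theorem mfderiv_symm_toLp_ne_zero {φ : OpenPartialHomeomorph M (Cn n)} (hφ : φ ∈ atlas (Cn n) M)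
    {z : Cn n} (hz : z ∈ φ.target) {x : Fin n → ℂ} (hx : x ≠ 0) :
    ∑ i, x i • coordVec φ z i ≠ 0 := by
  set L : Cn n →L[ℂ] HTangent n (φ.symm z) :=
    mfderiv 𝓘(ℂ, Cn n) 𝓘(ℂ, Cn n) φ.symm z with hL
  have hx' : (WithLp.toLp 2 x : Cn n) = ∑ i, x i • EuclideanSpace.single i (1 : ℂ) := by
    ext i
    simp [Finset.sum_apply, Pi.single_apply]
  have hsum : ∑ i, x i • coordVec φ z i = L (WithLp.toLp 2 x) := by
    rw [hx', map_sum]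
    exact Finset.sum_congr rfl fun i _ => (map_smul L _ _).symm
  have h1 : Function.Injective L :=
    (mdifferentiable_of_mem_atlas (I := 𝓘(ℂ, Cn n)) hφ).symm.mfderiv_injective hz
  rw [hsum]
  intro h0
  have h2 := h1 (h0.trans (map_zero L).symm)
  refine hx (funext fun i => ?_)
  exact congrArg (fun w : Cn n => w i) h2

theorem posDef_transpose_lower (g : HermitianMetric n M) {φ : OpenPartialHomeomorph M (Cn n)}
    (hφ : φ ∈ atlas (Cn n) M) {z : Cn n} (hz : z ∈ φ.target) :
    (g.lower φ z).transpose.PosDef := by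
  refine Matrix.PosDef.of_dotProduct_mulVec_pos ?_ ?_
  · ext i j
    simpa [HermitianMetric.lower] using g.symm (φ.symm z) _ _
  · intro x hx
    refine (form_self_pos g (φ.symm z) (mfderiv_symm_toLp_ne_zero hφ hz hx)).trans_eq ?_
    rw [sesq_sum_smul]
    simp only [dotProduct, Matrix.mulVec, HermitianMetric.lower, Matrix.transpose_apply,
      Matrix.of_apply, Finset.mul_sum, Pi.star_apply]
    rw [Finset.sum_comm]
    refine Finset.sum_congr rfl fun i _ => Finset.sum_congr rfl fun j _ => ?_
    rw [starRingEnd_apply]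
    ring

theorem upper_form_pos (g : HermitianMetric n M) {φ : OpenPartialHomeomorph M (Cn n)}
    (hφ : φ ∈ atlas (Cn n) M) {z : Cn n} (hz : z ∈ φ.target) {ζ : Fin n → ℂ} (hζ : ζ ≠ 0) :
    0 < (∑ i, ∑ j, g.upper φ z i j * ζ i * starRingEnd ℂ (ζ j)).re := by
  have h := (posDef_transpose_lower g hφ hz).inv.dotProduct_mulVec_pos (x := star ζ)
    (by simpa using hζ)
  have h2 := (Complex.lt_def.1 h).1
  refine h2.trans_eq ?_
  congr 1
  simp only [dotProduct, Matrix.mulVec, HermitianMetric.upper, Finset.mul_sum, star_star,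
    Pi.star_apply]
  exact Finset.sum_congr rfl fun i _ => Finset.sum_congr rfl fun j _ => by
    rw [starRingEnd_apply]; ring

theorem continuousOn_upper (g : HermitianMetric n M) {φ : OpenPartialHomeomorph M (Cn n)}
    (hφ : φ ∈ atlas (Cn n) M) : ContinuousOn (g.upper φ) φ.target := by
  have h1 : ContinuousOn (fun z => (g.lower φ z).transpose) φ.target := by
    have := (g.smooth φ hφ).continuousOn
    refine continuousOn_pi.2 fun i => continuousOn_pi.2 fun j => ?_
    exact continuousOn_pi.1 (continuousOn_pi.1 this j) i
  have h2 : ContinuousOn (fun z => ((g.lower φ z).transpose.det)⁻¹) φ.target :=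
    (Continuous.matrix_det continuous_id |>.comp_continuousOn h1).inv₀
      fun z hz => (posDef_transpose_lower g hφ hz).det_pos.ne'
  have h3 : ContinuousOn (fun z => ((g.lower φ z).transpose.adjugate)) φ.target :=
    Continuous.matrix_adjugate continuous_id |>.comp_continuousOn h1
  refine (h2.smul h3).congr fun z _ => ?_
  simp [HermitianMetric.upper, Matrix.inv_def]

/-- The form is continuous and positive on the compact product of `S` with the unit sphere, so it
has a positive minimum there. Homogeneity of degree two does the rest. -/
theorem exists_pos_le_upper_form (g : HermitianMetric n M) {φ : OpenPartialHomeomorph M (Cn n)}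
    (hφ : φ ∈ atlas (Cn n) M) {S : Set (Cn n)} (hS : IsCompact S) (hSt : S ⊆ φ.target) :
    ∃ m : ℝ, 0 < m ∧ ∀ z ∈ S, ∀ ζ : Cn n,
      m * ‖ζ‖ ^ 2 ≤ (∑ i, ∑ j, g.upper φ z i j * ζ i * starRingEnd ℂ (ζ j)).re := by
  set Ψ : Cn n × Cn n → ℝ := fun p =>
    (∑ i, ∑ j, g.upper φ p.1 i j * p.2 i * starRingEnd ℂ (p.2 j)).re with hΨ
  have hcont : ContinuousOn Ψ (S ×ˢ Metric.sphere 0 1) := by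
    have hu : ∀ i j, ContinuousOn (fun p : Cn n × Cn n => g.upper φ p.1 i j)
        (S ×ˢ Metric.sphere 0 1) := fun i j =>
      (continuousOn_pi.1 (continuousOn_pi.1 ((continuousOn_upper g hφ).mono hSt) i) j).comp
        continuousOn_fst fun p hp => hp.1
    refine Complex.continuous_re.comp_continuousOn ?_
    refine continuousOn_finsetSum _ fun i _ => continuousOn_finsetSum _ fun j _ => ?_
    refine ((hu i j).mul ?_).mul ?_ <;> refine Continuous.continuousOn ?_ <;> fun_prop
  have hpos : ∃ m : ℝ, 0 < m ∧ ∀ p ∈ S ×ˢ Metric.sphere (0 : Cn n) 1, m ≤ Ψ p := by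
    rcases (S ×ˢ Metric.sphere (0 : Cn n) 1).eq_empty_or_nonempty with h | h
    · exact ⟨1, one_pos, fun p hp => by simp [h] at hp⟩
    · obtain ⟨p, hp, hmin⟩ := (hS.prod (isCompact_sphere 0 1)).exists_isMinOn h hcont
      refine ⟨Ψ p, upper_form_pos g hφ (hSt hp.1) ?_, fun q hq => hmin hq⟩
      intro h0
      have h1 : p.2 = 0 := by ext i; exact congrFun h0 i
      have h2 := hp.2
      rw [h1] at h2
      simp at h2
  obtain ⟨m, hm, hmin⟩ := hpos
  refine ⟨m, hm, fun z hz ζ => ?_⟩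
  rcases eq_or_ne ζ 0 with rfl | hζ
  · simp
  have hn : 0 < ‖ζ‖ := norm_pos_iff.2 hζ
  have h1 := hmin (z, ((‖ζ‖⁻¹ : ℝ) : ℂ) • ζ) ⟨hz, by
    simp [norm_smul, hn.ne']⟩
  have h2 : Ψ (z, ((‖ζ‖⁻¹ : ℝ) : ℂ) • ζ) = (‖ζ‖⁻¹) ^ 2 *
      (∑ i, ∑ j, g.upper φ z i j * ζ i * starRingEnd ℂ (ζ j)).re := by
    rw [hΨ, ← Complex.re_ofReal_mul, Finset.mul_sum]
    simp only [Finset.mul_sum]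
    congr 1
    refine Finset.sum_congr rfl fun i _ => Finset.sum_congr rfl fun j _ => ?_
    simp
    ring
  rw [h2] at h1
  have h3 := mul_le_mul_of_nonneg_left h1 (sq_nonneg ‖ζ‖)
  rw [← mul_assoc, ← mul_pow, mul_inv_cancel₀ hn.ne', one_pow, one_mul] at h3
  linarith

/-- The order of quantifiers is the point: `κ` is fixed by the metric, the chart, the compact set
and `lam` before `G` and the time set appear. -/
theorem exists_ellipticity_const (g : HermitianMetric n M) {φ : OpenPartialHomeomorph M (Cn n)}
    (hφ : φ ∈ atlas (Cn n) M) {S : Set (Cn n)} (hS : IsCompact S) (hSt : S ⊆ φ.target)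
    {lam : ℝ} (hlam : 0 < lam) :
    ∃ κ : ℝ, 0 < κ ∧ ∀ (Lam : ℝ) (I : Set ℝ) (G : HermitianCotensor n M),
      UniformlyElliptic g lam Lam I G → ∀ t ∈ I, ∀ z ∈ S, ∀ ξ : Fin n ⊕ Fin n → ℝ,
      κ * ∑ p, ξ p ^ 2 ≤ bil (fun p q => secondCoeff G φ p q t z) ξ ξ := by
  obtain ⟨m, hm, hmin⟩ := exists_pos_le_upper_form g hφ hS hSt
  refine ⟨1 / 4 * (lam * m), by positivity, fun Lam I G hG t ht z hz ξ => ?_⟩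
  have h1 := (hG t ht φ hφ z (hSt hz)
    fun i => (ξ (.inl i) : ℂ) - Complex.I * (ξ (.inr i) : ℂ)).1
  have h2 := hmin z hz (WithLp.toLp 2 fun i => (ξ (.inl i) : ℂ) - Complex.I * (ξ (.inr i) : ℂ))
  have h3 : ‖(WithLp.toLp 2 fun i => (ξ (.inl i) : ℂ) - Complex.I * (ξ (.inr i) : ℂ) : Cn n)‖ ^ 2
      = ∑ p, ξ p ^ 2 := by
    rw [EuclideanSpace.norm_sq_eq, Fintype.sum_sum_type, ← Finset.sum_add_distrib]
    refine Finset.sum_congr rfl fun i _ => ?_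
    rw [← Complex.normSq_eq_norm_sq, Complex.normSq_apply]
    simp
    ring
  rw [h3] at h2
  have h4 := mul_le_mul_of_nonneg_left h2 hlam.le
  have h5 := bil_realMatrix (G.comp φ t z) ξ
  have h6 : bil (fun p q => secondCoeff G φ p q t z) ξ ξ
    = bil (fun p q => realMatrix p q (G.comp φ t z)) ξ ξ := rfl
  rw [h6, h5]
  have h7 := h4.trans h1
  calc 1 / 4 * (lam * m) * ∑ p, ξ p ^ 2 = 1 / 4 * (lam * (m * ∑ p, ξ p ^ 2)) := by ring
    _ ≤ _ := mul_le_mul_of_nonneg_left h7 (by norm_num)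

end Ellipticity

/-! ### Independence of the gradient square from the chart -/

section ChartIndependence

variable {n : ℕ} {M : Type*} [TopologicalSpace M] [ChartedSpace (Cn n) M]

/-- The `(1,0)` part of the differential of a real function, computed in a chart. -/
noncomputable def partialCovec (φ : OpenPartialHomeomorph M (Cn n)) (f : M → ℝ) (x : M) :
    HCotangent n x :=
  ∑ i, ((dird (realBasis n (.inl i)) (fun z => f (φ.symm z)) (φ x) : ℂ)
    - Complex.I * (dird (realBasis n (.inr i)) (fun z => f (φ.symm z)) (φ x) : ℂ))
      • coordCovec φ x i

/-- The value is `df(v) - i df(iv)`, that is `2 ∂f(v)`. In this form independence of the chart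
reduces to that of the real differential. -/
theorem partialCovec_apply (φ : OpenPartialHomeomorph M (Cn n)) (f : M → ℝ) (x : M)
    (v : HTangent n x) :
    partialCovec φ f x v = (dird (coords φ x v) (fun z => f (φ.symm z)) (φ x) : ℂ)
      - Complex.I * (dird (coords φ x (Complex.I • v)) (fun z => f (φ.symm z)) (φ x) : ℂ) := by
  rw [map_smul]
  generalize hw : coords φ x v = w
  have h1 : ∀ w : Cn n, dird w (fun z => f (φ.symm z)) (φ x)
      = ∑ i, ((w i).re * dird (realBasis n (.inl i)) (fun z => f (φ.symm z)) (φ x)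
        + (w i).im * dird (realBasis n (.inr i)) (fun z => f (φ.symm z)) (φ x)) := by
    intro w
    conv_lhs => rw [eq_sum_realBasis w]
    rw [dird_sum_vec, Fintype.sum_sum_type, ← Finset.sum_add_distrib]
    rfl
  have h2 : ∀ i, coordCovec φ x i v = w i := by
    intro i
    rw [← hw]; rfl
  rw [h1 w, h1 (Complex.I • w), partialCovec]
  refine (sum_smul_clm_apply _ _ _).trans ?_
  rw [Finset.sum_congr rfl fun i _ => congrArg (_ * ·) (h2 i)]
  push_cast
  rw [Finset.mul_sum, ← Finset.sum_sub_distrib]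
  refine Finset.sum_congr rfl fun i _ => ?_
  apply Complex.ext <;> simp <;> ring

theorem gradSq_eq_form (G : HermitianCotensor n M) {φ : OpenPartialHomeomorph M (Cn n)}
    (f : ℝ → M → ℝ) (t : ℝ) {x : M} (hx : x ∈ φ.source) :
    gradSq (realBasis n) (secondCoeff G φ) (funComp f φ) t (φ x)
      = (1 / 4) * (G.form t x (partialCovec φ (f t) x) (partialCovec φ (f t) x)).re := by
  have hcomp : ∀ i j, G.comp φ t (φ x) i j
      = G.form t x (coordCovec φ x j) (coordCovec φ x i) := by
    intro i j
    rw [HermitianCotensor.comp, φ.left_inv hx]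
  have h1 := bil_realMatrix (G.comp φ t (φ x))
    (fun p => dird (realBasis n p) (funComp f φ t) (φ x))
  refine h1.trans ?_
  have h2 := sesq_sum_smul (G.form t x)
    (fun i => (dird (realBasis n (.inl i)) (fun z => f t (φ.symm z)) (φ x) : ℂ)
      - Complex.I * (dird (realBasis n (.inr i)) (fun z => f t (φ.symm z)) (φ x) : ℂ))
    (fun i => coordCovec φ x i)
  rw [partialCovec, h2]
  simp only [hcomp]
  rfl

variable [IsManifold 𝓘(ℂ, Cn n) ω M]

/-- The chain rule for the transition map `τ = φ ∘ ψ.symm`, whose complex derivative carries the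
coordinates in `ψ` to those in `φ` and is then regarded as real linear. -/
theorem dird_coords_eq {f : M → ℝ} {φ ψ : OpenPartialHomeomorph M (Cn n)}
    (hφ : φ ∈ atlas (Cn n) M) (hψ : ψ ∈ atlas (Cn n) M) {x : M} (hxφ : x ∈ φ.source)
    (hxψ : x ∈ ψ.source)
    (hf : DifferentiableAt ℝ (fun z => f (φ.symm z)) (φ x)) (v : HTangent n x) :
    dird (coords ψ x v) (fun z => f (ψ.symm z)) (ψ x)
      = dird (coords φ x v) (fun z => f (φ.symm z)) (φ x) := by
  have mφ := (mdifferentiable_of_mem_atlas (I := 𝓘(ℂ, Cn n)) hφ).mdifferentiableAt hxφ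
  have mψ := (mdifferentiable_of_mem_atlas (I := 𝓘(ℂ, Cn n)) hψ).mdifferentiableAt hxψ
  have hz : ψ x ∈ ψ.target := ψ.map_source hxψ
  have mψs := (mdifferentiable_of_mem_atlas (I := 𝓘(ℂ, Cn n)) hψ).mdifferentiableAt_symm hz
  have hback : ψ.symm (ψ x) = x := ψ.left_inv hxψ
  set τ : Cn n → Cn n := fun z => φ (ψ.symm z) with hτ
  have mτ : MDifferentiableAt 𝓘(ℂ, Cn n) 𝓘(ℂ, Cn n) τ (ψ x) :=
    MDifferentiableAt.comp (ψ x) (by rw [hback]; exact mφ) mψs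
  have dτ : DifferentiableAt ℂ τ (ψ x) := mdifferentiableAt_iff_differentiableAt.1 mτ
  have hcoords : coords φ x v = fderiv ℂ τ (ψ x) (coords ψ x v) := by
    have hev : φ =ᶠ[𝓝 x] τ ∘ ψ := by
      filter_upwards [ψ.open_source.mem_nhds hxψ] with y hy
      simp [hτ, ψ.left_inv hy]
    have h1 : mfderiv 𝓘(ℂ, Cn n) 𝓘(ℂ, Cn n) φ x
        = mfderiv 𝓘(ℂ, Cn n) 𝓘(ℂ, Cn n) (τ ∘ ψ) x := hev.mfderiv_eq
    have h2 := mfderiv_comp x mτ mψ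
    rw [mfderiv_eq_fderiv] at h2
    have h3 := DFunLike.congr_fun (h1.trans h2) v
    exact h3
  have hev2 : (fun z => f (ψ.symm z)) =ᶠ[𝓝 (ψ x)] (fun z => f (φ.symm z)) ∘ τ := by
    have hcont : ContinuousAt ψ.symm (ψ x) := ψ.continuousAt_symm hz
    have : ∀ᶠ z in 𝓝 (ψ x), ψ.symm z ∈ φ.source :=
      hcont.eventually (by rw [hback]; exact φ.open_source.mem_nhds hxφ)
    filter_upwards [this] with z hz'
    simp [hτ, φ.left_inv hz']
  have hτx : τ (ψ x) = φ x := by simp [hτ, hback]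
  rw [dird_congr hev2, hcoords]
  have hfd : HasFDerivAt (fun z => f (φ.symm z)) (fderiv ℝ (fun z => f (φ.symm z)) (φ x))
      (τ (ψ x)) := by rw [hτx]; exact hf.hasFDerivAt
  have := (hfd.comp (ψ x) (dτ.hasFDerivAt.restrictScalars ℝ)).fderiv
  rw [dird, this]
  rfl

theorem partialCovec_eq {f : M → ℝ} {φ ψ : OpenPartialHomeomorph M (Cn n)}
    (hφ : φ ∈ atlas (Cn n) M) (hψ : ψ ∈ atlas (Cn n) M) {x : M} (hxφ : x ∈ φ.source)
    (hxψ : x ∈ ψ.source)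
    (hf : DifferentiableAt ℝ (fun z => f (φ.symm z)) (φ x)) :
    partialCovec ψ f x = partialCovec φ f x := by
  ext v
  rw [partialCovec_apply, partialCovec_apply, dird_coords_eq hφ hψ hxφ hxψ hf,
    dird_coords_eq hφ hψ hxφ hxψ hf]

theorem gradSq_eq_of_mem_source (G : HermitianCotensor n M) {f : ℝ → M → ℝ} {t : ℝ}
    {φ ψ : OpenPartialHomeomorph M (Cn n)}
    (hφ : φ ∈ atlas (Cn n) M) (hψ : ψ ∈ atlas (Cn n) M) {x : M} (hxφ : x ∈ φ.source)
    (hxψ : x ∈ ψ.source) (hf : DifferentiableAt ℝ (funComp f φ t) (φ x)) :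
    gradSq (realBasis n) (secondCoeff G ψ) (funComp f ψ) t (ψ x)
      = gradSq (realBasis n) (secondCoeff G φ) (funComp f φ) t (φ x) := by
  rw [gradSq_eq_form G f t hxφ, gradSq_eq_form G f t hxψ, partialCovec_eq hφ hψ hxφ hxψ hf]

end ChartIndependence

/-! ### The Li–Yau estimate on the manifold -/

section GlobalEstimate

theorem exists_pos_le_of_finite {N : ℕ} (κ : Fin N → ℝ) (h : ∀ α, 0 < κ α) :
    ∃ κ₀ : ℝ, 0 < κ₀ ∧ ∀ α, κ₀ ≤ κ α := by
  have hs : 0 ≤ ∑ α, (κ α)⁻¹ := Finset.sum_nonneg fun α _ => (inv_pos.2 (h α)).le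
  refine ⟨(∑ α, (κ α)⁻¹ + 1)⁻¹, by positivity, fun α => ?_⟩
  refine inv_le_of_inv_le₀ (h α) ?_
  have := Finset.single_le_sum (f := fun α => (κ α)⁻¹) (fun α _ => (inv_pos.2 (h α)).le)
    (Finset.mem_univ α)
  linarith

theorem eventually_abs_sub_le_one {E : Type*} [NormedAddCommGroup E] {I : Set ℝ} {U S : Set E}
    {g : ℝ → E → ℝ} (hg : ContinuousOn (fun p : ℝ × E => g p.1 p.2) (I ×ˢ U)) (hS : IsCompact S)
    (hSU : S ⊆ U) {b : ℝ} (hb : Icc 0 b ⊆ I) :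
    ∀ᶠ h in 𝓝[>] (0 : ℝ), ∀ z ∈ S, ∀ s ∈ Icc 0 b, ∀ s' ∈ Icc 0 b, |s' - s| ≤ h →
      |g s' z - g s z| ≤ 1 := by
  have huc := (isCompact_Icc.prod hS).uniformContinuousOn_of_continuous
    (hg.mono (prod_mono hb hSU))
  obtain ⟨δ, hδ, H⟩ := Metric.uniformContinuousOn_iff.1 huc 1 one_pos
  filter_upwards [Ioo_mem_nhdsGT hδ] with h hh z hz s hs s' hs' hss
  have := H (s', z) ⟨hs', hz⟩ (s, z) ⟨hs, hz⟩ (by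
    simpa [Prod.dist_eq, Real.dist_eq, hδ] using hss.trans_lt hh.2)
  rw [Real.dist_eq] at this
  exact this.le

variable {n : ℕ} {M : Type*} [TopologicalSpace M] [ChartedSpace (Cn n) M]

/-- The hypotheses of the Harnack inequality on the coefficients and on the solution. -/
structure IsAdmissible (g : HermitianMetric n M) (A : FiniteCover n M) (lam Lam : ℝ)
    (KG Kχ K₀ : ℝ≥0) (T : EReal) (G : HermitianCotensor n M)
    (χ : ∀ (_ : ℝ) (x : M), HTangent n x) (χ₀ u : ℝ → M → ℝ) : Prop where
  hG : IsCklOn 3 1 (timeInterval T) G.comp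
  hχ : IsCklOn 3 1 (timeInterval T) (vecComp χ)
  hχ₀ : IsCklOn (n := n) 3 1 (timeInterval T) (funComp χ₀)
  elliptic : UniformlyElliptic g lam Lam (timeInterval T) G
  bG : cklNorm A 3 1 (timeInterval T) G.comp ≤ KG
  bχ : cklNorm A 1 1 (timeInterval T) (vecComp χ) ≤ Kχ
  bχ₀ : cklNorm A 1 1 (timeInterval T) (funComp χ₀) ≤ K₀
  hu : IsCklOn (n := n) 3 2 (timeInterval T) (funComp u)
  pos : ∀ t ∈ timeInterval T, ∀ x : M, 0 < u t x
  sol : IsSolution (timeInterval T) G χ χ₀ u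

variable {g : HermitianMetric n M} {A : FiniteCover n M} {lam Lam : ℝ} {KG Kχ K₀ : ℝ≥0}
  {T : EReal} {G : HermitianCotensor n M} {χ : ∀ (_ : ℝ) (x : M), HTangent n x}
  {χ₀ u : ℝ → M → ℝ}

theorem IsAdmissible.isLogSolution (h : IsAdmissible g A lam Lam KG Kχ K₀ T G χ χ₀ u)
    {φ : OpenPartialHomeomorph M (Cn n)} (hφ : φ ∈ atlas (Cn n) M) :
    IsLogSolution (realBasis n) T φ.target (secondCoeff G φ) (firstCoeff χ φ) (funComp χ₀ φ)
      (funComp (fun t x => Real.log (u t x)) φ) :=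
  isLogSolution_of_isSolution hφ h.hG h.hχ h.hχ₀ h.hu h.pos h.sol

/-- The discretized Li–Yau quantity of `f` on the manifold. -/
noncomputable def liYauOn (G : HermitianCotensor n M) (f : ℝ → M → ℝ) (h t : ℝ) (x : M) : ℝ :=
  liYau (realBasis n) (secondCoeff G (chartAt (Cn n) x)) (funComp f (chartAt (Cn n) x)) h t
    (chartAt (Cn n) x x)

theorem IsLogSolution.continuousOn_liYau {E : Type*} [NormedAddCommGroup E] [NormedSpace ℝ E]
    {ι : Type*} [Fintype ι] {e : ι → E} {U : Set E} {a : ι → ι → ℝ → E → ℝ}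
    {b : ι → ℝ → E → ℝ} {c f : ℝ → E → ℝ} (hU : IsOpen U) (hs : IsLogSolution e T U a b c f)
    {h t₁ : ℝ} (hh : 0 ≤ h) (ht : t₁ + h ∈ timeInterval T) :
    ContinuousOn (fun p : ℝ × E => liYau e a f h p.1 p.2) (Icc 0 t₁ ×ˢ U) := by
  have hI : Icc 0 t₁ ⊆ timeInterval T := fun s hs =>
    mem_timeInterval_of_le ht hs.1 (by linarith [hs.2])
  have h1 := (hs.jointC_gradSq hU).continuousOn.mono (prod_mono hI subset_rfl)
  have h2 := hs.f_joint.continuousOn.mono (prod_mono hI subset_rfl)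
  have h3 : ContinuousOn (fun p : ℝ × E => f (p.1 + h) p.2) (Icc 0 t₁ ×ˢ U) := by
    refine hs.f_joint.continuousOn.comp (f := fun p : ℝ × E => (p.1 + h, p.2))
      (by fun_prop) fun p hp => ⟨?_, hp.2⟩
    exact mem_timeInterval_of_le ht (by linarith [hp.1.1]) (by linarith [hp.1.2])
  exact h1.sub (continuousOn_const.mul (h3.sub h2))

variable [IsManifold 𝓘(ℂ, Cn n) ω M]

theorem IsAdmissible.liYauOn_eq (hd : IsAdmissible g A lam Lam KG Kχ K₀ T G χ χ₀ u)
    {φ : OpenPartialHomeomorph M (Cn n)} (hφ : φ ∈ atlas (Cn n) M) {x : M} (hx : x ∈ φ.source)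
    {t : ℝ} (ht : t ∈ timeInterval T) (h : ℝ) :
    liYauOn G (fun t x => Real.log (u t x)) h t x
      = liYau (realBasis n) (secondCoeff G φ) (funComp (fun t x => Real.log (u t x)) φ) h t
          (φ x) := by
  have hc : x ∈ (chartAt (Cn n) x).source := mem_chart_source _ x
  rw [liYauOn, liYau, liYau, gradSq_eq_of_mem_source G hφ (chart_mem_atlas _ x) hx hc
    ((hd.isLogSolution hφ).f_joint.differentiableAt ht (φ.map_source hx))]
  simp only [funComp, φ.left_inv hx, (chartAt (Cn n) x).left_inv hc]

theorem IsAdmissible.continuousOn_liYauOn (hd : IsAdmissible g A lam Lam KG Kχ K₀ T G χ χ₀ u)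
    {h t₁ : ℝ} (hh : 0 ≤ h) (ht : t₁ + h ∈ timeInterval T) :
    ContinuousOn (fun p : ℝ × M => liYauOn G (fun t x => Real.log (u t x)) h p.1 p.2)
      (Icc 0 t₁ ×ˢ univ) := by
  rintro ⟨s, x⟩ hp
  have hφ := chart_mem_atlas (Cn n) x
  set φ := chartAt (Cn n) x with hφ'
  have hx : x ∈ φ.source := mem_chart_source _ x
  have h1 := (hd.isLogSolution hφ).continuousOn_liYau φ.open_target hh ht
  have h2 : ContinuousOn (fun p : ℝ × M => ((p.1, φ p.2) : ℝ × Cn n)) (Icc 0 t₁ ×ˢ φ.source) :=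
    continuousOn_fst.prodMk (φ.continuousOn.comp continuousOn_snd fun p hp => hp.2)
  have h3 : ContinuousOn (fun p : ℝ × M => liYauOn G (fun t x => Real.log (u t x)) h p.1 p.2)
      (Icc 0 t₁ ×ˢ φ.source) := by
    refine (h1.comp h2 fun p hp => ⟨hp.1, φ.map_source hp.2⟩).congr fun p hp => ?_
    exact hd.liYauOn_eq hφ hp.2
      (mem_timeInterval_of_le ht hp.1.1 (by linarith [hp.1.2])) h
  refine (h3 (s, x) ⟨hp.1, hx⟩).mono_of_mem_nhdsWithin ?_
  have : (univ : Set ℝ) ×ˢ φ.source ∈ 𝓝 (s, x) :=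
    prod_mem_nhds univ_mem (φ.open_source.mem_nhds hx)
  filter_upwards [self_mem_nhdsWithin, mem_nhdsWithin_of_mem_nhds this] with p hp1 hp2
  exact ⟨hp1.1, hp2.2⟩

/-- For small `h` the discretized quantity times `t` attains its maximum over `[0, t₁] × M`, and the
local bound applies at that point. The constants come from the finitely many charts of the cover,
while the conclusion holds in every chart of the atlas. -/
theorem exists_liYau_estimate [CompactSpace M] (g : HermitianMetric n M) (A : FiniteCover n M)
    {lam : ℝ} (Lam : ℝ) (hlam : 0 < lam) (KG Kχ K₀ : ℝ≥0) :
    ∃ C : ℝ, 0 < C ∧ ∀ (T : EReal) (G : HermitianCotensor n M)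
      (χ : ∀ (_ : ℝ) (x : M), HTangent n x) (χ₀ u : ℝ → M → ℝ),
      IsAdmissible g A lam Lam KG Kχ K₀ T G χ χ₀ u →
      ∀ φ ∈ atlas (Cn n) M, ∀ z ∈ φ.target, ∀ t ∈ timeInterval T, 0 < t →
      t * (gradSq (realBasis n) (secondCoeff G φ) (funComp (fun t x => Real.log (u t x)) φ) t z
        - 2 * logRhs (realBasis n) (secondCoeff G φ) (firstCoeff χ φ) (funComp χ₀ φ)
            (funComp (fun t x => Real.log (u t x)) φ) t z) ≤ C * (t + 1) := by
  have hScomp : ∀ α, IsCompact (A.chart α '' A.K α) := fun α =>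
    (A.isCompact α).image_of_continuousOn ((A.chart α).continuousOn.mono (A.subset_source α))
  have hSsub : ∀ α, A.chart α '' A.K α ⊆ (A.chart α).target := fun α => by
    rintro _ ⟨x, hx, rfl⟩
    exact (A.chart α).map_source (A.subset_source α hx)
  choose κ hκ0 hκ using fun α =>
    exists_ellipticity_const g (A.chart_mem α) (hScomp α) (hSsub α) hlam
  obtain ⟨κ₀, hκ₀, hκle⟩ := exists_pos_le_of_finite κ hκ0
  obtain ⟨C, hC, hbound⟩ := exists_bound_liYau_of_localMax (realBasis n) hκ₀
    ((KG + Kχ + K₀ : ℝ≥0) : ℝ≥0).2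
  refine ⟨C, hC, ?_⟩
  intro T G χ χ₀ u hd φ hφ z hz t₁ ht₁ h0
  set f : ℝ → M → ℝ := fun t x => Real.log (u t x) with hf
  obtain ⟨δ, hδ, hball⟩ := Metric.mem_nhds_iff.1 (timeInterval_mem_nhds ht₁ h0)
  -- A little room beyond `t₁` keeps `t + h` in the time interval for all `t ≤ t₁` and `h < δ / 2`.
  set t₂ := t₁ + δ / 2 with ht₂
  have ht₂I : t₂ ∈ timeInterval T := (hball (by
    rw [Metric.mem_ball, Real.dist_eq, ht₂, add_sub_cancel_left, abs_of_pos] <;> linarith)).1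
  have hI : Icc 0 t₂ ⊆ timeInterval T := fun s hs => mem_timeInterval_of_le ht₂I hs.1 hs.2
  have hsol := fun α => hd.isLogSolution (A.chart_mem α)
  -- How small `h` must be depends on the solution, through uniform continuity on compact sets, but
  -- the resulting tolerance `1` does not.
  have hclose : ∀ᶠ h in 𝓝[>] (0 : ℝ), ∀ α, ∀ z ∈ A.chart α '' A.K α, ∀ s ∈ Icc 0 t₂,
      ∀ s' ∈ Icc 0 t₂, |s' - s| ≤ h →
      (∀ p, |dird (realBasis n p) (funComp f (A.chart α) s') z
        - dird (realBasis n p) (funComp f (A.chart α) s) z| ≤ 1) ∧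
      (∀ p q, |dird (realBasis n p) (dird (realBasis n q) (funComp f (A.chart α) s')) z
        - dird (realBasis n p) (dird (realBasis n q) (funComp f (A.chart α) s)) z| ≤ 1) ∧
      |logRhs (realBasis n) (secondCoeff G (A.chart α)) (firstCoeff χ (A.chart α))
          (funComp χ₀ (A.chart α)) (funComp f (A.chart α)) s' z
        - logRhs (realBasis n) (secondCoeff G (A.chart α)) (firstCoeff χ (A.chart α))
          (funComp χ₀ (A.chart α)) (funComp f (A.chart α)) s z| ≤ 1 := by
    have h1 : ∀ α p, _ := fun α p => eventually_abs_sub_le_one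
      (g := fun s z => dird (realBasis n p) (funComp f (A.chart α) s) z)
      ((hsol α).f_joint.dird p).continuousOn (hScomp α) (hSsub α) hI
    have h2 : ∀ α p q, _ := fun α p q => eventually_abs_sub_le_one
      (g := fun s z => dird (realBasis n p) (dird (realBasis n q) (funComp f (A.chart α) s)) z)
      (((hsol α).f_joint.dird q).dird p).continuousOn (hScomp α) (hSsub α) hI
    have h3 : ∀ α, _ := fun α => eventually_abs_sub_le_one
      ((hsol α).jointC_logRhs (A.chart α).open_target).continuousOn (hScomp α) (hSsub α) hI
    refine eventually_all.2 fun α => ?_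
    filter_upwards [eventually_all.2 (h1 α),
      eventually_all.2 fun p => eventually_all.2 (h2 α p), h3 α] with h H1 H2 H3 z hz s hs s' hs' hss
    exact ⟨fun p => H1 p z hz s hs s' hs' hss, fun p q => H2 p q z hz s hs s' hs' hss,
      H3 z hz s hs s' hs' hss⟩
  have key : ∀ᶠ h in 𝓝[>] (0 : ℝ),
      t₁ * liYau (realBasis n) (secondCoeff G φ) (funComp f φ) h t₁ z ≤ C * (t₁ + 1) := by
    filter_upwards [hclose, Ioo_mem_nhdsGT (half_pos hδ)] with h hcl hh
    have hth : t₁ + h ∈ timeInterval T :=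
      mem_timeInterval_of_le ht₂I (by linarith [hh.1]) (by linarith [hh.2])
    have hx : φ.symm z ∈ φ.source := φ.map_target hz
    have heq : liYau (realBasis n) (secondCoeff G φ) (funComp f φ) h t₁ z
        = liYauOn G f h t₁ (φ.symm z) := by
      rw [hd.liYauOn_eq hφ hx ht₁ h, φ.right_inv hz]
    rw [heq]
    by_contra! hlt
    have hpos₁ : 0 < t₁ * liYauOn G f h t₁ (φ.symm z) := lt_trans (by positivity) hlt
    have hcont : ContinuousOn (fun p : ℝ × M => p.1 * liYauOn G f h p.1 p.2)
        (Icc 0 t₁ ×ˢ univ) := continuousOn_fst.mul (hd.continuousOn_liYauOn hh.1.le hth)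
    obtain ⟨⟨t₀, x₀⟩, hmem, hmax⟩ := (isCompact_Icc.prod isCompact_univ).exists_isMaxOn
      ⟨(t₁, φ.symm z), ⟨⟨h0.le, le_rfl⟩, mem_univ _⟩⟩ hcont
    have hmax' : ∀ s ∈ Icc 0 t₁, ∀ x, s * liYauOn G f h s x ≤ t₀ * liYauOn G f h t₀ x₀ :=
      fun s hs x => hmax (a := (s, x)) ⟨hs, mem_univ _⟩
    have hFpos : 0 < t₀ * liYauOn G f h t₀ x₀ :=
      hpos₁.trans_le (hmax' t₁ ⟨h0.le, le_rfl⟩ _)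
    -- The weight `t` vanishes at the initial time, so a positive maximum is not attained there.
    have ht₀ : 0 < t₀ := lt_of_le_of_ne hmem.1.1 fun h' => by simp [← h'] at hFpos
    have hLpos : 0 < liYauOn G f h t₀ x₀ := pos_of_mul_pos_right hFpos ht₀.le
    have ht₀I : t₀ ∈ timeInterval T := mem_timeInterval_of_le ht₁ ht₀.le hmem.1.2
    have ht₀₂ : t₀ ∈ Icc 0 t₂ := ⟨ht₀.le, by linarith [hmem.1.2]⟩
    have hsub : ∀ s ∈ Icc t₀ (t₀ + h), s ∈ Icc 0 t₂ := fun s hs =>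
      ⟨ht₀.le.trans hs.1, by linarith [hs.2, hmem.1.2, hh.2]⟩
    obtain ⟨α, hα⟩ : ∃ α, x₀ ∈ A.K α := by
      have : x₀ ∈ ⋃ α, A.K α := by rw [A.covers]; trivial
      simpa using this
    have hxs : x₀ ∈ (A.chart α).source := A.subset_source α hα
    have hz₀ : A.chart α x₀ ∈ (A.chart α).target := (A.chart α).map_source hxs
    have hzS : A.chart α x₀ ∈ A.chart α '' A.K α := mem_image_of_mem _ hα
    have heq' : ∀ s ∈ timeInterval T, ∀ y ∈ (A.chart α).target,
        liYau (realBasis n) (secondCoeff G (A.chart α)) (funComp f (A.chart α)) h s y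
          = liYauOn G f h s ((A.chart α).symm y) := by
      intro s hs y hy
      rw [hd.liYauOn_eq (A.chart_mem α) ((A.chart α).map_target hy) hs h,
        (A.chart α).right_inv hy]
    have heq₀ : ∀ s ∈ timeInterval T,
        liYau (realBasis n) (secondCoeff G (A.chart α)) (funComp f (A.chart α)) h s
          (A.chart α x₀) = liYauOn G f h s x₀ := by
      intro s hs
      rw [heq' s hs _ hz₀, (A.chart α).left_inv hxs]
    have hcl₀ := fun s hs => hcl α _ hzS t₀ ht₀₂ s (hsub s hs)
    have hend := hcl₀ (t₀ + h) ⟨by linarith [hh.1], le_rfl⟩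
      (by rw [add_sub_cancel_left, abs_of_pos hh.1])
    have hfin := hbound T (A.chart α).target (secondCoeff G (A.chart α))
      (firstCoeff χ (A.chart α)) (funComp χ₀ (A.chart α)) (funComp f (A.chart α))
      (A.chart α).open_target (hsol α) t₀ h (A.chart α x₀) hz₀ ht₀ hh.1
      (hI (hsub _ ⟨by linarith [hh.1], le_rfl⟩))
      (coeffBounds_of_cklNorm_le hd.hG hd.hχ hd.hχ₀ hd.bG hd.bχ hd.bχ₀ hα)
      (fun ξ => (mul_le_mul_of_nonneg_right (hκle α)
        (Finset.sum_nonneg fun _ _ => sq_nonneg _)).trans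
        (hκ α Lam _ G hd.elliptic t₀ ht₀I _ hzS ξ))
      hend.1 hend.2.1
      (fun s hs => (hcl₀ s hs (by rw [abs_of_nonneg] <;> linarith [hs.1, hs.2])).2.2)
      (by
        filter_upwards [(A.chart α).open_target.mem_nhds hz₀] with y hy
        rw [heq' t₀ ht₀I y hy, heq₀ t₀ ht₀I]
        exact le_of_mul_le_mul_left (hmax' t₀ hmem.1 _) ht₀)
      (by
        filter_upwards [Ioo_mem_nhdsLT ht₀] with s hs
        have hsI : s ∈ timeInterval T := mem_timeInterval_of_le ht₀I hs.1.le hs.2.le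
        rw [heq₀ s hsI, heq₀ t₀ ht₀I]
        exact hmax' s ⟨hs.1.le, hs.2.le.trans hmem.1.2⟩ _)
      (by rw [heq₀ t₀ ht₀I]; exact hLpos)
    rw [heq₀ t₀ ht₀I] at hfin
    have h5 : C * (t₀ + 1) ≤ C * (t₁ + 1) :=
      mul_le_mul_of_nonneg_left (by linarith [hmem.1.2]) hC.le
    linarith [hmax' t₁ ⟨h0.le, le_rfl⟩ (φ.symm z)]
  have hlim : Tendsto (fun h => t₁ * liYau (realBasis n) (secondCoeff G φ) (funComp f φ) h t₁ z)
      (𝓝[>] 0) (𝓝 (t₁ * (gradSq (realBasis n) (secondCoeff G φ) (funComp f φ) t₁ z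
        - 2 * logRhs (realBasis n) (secondCoeff G φ) (firstCoeff χ φ) (funComp χ₀ φ)
            (funComp f φ) t₁ z))) := by
    have h1 := ((hd.isLogSolution hφ).eqn z hz t₁ ht₁ h0).tendsto_slope_zero_right
    refine (tendsto_const_nhds.sub (h1.const_mul 2)).const_mul t₁ |>.congr fun h => ?_
    rw [liYau, smul_eq_mul]
    ring
  exact le_of_tendsto hlim key

end GlobalEstimate

/-! ### Integration of the Li–Yau estimate along segments -/

section PathIntegration

variable {n : ℕ}

theorem fderiv_eq_sum_dird (g : Cn n → ℝ) (z : Cn n) :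
    fderiv ℝ g z = ∑ p, dird (realBasis n p) g z • realVector p := by
  ext v
  have h1 : ∀ p, realVector p v = (Sum.elim (fun i => (v i).re) (fun i => (v i).im) p : ℝ) := by
    rintro (i | i) <;> rfl
  conv_lhs => rw [eq_sum_realBasis v]
  rw [map_sum, sum_apply]
  refine Finset.sum_congr rfl fun p _ => ?_
  rw [map_smul, smul_apply, h1, smul_eq_mul, smul_eq_mul, mul_comm]
  rfl

theorem dird_eq_dot (v : Cn n) (g : Cn n → ℝ) (z : Cn n) :
    dird v g z = dot (fun p => realVector p v) (fun p => dird (realBasis n p) g z) := by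
  rw [dird, fderiv_eq_sum_dird, sum_apply]
  exact Finset.sum_congr rfl fun p _ => by rw [smul_apply, smul_eq_mul, mul_comm]

theorem sum_realVector_sq (v : Cn n) : ∑ p, realVector p v ^ 2 = ‖v‖ ^ 2 := by
  rw [EuclideanSpace.norm_sq_eq, Fintype.sum_sum_type, ← Finset.sum_add_distrib]
  refine Finset.sum_congr rfl fun i _ => ?_
  rw [← Complex.normSq_eq_norm_sq, Complex.normSq_apply]
  simp [realVector]
  ring

theorem neg_le_dot_add {ι : Type*} [Fintype ι] {κ : ℝ} (hκ : 0 < κ) (w x : ι → ℝ) :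
    -((∑ p, w p ^ 2) / (2 * κ)) ≤ dot w x + κ * (∑ p, x p ^ 2) / 2 := by
  rw [dot, Finset.sum_div, ← Finset.sum_neg_distrib, Finset.mul_sum, Finset.sum_div,
    ← Finset.sum_add_distrib]
  refine Finset.sum_le_sum fun p _ => ?_
  have h : w p * x p + κ * x p ^ 2 / 2 + w p ^ 2 / (2 * κ) = (κ * x p + w p) ^ 2 / (2 * κ) := by
    field_simp
    ring
  have : 0 ≤ (κ * x p + w p) ^ 2 / (2 * κ) := by positivity
  linarith

/-- Continuous partial derivatives in time and space make `f` strictly differentiable in both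
together, so the chain rule applies along the moving point. -/
theorem IsLogSolution.hasDerivAt_comp_line {T : EReal} {U : Set (Cn n)}
    {a : Fin n ⊕ Fin n → Fin n ⊕ Fin n → ℝ → Cn n → ℝ} {b : Fin n ⊕ Fin n → ℝ → Cn n → ℝ}
    {c f : ℝ → Cn n → ℝ} (hU : IsOpen U) (h : IsLogSolution (realBasis n) T U a b c f)
    {s t : ℝ} (hs : s ∈ timeInterval T) (h0 : 0 < s) {z w : Cn n} (hz : z + (s - t) • w ∈ U) :
    HasDerivAt (fun r => f r (z + (r - t) • w))
      (logRhs (realBasis n) a b c f s (z + (s - t) • w) + dird w (f s) (z + (s - t) • w)) s := by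
  set y := z + (s - t) • w with hy
  have hnhds : (timeInterval T ∩ Ioi 0) ×ˢ U ∈ 𝓝 (s, y) :=
    prod_mem_nhds (timeInterval_mem_nhds hs h0) (hU.mem_nhds hz)
  have hnhds' : timeInterval T ×ˢ U ∈ 𝓝 (s, y) :=
    mem_of_superset hnhds (prod_mono inter_subset_left subset_rfl)
  have hc2 : ContinuousAt (fun p : ℝ × Cn n => fderiv ℝ (f p.1) p.2) (s, y) := by
    simp only [fderiv_eq_sum_dird]
    refine tendsto_finsetSum _ fun p _ => ?_
    exact (((h.f_joint.dird p).continuousOn.continuousAt hnhds').smul continuousAt_const)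
  have hc1 : ContinuousAt (fun p : ℝ × Cn n => ContinuousLinearMap.toSpanSingleton ℝ
      (logRhs (realBasis n) a b c f p.1 p.2)) (s, y) := by
    have := (h.jointC_logRhs hU).continuousOn.continuousAt hnhds'
    exact (ContinuousLinearMap.toSpanSingletonCLE (𝕜 := ℝ) (E := ℝ)).continuous.continuousAt.comp this
  have hstrict := hasStrictFDerivAt_uncurry_coprod (𝕜 := ℝ) (u := (s, y)) (f := f)
    (f₁ := fun t z => ContinuousLinearMap.toSpanSingleton ℝ (logRhs (realBasis n) a b c f t z))
    (f₂ := fun t z => fderiv ℝ (f t) z)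
    (by filter_upwards [hnhds] with p hp
        exact (h.eqn p.2 hp.2 p.1 hp.1.1 hp.1.2).hasFDerivAt)
    (by filter_upwards [hnhds'] with p hp
        exact (h.f_joint.differentiableAt hp.1 hp.2).hasFDerivAt) hc1 hc2
  have hcurve : HasDerivAt (fun r : ℝ => (r, z + (r - t) • w)) ((1 : ℝ), w) s := by
    refine (hasDerivAt_id s).prodMk ?_
    simpa using (((hasDerivAt_id s).sub_const t).smul_const w).const_add z
  have := hstrict.hasFDerivAt.comp_hasDerivAt s hcurve
  refine this.congr_deriv ?_
  simp [Function.HasUncurry.uncurry, dird]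

/-- Along the segment, `d/ds f = f_t + ∂_w f ≥ |∇f|²_a / 2 - (C/2)(1 + 1/s) + ∂_w f`. Ellipticity
and completing the square in the gradient leave `-|w|²/(2κ)`, and integration over `[t, τ]` gives
the bound. -/
theorem IsLogSolution.sub_le_of_liYau {T : EReal} {U S : Set (Cn n)}
    {a : Fin n ⊕ Fin n → Fin n ⊕ Fin n → ℝ → Cn n → ℝ} {b : Fin n ⊕ Fin n → ℝ → Cn n → ℝ}
    {c f : ℝ → Cn n → ℝ} (hU : IsOpen U) (h : IsLogSolution (realBasis n) T U a b c f)
    (hS : Convex ℝ S) (hSU : S ⊆ U) {κ C : ℝ} (hκ : 0 < κ)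
    (hell : ∀ t ∈ timeInterval T, ∀ z ∈ S, ∀ ξ : Fin n ⊕ Fin n → ℝ,
      κ * ∑ p, ξ p ^ 2 ≤ bil (fun p q => a p q t z) ξ ξ)
    (hLY : ∀ z ∈ S, ∀ t ∈ timeInterval T, 0 < t →
      t * (gradSq (realBasis n) a f t z - 2 * logRhs (realBasis n) a b c f t z) ≤ C * (t + 1))
    {z₀ z₁ : Cn n} (hz₀ : z₀ ∈ S) (hz₁ : z₁ ∈ S) {t τ : ℝ} (ht : 0 < t) (htτ : t < τ)
    (hτ : τ ∈ timeInterval T) :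
    f t z₀ - f τ z₁ ≤ C / 2 * (Real.log (τ / t) + (τ - t))
      + ‖z₁ - z₀‖ ^ 2 / (2 * κ) / (τ - t) := by
  have hd : 0 < τ - t := sub_pos.2 htτ
  -- The constant velocity that reaches `z₁` exactly at time `τ`.
  set w := (τ - t)⁻¹ • (z₁ - z₀) with hw
  set D := ‖w‖ ^ 2 / (2 * κ) with hD
  have hline : ∀ s ∈ Icc t τ, z₀ + (s - t) • w ∈ S := by
    intro s hs
    have := hS.add_smul_sub_mem hz₀ hz₁ (t := (s - t) * (τ - t)⁻¹)
      ⟨mul_nonneg (by linarith [hs.1]) (inv_pos.2 hd).le, by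
        rw [← div_eq_mul_inv, div_le_one hd]; linarith [hs.2]⟩
    rwa [mul_smul] at this
  have hI : ∀ s ∈ Icc t τ, s ∈ timeInterval T ∧ 0 < s := fun s hs =>
    ⟨mem_timeInterval_of_le hτ (ht.le.trans hs.1) hs.2, ht.trans_le hs.1⟩
  have hder : ∀ s ∈ Icc t τ, HasDerivAt
      (fun r => f r (z₀ + (r - t) • w) + C / 2 * (r + Real.log r) + D * r)
      (logRhs (realBasis n) a b c f s (z₀ + (s - t) • w) + dird w (f s) (z₀ + (s - t) • w)
        + C / 2 * (1 + s⁻¹) + D * 1) s := fun s hs =>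
    ((h.hasDerivAt_comp_line hU (hI s hs).1 (hI s hs).2 (hSU (hline s hs))).add
      (((hasDerivAt_id s).add (Real.hasDerivAt_log (hI s hs).2.ne')).const_mul (C / 2))).add
      ((hasDerivAt_id s).const_mul D)
  have hnn : ∀ s ∈ Icc t τ, 0 ≤ logRhs (realBasis n) a b c f s (z₀ + (s - t) • w)
      + dird w (f s) (z₀ + (s - t) • w) + C / 2 * (1 + s⁻¹) + D * 1 := by
    intro s hs
    have hs0 := (hI s hs).2
    have h1 := hLY _ (hline s hs) s (hI s hs).1 hs0
    have h2 := hell s (hI s hs).1 _ (hline s hs)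
      fun p => dird (realBasis n p) (f s) (z₀ + (s - t) • w)
    have h3 := neg_le_dot_add hκ (fun p => realVector p w)
      fun p => dird (realBasis n p) (f s) (z₀ + (s - t) • w)
    rw [sum_realVector_sq, ← dird_eq_dot] at h3
    have h4 : gradSq (realBasis n) a f s (z₀ + (s - t) • w)
        - 2 * logRhs (realBasis n) a b c f s (z₀ + (s - t) • w) ≤ C * (1 + s⁻¹) := by
      refine le_of_mul_le_mul_left (h1.trans_eq ?_) hs0
      field_simp
    have h5 : gradSq (realBasis n) a f s (z₀ + (s - t) • w) = bil (fun p q => a p q s (z₀ + (s - t) • w))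
      (fun p => dird (realBasis n p) (f s) (z₀ + (s - t) • w))
      (fun p => dird (realBasis n p) (f s) (z₀ + (s - t) • w)) := rfl
    rw [← h5] at h2
    linarith
  have hmono : MonotoneOn (fun r => f r (z₀ + (r - t) • w) + C / 2 * (r + Real.log r) + D * r)
      (Icc t τ) := by
    refine monotoneOn_of_deriv_nonneg (convex_Icc t τ)
      (fun s hs => (hder s hs).continuousAt.continuousWithinAt)
      (fun s hs => (hder s (interior_subset hs)).differentiableAt.differentiableWithinAt)
      fun s hs => ?_
    rw [(hder s (interior_subset hs)).deriv]
    exact hnn s (interior_subset hs)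
  have hfin := hmono ⟨le_rfl, htτ.le⟩ ⟨htτ.le, le_rfl⟩ htτ.le
  have hend : z₀ + (τ - t) • w = z₁ := by
    rw [hw, smul_smul, mul_inv_cancel₀ hd.ne', one_smul]; abel
  simp only [sub_self, zero_smul, add_zero, hend] at hfin
  have hDval : D * (τ - t) = ‖z₁ - z₀‖ ^ 2 / (2 * κ) / (τ - t) := by
    rw [hD, hw, norm_smul, norm_inv, Real.norm_of_nonneg hd.le]
    field_simp
  rw [← hDval, Real.log_div (ht.trans htτ).ne' ht.ne']
  linarith

end PathIntegration

/-! ### Chaining local Harnack inequalities -/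

section Chaining

variable {n : ℕ} {M : Type*} [TopologicalSpace M] [ChartedSpace (Cn n) M]

/-- A Harnack inequality between the points `x` and `y`, for all admissible equations. -/
def PointHarnack (g : HermitianMetric n M) (A : FiniteCover n M) (lam Lam : ℝ)
    (KG Kχ K₀ : ℝ≥0) (C B : ℝ) (x y : M) : Prop :=
  ∀ (T : EReal) (G : HermitianCotensor n M) (χ : ∀ (_ : ℝ) (x : M), HTangent n x)
    (χ₀ u : ℝ → M → ℝ), IsAdmissible g A lam Lam KG Kχ K₀ T G χ χ₀ u →
    ∀ t τ : ℝ, 0 < t → t < τ → τ ∈ timeInterval T →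
      Real.log (u t x) - Real.log (u τ y)
        ≤ C * (Real.log (τ / t) + (τ - t)) + B / (τ - t)

variable {g : HermitianMetric n M} {A : FiniteCover n M} {lam Lam : ℝ} {KG Kχ K₀ : ℝ≥0}
  {C B B' : ℝ} {x y z : M}

theorem PointHarnack.mono (h : PointHarnack g A lam Lam KG Kχ K₀ C B x y) (hB : B ≤ B') :
    PointHarnack g A lam Lam KG Kχ K₀ C B' x y :=
  fun T G χ χ₀ u hd t τ ht htτ hτ => (h T G χ χ₀ u hd t τ ht htτ hτ).trans
    (by have := div_le_div_of_nonneg_right hB (sub_pos.2 htτ).le; linarith)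

/-- Pass through `y` at the midpoint of the time interval. The terms with `C` telescope, so `C` is
preserved, and halving the elapsed time doubles `B` and `B'`. -/
theorem PointHarnack.trans (h : PointHarnack g A lam Lam KG Kχ K₀ C B x y)
    (h' : PointHarnack g A lam Lam KG Kχ K₀ C B' y z) :
    PointHarnack g A lam Lam KG Kχ K₀ C (2 * B + 2 * B') x z := by
  intro T G χ χ₀ u hd t τ ht htτ hτ
  have hτ0 : 0 < τ := ht.trans htτ
  have hσ0 : 0 < (t + τ) / 2 := by linarith
  have hσ : (t + τ) / 2 ∈ timeInterval T := mem_timeInterval_of_le hτ hσ0.le (by linarith)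
  have h1 := h T G χ χ₀ u hd t _ ht (by linarith) hσ
  have h2 := h' T G χ χ₀ u hd _ τ hσ0 (by linarith) hτ
  have hne : τ - t ≠ 0 := (sub_pos.2 htτ).ne'
  have e1 : B / ((t + τ) / 2 - t) = 2 * B / (τ - t) := by
    rw [show (t + τ) / 2 - t = (τ - t) / 2 by ring]; field_simp
  have e2 : B' / (τ - (t + τ) / 2) = 2 * B' / (τ - t) := by
    rw [show τ - (t + τ) / 2 = (τ - t) / 2 by ring]; field_simp
  rw [e1, Real.log_div hσ0.ne' ht.ne'] at h1
  rw [e2, Real.log_div hτ0.ne' hσ0.ne'] at h2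
  rw [Real.log_div hτ0.ne' ht.ne', add_div]
  linarith

variable [IsManifold 𝓘(ℂ, Cn n) ω M]

theorem exists_local_pointHarnack (g : HermitianMetric n M) (A : FiniteCover n M) {lam Lam : ℝ}
    (hlam : 0 < lam) {KG Kχ K₀ : ℝ≥0} {C : ℝ}
    (hLY : ∀ (T : EReal) (G : HermitianCotensor n M)
      (χ : ∀ (_ : ℝ) (x : M), HTangent n x) (χ₀ u : ℝ → M → ℝ),
      IsAdmissible g A lam Lam KG Kχ K₀ T G χ χ₀ u →
      ∀ φ ∈ atlas (Cn n) M, ∀ z ∈ φ.target, ∀ t ∈ timeInterval T, 0 < t →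
      t * (gradSq (realBasis n) (secondCoeff G φ) (funComp (fun t x => Real.log (u t x)) φ) t z
        - 2 * logRhs (realBasis n) (secondCoeff G φ) (firstCoeff χ φ) (funComp χ₀ φ)
            (funComp (fun t x => Real.log (u t x)) φ) t z) ≤ C * (t + 1)) (x₀ : M) :
    ∃ V ∈ 𝓝 x₀, ∃ B : ℝ, 0 ≤ B ∧ ∀ x ∈ V, ∀ y ∈ V,
      PointHarnack g A lam Lam KG Kχ K₀ (C / 2) B x y := by
  have hφ := chart_mem_atlas (Cn n) x₀
  set φ := chartAt (Cn n) x₀ with hφ'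
  have hx₀ : x₀ ∈ φ.source := mem_chart_source _ x₀
  obtain ⟨r, hr, hball⟩ := Metric.nhds_basis_closedBall.mem_iff.1
    (φ.open_target.mem_nhds (φ.map_source hx₀))
  obtain ⟨κ, hκ, hell⟩ := exists_ellipticity_const g hφ
    (isCompact_closedBall (φ x₀) r) hball hlam
  refine ⟨φ.source ∩ φ ⁻¹' Metric.closedBall (φ x₀) r,
    inter_mem (φ.open_source.mem_nhds hx₀)
      ((φ.continuousAt hx₀).preimage_mem_nhds (Metric.closedBall_mem_nhds _ hr)),
    (2 * r) ^ 2 / (2 * κ), by positivity, ?_⟩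
  intro x hx y hy T G χ χ₀ u hd t τ ht htτ hτ
  have h1 := (hd.isLogSolution hφ).sub_le_of_liYau φ.open_target (convex_closedBall (φ x₀) r)
    hball hκ (hell Lam _ G hd.elliptic)
    (fun z hz t ht h0 => hLY T G χ χ₀ u hd φ hφ z (hball hz) t ht h0) hx.2 hy.2 ht htτ hτ
  simp only [funComp, φ.left_inv hx.1, φ.left_inv hy.1] at h1
  refine h1.trans (add_le_add le_rfl ?_)
  refine div_le_div_of_nonneg_right ?_ (sub_pos.2 htτ).le
  refine div_le_div_of_nonneg_right (pow_le_pow_left₀ (norm_nonneg _) ?_ 2) (by positivity)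
  rw [← dist_eq_norm]
  have h2 := dist_triangle_right (φ y) (φ x) (φ x₀)
  have h3 := Metric.mem_closedBall.1 hx.2
  have h4 := Metric.mem_closedBall.1 hy.2
  linarith

/-- A transitive family of relations which holds locally holds globally on a compact connected
space, with a uniform constant. -/
theorem exists_uniform_of_local {X : Type*} [TopologicalSpace X] [CompactSpace X]
    [ConnectedSpace X] (R : ℝ → X → X → Prop)
    (hmono : ∀ {B B' : ℝ} {x y : X}, R B x y → B ≤ B' → R B' x y)
    (htrans : ∀ {B B' : ℝ} {x y z : X}, R B x y → R B' y z → R (2 * B + 2 * B') x z)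
    (hloc : ∀ x₀ : X, ∃ V ∈ 𝓝 x₀, ∃ B : ℝ, 0 ≤ B ∧ ∀ x ∈ V, ∀ y ∈ V, R B x y) :
    ∃ B : ℝ, 0 ≤ B ∧ ∀ x y, R B x y := by
  obtain ⟨x₀⟩ := (inferInstance : Nonempty X)
  -- The relation need not be symmetric, so both directions are recorded. The local hypothesis makes
  -- `W` and its complement open, and connectedness gives `W = univ`.
  set W : Set X := {y | ∃ B : ℝ, 0 ≤ B ∧ R B x₀ y ∧ R B y x₀} with hW
  have hstep : ∀ y : X, ∃ V ∈ 𝓝 y, ∀ z ∈ V, ∀ z' ∈ V, z ∈ W → z' ∈ W := by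
    intro y
    obtain ⟨V, hV, B, hB, h⟩ := hloc y
    refine ⟨V, hV, fun z hz z' hz' ⟨B', hB', h1, h2⟩ => ⟨2 * B + 2 * B', by positivity, ?_, ?_⟩⟩
    · exact hmono (htrans h1 (h z hz z' hz')) (by linarith)
    · exact htrans (h z' hz' z hz) h2
  have hopen : IsOpen W := isOpen_iff_mem_nhds.2 fun y hy => by
    obtain ⟨V, hV, h⟩ := hstep y
    exact mem_of_superset hV fun z hz => h y (mem_of_mem_nhds hV) z hz hy
  have hclosed : IsClosed W := isOpen_compl_iff.1 <| isOpen_iff_mem_nhds.2 fun y hy => by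
    obtain ⟨V, hV, h⟩ := hstep y
    exact mem_of_superset hV fun z hz hzW => hy (h z hz y (mem_of_mem_nhds hV) hzW)
  have hne : W.Nonempty := by
    obtain ⟨V, hV, B, hB, h⟩ := hloc x₀
    have hx := mem_of_mem_nhds hV
    exact ⟨x₀, B, hB, h x₀ hx x₀ hx, h x₀ hx x₀ hx⟩
  have huniv : W = univ := IsClopen.eq_univ ⟨hclosed, hopen⟩ hne
  obtain ⟨B, hB, hall⟩ : ∃ B : ℝ, 0 ≤ B ∧ ∀ y ∈ (univ : Set X), R B x₀ y ∧ R B y x₀ := by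
    -- The bound `B` may so far depend on the point. It is locally uniform, hence uniform by
    -- compactness.
    refine isCompact_univ.induction_on (p := fun S => ∃ B : ℝ, 0 ≤ B ∧
      ∀ y ∈ S, R B x₀ y ∧ R B y x₀) ⟨0, le_rfl, by simp⟩ ?_ ?_ ?_
    · rintro S S' hSS ⟨B, hB, h⟩
      exact ⟨B, hB, fun y hy => h y (hSS hy)⟩
    · rintro S S' ⟨B, hB, h⟩ ⟨B', hB', h'⟩
      refine ⟨B + B', by positivity, ?_⟩
      rintro y (hy | hy)
      · exact ⟨hmono (h y hy).1 (by linarith), hmono (h y hy).2 (by linarith)⟩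
      · exact ⟨hmono (h' y hy).1 (by linarith), hmono (h' y hy).2 (by linarith)⟩
    · intro y _
      obtain ⟨V, hV, B, hB, h⟩ := hloc y
      obtain ⟨B', hB', h1, h2⟩ : y ∈ W := by rw [huniv]; trivial
      have hy := mem_of_mem_nhds hV
      exact ⟨V, mem_nhdsWithin_of_mem_nhds hV, 2 * B + 2 * B', by positivity, fun z hz =>
        ⟨hmono (htrans h1 (h y hy z hz)) (by linarith), htrans (h z hz y hy) h2⟩⟩
  exact ⟨2 * B + 2 * B, by positivity, fun x y =>
    htrans (hall x trivial).2 (hall y trivial).1⟩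

end Chaining

end HermitianHarnack

/-! ### The parabolic Harnack inequality -/

theorem theorem5p3 {n : ℕ} {M : Type*} [TopologicalSpace M]
    [ChartedSpace (HermitianHarnack.Cn n) M] [IsManifold 𝓘(ℂ, HermitianHarnack.Cn n) ω M]
    [T2Space M] [CompactSpace M] [ConnectedSpace M]
    (g : HermitianHarnack.HermitianMetric n M) (A : HermitianHarnack.FiniteCover n M)
    (lam Lam : ℝ) (hlam : 0 < lam) (KG Kχ K₀ : ℝ≥0) :
    ∃ C₁ C₂ β : ℝ, 0 < C₁ ∧ 0 < C₂ ∧ 0 < β ∧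
      ∀ (T : EReal) (G : HermitianHarnack.HermitianCotensor n M)
        (χ : ∀ (_ : ℝ) (x : M), HermitianHarnack.HTangent n x)
        (χ₀ u : ℝ → M → ℝ),
        HermitianHarnack.IsCklOn 3 1 (HermitianHarnack.timeInterval T) G.comp →
        HermitianHarnack.IsCklOn 3 1 (HermitianHarnack.timeInterval T)
          (HermitianHarnack.vecComp χ) →
        HermitianHarnack.IsCklOn (n := n) 3 1 (HermitianHarnack.timeInterval T)
          (HermitianHarnack.funComp χ₀) →
        HermitianHarnack.UniformlyElliptic g lam Lam (HermitianHarnack.timeInterval T) G →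
        HermitianHarnack.cklNorm A 3 1 (HermitianHarnack.timeInterval T) G.comp ≤ KG →
        HermitianHarnack.cklNorm A 1 1 (HermitianHarnack.timeInterval T)
          (HermitianHarnack.vecComp χ) ≤ Kχ →
        HermitianHarnack.cklNorm A 1 1 (HermitianHarnack.timeInterval T)
          (HermitianHarnack.funComp χ₀) ≤ K₀ →
        HermitianHarnack.IsCklOn (n := n) 3 2 (HermitianHarnack.timeInterval T)
          (HermitianHarnack.funComp u) →
        (∀ t ∈ HermitianHarnack.timeInterval T, ∀ x : M, 0 < u t x) →
        HermitianHarnack.IsSolution (HermitianHarnack.timeInterval T) G χ χ₀ u →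
        ∀ t τ : ℝ, 0 < t → t < τ → (τ : EReal) < T →
          (⨆ z : M, u t z) ≤
            (τ / t) ^ β * Real.exp (C₁ / (τ - t) + C₂ * (τ - t)) * ⨅ z : M, u τ z := by
  open HermitianHarnack in
  obtain ⟨C, hC, hLY⟩ := exists_liYau_estimate g A Lam hlam KG Kχ K₀
  obtain ⟨B, hB, hH⟩ := exists_uniform_of_local (PointHarnack g A lam Lam KG Kχ K₀ (C / 2))
    PointHarnack.mono PointHarnack.trans (exists_local_pointHarnack g A hlam hLY)
  -- The chaining constant `B` is only known to be nonnegative; the added `1` makes `C₁` strictly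
  -- positive.
  refine ⟨B + 1, C / 2, C / 2, by positivity, by positivity, by positivity, ?_⟩
  intro T G χ χ₀ u hG hχ hχ₀ hell bG bχ bχ₀ hu hpos hsol t τ ht htτ hτT
  have hd : IsAdmissible g A lam Lam KG Kχ K₀ T G χ χ₀ u :=
    ⟨hG, hχ, hχ₀, hell, bG, bχ, bχ₀, hu, hpos, hsol⟩
  have hτ : τ ∈ timeInterval T := ⟨(ht.trans htτ).le, hτT⟩
  have htI : t ∈ timeInterval T := mem_timeInterval_of_le hτ ht.le htτ.le
  have hq : 0 < τ / t := div_pos (ht.trans htτ) ht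
  have hd0 : 0 < τ - t := sub_pos.2 htτ
  rw [Real.mul_iInf_of_nonneg (by positivity)]
  refine ciSup_le fun x => le_ciInf fun y => ?_
  have h1 := hH x y T G χ χ₀ u hd t τ ht htτ hτ
  have hx := hpos t htI x
  have hy := hpos τ hτ y
  rw [← Real.log_le_log_iff hx (by positivity), Real.log_mul (by positivity) hy.ne',
    Real.log_mul (by positivity) (Real.exp_pos _).ne', Real.log_exp, Real.log_rpow hq]
  have h2 : B / (τ - t) ≤ (B + 1) / (τ - t) := div_le_div_of_nonneg_right (by linarith) hd0.le
  linarith
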